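/- **Setting.** Let $\mathcal X_1,\mathcal X_2,\mathcal Y$ be finite alphabets and $W(y\mid x_1,x_2)$ a discrete memoryless multiple-access channel. A common message $w_0$, known to both transmitters, and private messages $w_1$ (known to transmitter 1) and $w_2$ (known to transmitter 2) are uniform and independent, with $\lceil 2^{nR_i}\rceil$ values ($R_i\ge 0$, $i=0,1,2$), and are all to be decoded by the receiver. The capacity region is the closure of the set of triples $(R_0,R_1,R_2)$ for which some codes of blocklength $n=1,2,\dots$ have average error probability tending to $0$. Logarithms are to base 2. For finite alphabets of $U_0,U_1,U_2$ and functions $x_1=f_1(u_0,u_1)$, $x_2=f_2(u_0,u_2)$, consider a codebook law and an encoding law with the same law of $U_0$, $$P^{c}=P_{U_0}P^{c}_{U_1|U_0}P^{c}_{U_2|U_0},\qquad P^{e}=P_{U_0}P^{e}_{U_1|U_0}P^{e}_{U_2|U_0}.$$ Mutual informations are taken under $P^{e}$ with $Y$ the output of $W$ for inputs $f_1(U_0,U_1)$, $f_2(U_0,U_2)$. Put $D_i=D(P^e_{U_i|U_0}\,\|\,P^c_{U_i|U_0}\mid P_{U_0})\in[0,\infty]$ for $i=1,2$ and $D=D(P^e\|P^c)$.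 Let $\mathcal R(P^c,P^e,f_1,f_2)$ be the set of all $(R_0,R_1,R_2,B_1,B_2)$ with nonnegative entries such that, with $L_i=R_i+B_i$, $$\begin{aligned} B_1&\ge D_1,\qquad B_2\ge D_2,\\ R_0+L_1+L_2&\le I(Y;U_0,U_1,U_2)+D,\\ L_1+L_2&\le I(Y;U_1,U_2\mid U_0)+D,\\ L_1&\le I(Y;U_1\mid U_0,U_2)+D_1,\\ L_2&\le I(Y;U_2\mid U_0,U_1)+D_2 . \end{aligned}$$ **Scheme.** Draw common codewords $U_0^n(w_0)$ i.i.d. from $P_{U_0}$ and, on top of each of them, for $i=1,2$, conditionally independent codewords $U_i^n(w_0,w_i,b_i)$, $1\le b_i\le\lceil 2^{nB_i}\rceil$, from $\prod_t P^{c}_{U_i|U_0}(\cdot\mid U_{0,t})$. Transmitter $i$ picks uniformly at random a bin index $b_i$ for which $(U_0^n(w_0),U_i^n(w_0,w_i,b_i))$ is $\varepsilon'$-typical for the law of $(U_0,U_i)$ under $P^{e}$ (any index, if there is none), and sends $f_i$ applied letter by letter. The receiver outputs the unique message triple that for some bin indices has codewords jointly $\varepsilon$-typical with $Y^n$ for the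 law of $(U_0,U_1,U_2,Y)$ under $P^e$, and otherwise declares an error. Here a sequence is $\varepsilon$-typical for $p$ if the empirical frequency of each letter $a$ is within $\varepsilon p(a)$ of $p(a)$. **Theorem.** 1. If $(R_0,R_1,R_2,B_1,B_2)$ has nonnegative entries and satisfies the six displayed inequalities strictly, then for all sufficiently small $\varepsilon>0$ and all sufficiently small $\varepsilon'>0$ (depending on $\varepsilon$) the error probability of the scheme, averaged over the random codebook, the messages, the choice of the bin indices and the channel, tends to $0$ as $n\to\infty$. 2. If $(R_0,R_1,R_2,B_1,B_2)\in\mathcal R(P^c,P^e,f_1,f_2)$, then $(R_0,R_1,R_2)$ belongs to the capacity region. 3. For every codebook law $P^c$ with $D_1,D_2<\infty$, the projection of $\mathcal R(P^c,P^e,f_1,f_2)$ to $(R_0,R_1,R_2)$ (elimination of the binning rates) is the set of nonnegative triples with $$\begin{aligned} R_0+R_1+R_2&\le I(Y;U_0,U_1,U_2), & R_1+R_2&\le I(Y;U_1,U_2\mid U_0),\\ R_1&\le I(Y;U_1\mid U_0,U_2), & R_2&\le I(Y;U_2\mid U_0,U_1), \end{aligned}$$ which does not depend on $P^c$. 4.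 The union of the projected regions over all finite auxiliary alphabets, all such pairs $(P^c,P^e)$ and all $f_1,f_2$ equals the union of the regions in 3 over all finite auxiliary alphabets, $P^e$ and $f_1,f_2$, and this union is the capacity region of the channel. -/

import Mathlib

open Filter Topology
open scoped ENNReal

noncomputable section

namespace MACCM

/-! ### Information measures on finite alphabets (in bits) -/

/-- The entropy `H(p)` in bits. -/
def entropy {α : Type*} [Fintype α] (p : PMF α) : ℝ :=
  (∑ a, Real.negMulLog (p a).toReal) / Real.log 2

/-- `I(A; B)` in bits, where `A` and `B` are functions of a sample drawn from `p`. -/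
def mutualInfo {Ω α β : Type*} [Fintype α] [Fintype β]
    (p : PMF Ω) (A : Ω → α) (B : Ω → β) : ℝ :=
  entropy (p.map A) + entropy (p.map B) - entropy (p.map fun ω => (A ω, B ω))

/-- `I(A; B | C)` in bits, where `A`, `B`, `C` are functions of a sample drawn from `p`. -/
def condMutualInfo {Ω α β γ : Type*} [Fintype α] [Fintype β] [Fintype γ]
    (p : PMF Ω) (A : Ω → α) (B : Ω → β) (C : Ω → γ) : ℝ :=
  entropy (p.map fun ω => (A ω, C ω)) + entropy (p.map fun ω => (B ω, C ω))
    - entropy (p.map fun ω => (A ω, B ω, C ω)) - entropy (p.map C)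

/-- The Kullback-Leibler divergence `D(p || q)` in bits; it is `∞` unless `p ≪ q`. -/
def divergence {α : Type*} (p q : PMF α) : ℝ≥0∞ :=
  letI : MeasurableSpace α := ⊤
  InformationTheory.klDiv p.toMeasure q.toMeasure / ENNReal.ofReal (Real.log 2)

/-- The conditional divergence `D(p || q | r) = ∑ u, r(u) D(p(· | u) || q(· | u))`. -/
def condDivergence {υ α : Type*} [Fintype υ] (p q : υ → PMF α) (r : PMF υ) : ℝ≥0∞ :=
  ∑ u, r u * divergence (p u) (q u)

/-! ### Product laws, typical sets -/

/-- The law of a vector with independent coordinates, the `i`-th one distributed as `p i`. -/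
def indepLaw {ι α : Type*} [Fintype ι] [Fintype α] (p : ι → PMF α) : PMF (ι → α) :=
  haveI : DecidableEq ι := Classical.decEq ι
  PMF.ofFintype (fun x => ∏ i, p i (x i)) (by
    rw [← Fintype.prod_sum fun i a => p i a]
    refine Finset.prod_eq_one fun i _ => ?_
    rw [← tsum_fintype (L := .unconditional _)]
    exact (p i).tsum_coe)

/-- The (robustly) `ε`-typical sequences of length `n` for `p`: the empirical frequency of every
letter `a` is within `ε * p a` of `p a`. -/
def typicalSet {α : Type*} (ε : ℝ) (p : PMF α) (n : ℕ) : Set (Fin n → α) :=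
  {x | ∀ a, |(Nat.card {i // x i = a} : ℝ) / n - (p a).toReal| ≤ ε * (p a).toReal}

/-! ### The channel, codes and the capacity region -/

/-- `n` uses of the memoryless channel `W`, with inputs `x₁` and `x₂`. -/
def channelOutput {X₁ X₂ Y : Type*} [Fintype Y] (W : X₁ → X₂ → PMF Y) {n : ℕ}
    (x₁ : Fin n → X₁) (x₂ : Fin n → X₂) : PMF (Fin n → Y) :=
  indepLaw fun i => W (x₁ i) (x₂ i)

/-- The number `⌈2 ^ (n R)⌉` of indices at rate `R` (in bits) and blocklength `n`. -/
def numIndices (n : ℕ) (R : ℝ) : ℕ := ⌈(2 : ℝ) ^ ((n : ℝ) * R)⌉₊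

instance (n : ℕ) (R : ℝ) : NeZero (numIndices n R) :=
  ⟨(Nat.ceil_pos.2 (Real.rpow_pos_of_pos two_pos _)).ne'⟩

/-- Rate triples `(R₀, R₁, R₂)`: common message, private message of transmitter 1, private
message of transmitter 2. -/
abbrev Rates : Type := ℝ × ℝ × ℝ

/-- The message triples `(w₀, w₁, w₂)` at blocklength `n` and rates `R`. -/
abbrev Messages (n : ℕ) (R : Rates) : Type :=
  Fin (numIndices n R.1) × Fin (numIndices n R.2.1) × Fin (numIndices n R.2.2)

/-- A code of blocklength `n` and rates `R`: transmitter `i` knows the common message and its own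
private message; the receiver estimates all three messages. -/
structure Code (X₁ X₂ Y : Type*) (n : ℕ) (R : Rates) where
  enc₁ : Fin (numIndices n R.1) → Fin (numIndices n R.2.1) → Fin n → X₁
  enc₂ : Fin (numIndices n R.1) → Fin (numIndices n R.2.2) → Fin n → X₂
  dec : (Fin n → Y) → Messages n R

/-- The average error probability of a code (independent, uniformly distributed messages). -/
def Code.errorProb {X₁ X₂ Y : Type*} [Fintype Y] (W : X₁ → X₂ → PMF Y) {n : ℕ} {R : Rates}
    (C : Code X₁ X₂ Y n R) : ℝ≥0∞ :=
  ((PMF.uniformOfFintype (Messages n R)).bind fun w =>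
    (channelOutput W (C.enc₁ w.1 w.2.1) (C.enc₂ w.1 w.2.2)).map fun y => (w, C.dec y)).toOuterMeasure
      {z | z.2 ≠ z.1}

/-- The nonnegative rate triple `R` is achieved by codes with vanishing average error. -/
def IsAchievable {X₁ X₂ Y : Type*} [Fintype Y] (W : X₁ → X₂ → PMF Y) (R : Rates) : Prop :=
  0 ≤ R.1 ∧ 0 ≤ R.2.1 ∧ 0 ≤ R.2.2 ∧
    ∃ C : ∀ n, Code X₁ X₂ Y n R, Tendsto (fun n => (C n).errorProb W) atTop (𝓝 0)

/-- The capacity region: the closure of the set of achievable rate triples. -/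
def capacityRegion {X₁ X₂ Y : Type*} [Fintype Y] (W : X₁ → X₂ → PMF Y) : Set Rates :=
  closure {R | IsAchievable W R}

/-! ### Codebook and encoding distributions -/

/-- A distribution that factors as `P_{U₀} P_{U₁ | U₀} P_{U₂ | U₀}`. -/
structure SuperpositionLaw (U₀ U₁ U₂ : Type*) where
  base : PMF U₀
  top₁ : U₀ → PMF U₁
  top₂ : U₀ → PMF U₂

namespace SuperpositionLaw

variable {U₀ U₁ U₂ X₁ X₂ Y : Type*}

/-- The joint law of `(U₀, U₁, U₂)`. -/
def law (P : SuperpositionLaw U₀ U₁ U₂) : PMF (U₀ × U₁ × U₂) :=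
  P.base.bind fun u₀ => (P.top₁ u₀).bind fun u₁ => (P.top₂ u₀).map fun u₂ => (u₀, u₁, u₂)

/-- The joint law of `(U₀, U₁)`. -/
def law₁ (P : SuperpositionLaw U₀ U₁ U₂) : PMF (U₀ × U₁) :=
  P.law.map fun u => (u.1, u.2.1)

/-- The joint law of `(U₀, U₂)`. -/
def law₂ (P : SuperpositionLaw U₀ U₁ U₂) : PMF (U₀ × U₂) :=
  P.law.map fun u => (u.1, u.2.2)

/-- The joint law of `((U₀, U₁, U₂), Y)` when `X₁ = f₁(U₀, U₁)` and `X₂ = f₂(U₀, U₂)` are sent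
over the channel `W`. -/
def lawWithOutput (P : SuperpositionLaw U₀ U₁ U₂) (W : X₁ → X₂ → PMF Y)
    (f₁ : U₀ → U₁ → X₁) (f₂ : U₀ → U₂ → X₂) : PMF ((U₀ × U₁ × U₂) × Y) :=
  P.law.bind fun u => (W (f₁ u.1 u.2.1) (f₂ u.1 u.2.2)).map fun y => (u, y)

variable [Fintype U₀] [Fintype U₁] [Fintype U₂] [Fintype Y]

/-- `I(Y; U₀, U₁, U₂)` -/
def infoAll (P : SuperpositionLaw U₀ U₁ U₂) (W : X₁ → X₂ → PMF Y)
    (f₁ : U₀ → U₁ → X₁) (f₂ : U₀ → U₂ → X₂) : ℝ :=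
  mutualInfo (P.lawWithOutput W f₁ f₂) (fun z => z.2) (fun z => z.1)

/-- `I(Y; U₁, U₂ | U₀)` -/
def infoBoth (P : SuperpositionLaw U₀ U₁ U₂) (W : X₁ → X₂ → PMF Y)
    (f₁ : U₀ → U₁ → X₁) (f₂ : U₀ → U₂ → X₂) : ℝ :=
  condMutualInfo (P.lawWithOutput W f₁ f₂) (fun z => z.2) (fun z => z.1.2) (fun z => z.1.1)

/-- `I(Y; U₁ | U₀, U₂)` -/
def info₁ (P : SuperpositionLaw U₀ U₁ U₂) (W : X₁ → X₂ → PMF Y)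
    (f₁ : U₀ → U₁ → X₁) (f₂ : U₀ → U₂ → X₂) : ℝ :=
  condMutualInfo (P.lawWithOutput W f₁ f₂) (fun z => z.2) (fun z => z.1.2.1)
    (fun z => (z.1.1, z.1.2.2))

/-- `I(Y; U₂ | U₀, U₁)` -/
def info₂ (P : SuperpositionLaw U₀ U₁ U₂) (W : X₁ → X₂ → PMF Y)
    (f₁ : U₀ → U₁ → X₁) (f₂ : U₀ → U₂ → X₂) : ℝ :=
  condMutualInfo (P.lawWithOutput W f₁ f₂) (fun z => z.2) (fun z => z.1.2.2)
    (fun z => (z.1.1, z.1.2.1))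

/-- `D(P_{U₁} || Q_{U₁} | P_{U₀})`, for the encoding law `P` and the codebook law `Q`. -/
def div₁ (P Q : SuperpositionLaw U₀ U₁ U₂) : ℝ≥0∞ := condDivergence P.top₁ Q.top₁ P.base

/-- `D(P_{U₂} || Q_{U₂} | P_{U₀})`, for the encoding law `P` and the codebook law `Q`. -/
def div₂ (P Q : SuperpositionLaw U₀ U₁ U₂) : ℝ≥0∞ := condDivergence P.top₂ Q.top₂ P.base

/-- `D(P_encoding || P_codebook)`, for the encoding law `P` and the codebook law `Q`. -/
def divAll (P Q : SuperpositionLaw U₀ U₁ U₂) : ℝ≥0∞ := divergence P.law Q.law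

/-! ### The rate regions -/

/-- The pairs of a rate triple `R = (R₀, R₁, R₂)` and a pair of binning rates `B = (B₁, B₂)`
satisfying the inequalities of superposition coding combined with binning, for the encoding law
`P` and the codebook law `Q`; the total rates are `L₁ = R₁ + B₁` and `L₂ = R₂ + B₂`. -/
def binningRegion (P Q : SuperpositionLaw U₀ U₁ U₂) (W : X₁ → X₂ → PMF Y)
    (f₁ : U₀ → U₁ → X₁) (f₂ : U₀ → U₂ → X₂) : Set (Rates × ℝ × ℝ) :=
  {z | ∃ R₀ R₁ R₂ B₁ B₂ L₁ L₂ : ℝ, z = ((R₀, R₁, R₂), B₁, B₂) ∧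
    0 ≤ R₀ ∧ 0 ≤ R₁ ∧ 0 ≤ R₂ ∧ 0 ≤ B₁ ∧ 0 ≤ B₂ ∧ L₁ = R₁ + B₁ ∧ L₂ = R₂ + B₂ ∧
    (P.div₁ Q : EReal) ≤ (B₁ : EReal) ∧
    (P.div₂ Q : EReal) ≤ (B₂ : EReal) ∧
    ((R₀ + L₁ + L₂ : ℝ) : EReal) ≤ (P.infoAll W f₁ f₂ : EReal) + (P.divAll Q : EReal) ∧
    ((L₁ + L₂ : ℝ) : EReal) ≤ (P.infoBoth W f₁ f₂ : EReal) + (P.divAll Q : EReal) ∧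
    (L₁ : EReal) ≤ (P.info₁ W f₁ f₂ : EReal) + (P.div₁ Q : EReal) ∧
    (L₂ : EReal) ≤ (P.info₂ W f₁ f₂ : EReal) + (P.div₂ Q : EReal)}

/-- The same inequalities as in `binningRegion`, with strict inequality in every constraint that
involves an information quantity. -/
def strictBinningRegion (P Q : SuperpositionLaw U₀ U₁ U₂) (W : X₁ → X₂ → PMF Y)
    (f₁ : U₀ → U₁ → X₁) (f₂ : U₀ → U₂ → X₂) : Set (Rates × ℝ × ℝ) :=
  {z | ∃ R₀ R₁ R₂ B₁ B₂ L₁ L₂ : ℝ, z = ((R₀, R₁, R₂), B₁, B₂) ∧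
    0 ≤ R₀ ∧ 0 ≤ R₁ ∧ 0 ≤ R₂ ∧ 0 ≤ B₁ ∧ 0 ≤ B₂ ∧ L₁ = R₁ + B₁ ∧ L₂ = R₂ + B₂ ∧
    (P.div₁ Q : EReal) < (B₁ : EReal) ∧
    (P.div₂ Q : EReal) < (B₂ : EReal) ∧
    ((R₀ + L₁ + L₂ : ℝ) : EReal) < (P.infoAll W f₁ f₂ : EReal) + (P.divAll Q : EReal) ∧
    ((L₁ + L₂ : ℝ) : EReal) < (P.infoBoth W f₁ f₂ : EReal) + (P.divAll Q : EReal) ∧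
    (L₁ : EReal) < (P.info₁ W f₁ f₂ : EReal) + (P.div₁ Q : EReal) ∧
    (L₂ : EReal) < (P.info₂ W f₁ f₂ : EReal) + (P.div₂ Q : EReal)}

/-- The classical Slepian-Wolf inequalities for the law `P`. -/
def slepianWolfRegion (P : SuperpositionLaw U₀ U₁ U₂) (W : X₁ → X₂ → PMF Y)
    (f₁ : U₀ → U₁ → X₁) (f₂ : U₀ → U₂ → X₂) : Set Rates :=
  {R | ∃ R₀ R₁ R₂ : ℝ, R = (R₀, R₁, R₂) ∧ 0 ≤ R₀ ∧ 0 ≤ R₁ ∧ 0 ≤ R₂ ∧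
    R₀ + R₁ + R₂ ≤ P.infoAll W f₁ f₂ ∧
    R₁ + R₂ ≤ P.infoBoth W f₁ f₂ ∧
    R₁ ≤ P.info₁ W f₁ f₂ ∧
    R₂ ≤ P.info₂ W f₁ f₂}

end SuperpositionLaw

/-- The rate triples `R` that satisfy, with some binning rates, the inequalities of
`SuperpositionLaw.binningRegion`; union over all finite auxiliary alphabets, all pairs of a codebook
law `Q` and an encoding law `P` with the same law of `U₀`, and all input maps. -/
def unionBinningRegion {X₁ X₂ Y : Type*} [Fintype Y] (W : X₁ → X₂ → PMF Y) : Set Rates :=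
  {R | ∃ (k₀ k₁ k₂ : ℕ) (P Q : SuperpositionLaw (Fin k₀) (Fin k₁) (Fin k₂))
    (f₁ : Fin k₀ → Fin k₁ → X₁) (f₂ : Fin k₀ → Fin k₂ → X₂),
    P.base = Q.base ∧ ∃ B : ℝ × ℝ, (R, B) ∈ P.binningRegion Q W f₁ f₂}

/-- The union of the Slepian-Wolf regions over all finite auxiliary alphabets, laws, input maps. -/
def unionSlepianWolfRegion {X₁ X₂ Y : Type*} [Fintype Y] (W : X₁ → X₂ → PMF Y) : Set Rates :=
  {R | ∃ (k₀ k₁ k₂ : ℕ) (P : SuperpositionLaw (Fin k₀) (Fin k₁) (Fin k₂))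
    (f₁ : Fin k₀ → Fin k₁ → X₁) (f₂ : Fin k₀ → Fin k₂ → X₂), R ∈ P.slepianWolfRegion W f₁ f₂}

/-! ### The random coding scheme: superposition followed by binning -/

/-- A codebook: for every `w₀` a common codeword `U₀ⁿ(w₀)` and, on top of it, codewords
`U₁ⁿ(w₀, w₁, b₁)` and `U₂ⁿ(w₀, w₂, b₂)` indexed by a private message and a bin index. -/
structure Codebook (U₀ U₁ U₂ : Type*) (n : ℕ) (R : Rates) (B : ℝ × ℝ) where
  word₀ : Fin (numIndices n R.1) → Fin n → U₀
  word₁ : Fin (numIndices n R.1) → Fin (numIndices n R.2.1) → Fin (numIndices n B.1) → Fin n → U₁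
  word₂ : Fin (numIndices n R.1) → Fin (numIndices n R.2.2) → Fin (numIndices n B.2) → Fin n → U₂

section Scheme

variable {U₀ U₁ U₂ X₁ X₂ Y : Type*} [Fintype U₀] [Fintype U₁] [Fintype U₂] [Fintype Y]

/-- Codebook generation: the common codewords are i.i.d. `Q_{U₀}`; given the common codeword
`U₀ⁿ(w₀)`, the codewords superposed on it are independent with memoryless conditional laws
`Q_{U₁ | U₀}` and `Q_{U₂ | U₀}`. -/
def codebookLaw (Q : SuperpositionLaw U₀ U₁ U₂) (n : ℕ) (R : Rates) (B : ℝ × ℝ) :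
    PMF (Codebook U₀ U₁ U₂ n R B) :=
  (indepLaw fun _ => indepLaw fun _ => Q.base).bind fun c₀ =>
  (indepLaw fun w₀ => indepLaw fun _ => indepLaw fun _ => indepLaw fun i =>
    Q.top₁ (c₀ w₀ i)).bind fun c₁ =>
  (indepLaw fun w₀ => indepLaw fun _ => indepLaw fun _ => indepLaw fun i =>
    Q.top₂ (c₀ w₀ i)).map fun c₂ => ⟨c₀, c₁, c₂⟩

open Classical in
/-- A bin index chosen at random among the suitable ones, or among all if none is suitable. -/
def chooseIndex {k : ℕ} [NeZero k] (S : Set (Fin k)) : PMF (Fin k) :=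
  if h : S.toFinset.Nonempty then PMF.uniformOfFinset S.toFinset h
  else PMF.uniformOfFintype (Fin k)

variable {n : ℕ} {R : Rates} {B : ℝ × ℝ}

/-- Transmitter 1 looks for a bin index `b₁` for which `(U₀ⁿ, U₁ⁿ)` is typical for the encoding
law. -/
def bin₁ (P : SuperpositionLaw U₀ U₁ U₂) (ε : ℝ) (C : Codebook U₀ U₁ U₂ n R B)
    (w₀ : Fin (numIndices n R.1)) (w₁ : Fin (numIndices n R.2.1)) : PMF (Fin (numIndices n B.1)) :=
  chooseIndex {b₁ | (fun i => (C.word₀ w₀ i, C.word₁ w₀ w₁ b₁ i)) ∈ typicalSet ε P.law₁ n}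

/-- Transmitter 2 looks for a bin index `b₂` for which `(U₀ⁿ, U₂ⁿ)` is typical for the encoding
law. -/
def bin₂ (P : SuperpositionLaw U₀ U₁ U₂) (ε : ℝ) (C : Codebook U₀ U₁ U₂ n R B)
    (w₀ : Fin (numIndices n R.1)) (w₂ : Fin (numIndices n R.2.2)) : PMF (Fin (numIndices n B.2)) :=
  chooseIndex {b₂ | (fun i => (C.word₀ w₀ i, C.word₂ w₀ w₂ b₂ i)) ∈ typicalSet ε P.law₂ n}

open Classical in
/-- The receiver looks for the unique message triple that, for some bin indices, has codewords
jointly typical with the channel output; it declares a failure (`none`) if there is no such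
triple or more than one. -/
def decode (P : SuperpositionLaw U₀ U₁ U₂) (W : X₁ → X₂ → PMF Y)
    (f₁ : U₀ → U₁ → X₁) (f₂ : U₀ → U₂ → X₂) (ε : ℝ) (C : Codebook U₀ U₁ U₂ n R B)
    (y : Fin n → Y) : Option (Messages n R) :=
  if h : ∃! w : Messages n R, ∃ b₁ b₂,
      (fun i => ((C.word₀ w.1 i, C.word₁ w.1 w.2.1 b₁ i, C.word₂ w.1 w.2.2 b₂ i), y i)) ∈
        typicalSet ε (P.lawWithOutput W f₁ f₂) n
  then some (Classical.choose h.exists) else none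

/-- The error probability of the random coding scheme of blocklength `n`, message rates `R` and
binning rates `B`, averaged over the codebooks (drawn with the codebook law `Q`), the messages, the
choice of the bin indices and the channel. The transmitters test typicality for the encoding law
`P` with tolerance `ε'`, the receiver with tolerance `ε`. -/
def schemeErrorProb (P Q : SuperpositionLaw U₀ U₁ U₂) (W : X₁ → X₂ → PMF Y)
    (f₁ : U₀ → U₁ → X₁) (f₂ : U₀ → U₂ → X₂) (R : Rates) (B : ℝ × ℝ) (ε ε' : ℝ) (n : ℕ) : ℝ≥0∞ :=
  ((codebookLaw Q n R B).bind fun C =>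
    (PMF.uniformOfFintype (Messages n R)).bind fun w =>
    (bin₁ P ε' C w.1 w.2.1).bind fun b₁ =>
    (bin₂ P ε' C w.1 w.2.2).bind fun b₂ =>
    (channelOutput W
      (fun i => f₁ (C.word₀ w.1 i) (C.word₁ w.1 w.2.1 b₁ i))
      (fun i => f₂ (C.word₀ w.1 i) (C.word₂ w.1 w.2.2 b₂ i))).map fun y =>
    (w, decode P W f₁ f₂ ε C y)).toOuterMeasure {z | z.2 ≠ some z.1}

end Scheme

end MACCM

end

open MACCM

/-!
The achievability part rests on the expectation, over the random codebook, of the indicator of a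
decoding error. The law of the selected bin index is awkward, but outside of an exceptional set of
codebooks it is dominated by the uniform law on the bin times a weight (`chooseIndex_le`) that turns
the codebook law `Q` of the selected codeword into the encoding law `P`, up to a factor that is
exponential with an arbitrarily small exponent (`mul_binWeight_le`). The exceptional codebooks are
those in which a bin holds too few codewords typical for `P`; they are unlikely once the binning
rates exceed the divergences `D₁`, `D₂` (`tendsto_binFailure`). After this change of measure the
sent codewords are memoryless with law `P`, while the wrong ones, including those with the right
message and a wrong bin index, still have the law `Q`. The union bound (`schemeErrorProb_le`) has
one term for each class of wrong index tuples, and its exponent is the divergence of the law of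
`(U₀, U₁, U₂, Y)` under `P` from the law of the tested tuple. This divergence is the information
plus the divergence of `P` from `Q` on the wrong codewords (`relEnt_testAll` and its companions),
so the rate constraints gain exactly what binning costs. The tail bounds are Chernoff bounds.

Eliminating the binning rates is then linear arithmetic (`image_binningRegion`). The region of weak
inequalities may have no point with strict inequalities, for instance when one of the informations
is zero; its achievability therefore goes through the Slepian-Wolf region, with `Q = P` and bins of
one codeword. There a class of wrong tuples that would need an index of a message of rate zero is
empty, so that no strict inequality is needed for it (`slepianWolfRegion_subset_capacityRegion`).

For the converse, Gibbs' inequality gives a Fano-type bound for one message sent over independent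
but not identical channels (`successProb_mul_log_card_le`). Applied to all messages, to the two
private messages given `w₀`, and to each private message given the others, it bounds the rates of a
code by single-letter informations, averaged over the time and the common message. Conditionally on
`w₀` the two inputs are independent, so the averages form a point in the convex hull of the points
`ratePoint W (p, q)` of product inputs. This hull is compact by Carathéodory's theorem and does not
depend on the blocklength. Hence limits of achievable rates are still bounded by a point of the hull
(`exists_supports_of_tendsto`), and each of its points comes from a superposition law with finite
alphabets (`exists_hullPoint_eq`).
-/

noncomputable section

namespace MACCM

/-! ### Expectations with respect to probability mass functions -/

/-- The expectation of a nonnegative function of a sample drawn from `p`. No measurability or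
summability is involved, so that expectations over codebooks, messages and outputs commute. -/
def expect {α : Type*} (p : PMF α) (f : α → ℝ≥0∞) : ℝ≥0∞ := ∑' a, p a * f a

section Expect

variable {α β γ : Type*}

lemma expect_eq_sum [Fintype α] (p : PMF α) (f : α → ℝ≥0∞) : expect p f = ∑ a, p a * f a :=
  tsum_fintype _

lemma expect_mono {p : PMF α} {f g : α → ℝ≥0∞} (h : ∀ a, f a ≤ g a) : expect p f ≤ expect p g :=
  ENNReal.tsum_le_tsum fun a => by gcongr; exact h a

@[simp] lemma expect_const (p : PMF α) (c : ℝ≥0∞) : expect p (fun _ => c) = c := by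
  simp [expect, ENNReal.tsum_mul_right, p.tsum_coe]

lemma expect_le_of_le {p : PMF α} {f : α → ℝ≥0∞} {c : ℝ≥0∞} (h : ∀ a, f a ≤ c) :
    expect p f ≤ c := (expect_mono h).trans_eq (expect_const p c)

lemma expect_add (p : PMF α) (f g : α → ℝ≥0∞) :
    expect p (fun a => f a + g a) = expect p f + expect p g := by
  simp [expect, mul_add, ENNReal.tsum_add]

lemma expect_sum {ι : Type*} (s : Finset ι) (p : PMF α) (f : ι → α → ℝ≥0∞) :
    expect p (fun a => ∑ i ∈ s, f i a) = ∑ i ∈ s, expect p (f i) := by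
  simp only [expect, Finset.mul_sum]
  exact Summable.tsum_finsetSum fun _ _ => ENNReal.summable

lemma expect_mul_left (p : PMF α) (c : ℝ≥0∞) (f : α → ℝ≥0∞) :
    expect p (fun a => c * f a) = c * expect p f := by
  simp [expect, mul_left_comm, ENNReal.tsum_mul_left]

lemma expect_pure (a : α) (f : α → ℝ≥0∞) : expect (PMF.pure a) f = f a := by
  rw [expect, tsum_eq_single a]
  · simp
  · intro b hb; simp [hb]

lemma expect_bind (p : PMF α) (k : α → PMF β) (f : β → ℝ≥0∞) :
    expect (p.bind k) f = expect p fun a => expect (k a) f := by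
  simp only [expect, PMF.bind_apply, ← ENNReal.tsum_mul_right, ← ENNReal.tsum_mul_left, mul_assoc]
  rw [ENNReal.tsum_comm]

lemma expect_map (p : PMF α) (h : α → β) (f : β → ℝ≥0∞) :
    expect (p.map h) f = expect p fun a => f (h a) := by
  rw [← PMF.bind_pure_comp, expect_bind]
  simp [expect_pure]

lemma expect_comm (p : PMF α) (q : PMF β) (f : α → β → ℝ≥0∞) :
    (expect p fun a => expect q fun b => f a b) = expect q fun b => expect p fun a => f a b := by
  simp only [expect, ← ENNReal.tsum_mul_left]
  rw [ENNReal.tsum_comm]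
  simp only [mul_left_comm]

lemma toOuterMeasure_eq_expect (p : PMF α) (s : Set α) :
    p.toOuterMeasure s = expect p (s.indicator 1) := by
  rw [PMF.toOuterMeasure_apply, expect]
  congr 1 with a
  by_cases h : a ∈ s <;> simp [h]

lemma apply_eq_expect [DecidableEq α] (p : PMF α) (a : α) :
    p a = expect p fun b => if b = a then 1 else 0 := by
  simp [expect]

lemma pmf_ext_expect {p q : PMF α} (h : ∀ f, expect p f = expect q f) : p = q := by
  classical
  ext a
  rw [apply_eq_expect, apply_eq_expect, h]

/-- Markov's inequality at level `1/2`. -/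
lemma expect_indicator_half_le (p : PMF α) (f : α → ℝ≥0∞) :
    expect p ({a | 2⁻¹ < f a}.indicator 1) ≤ 2 * expect p f := by
  rw [← expect_mul_left]
  refine expect_mono fun a => ?_
  by_cases h : 2⁻¹ < f a
  · rw [Set.indicator_of_mem (by exact h)]
    calc (1 : ℝ≥0∞) = 2 * 2⁻¹ := (ENNReal.mul_inv_cancel (by simp) (by simp)).symm
      _ ≤ _ := by gcongr
  · rw [Set.indicator_of_notMem (by exact h)]; exact zero_le

lemma exists_le_of_expect_le {p : PMF α} {f : α → ℝ≥0∞} {c : ℝ≥0∞} (h : expect p f ≤ c) :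
    ∃ a, f a ≤ c := by
  by_contra! hc
  obtain ⟨a₀, ha₀⟩ := p.support_nonempty
  have hlt : expect p (fun _ => c) < expect p f := by
    refine ENNReal.tsum_lt_tsum (i := a₀) ?_ (fun a => by gcongr; exact (hc a).le) ?_
    · simp only [ENNReal.tsum_mul_right, p.tsum_coe, one_mul]
      exact (hc a₀).ne_top
    · exact ENNReal.mul_lt_mul_right ha₀ (p.apply_ne_top _) (hc a₀)
  rw [expect_const] at hlt
  exact absurd h (not_le.2 hlt)

end Expect

/-! ### Vectors with independent coordinates -/

section IndepLaw

variable {ι α β : Type*} [Fintype ι] [Fintype α] [Fintype β]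

lemma indepLaw_apply (p : ι → PMF α) (x : ι → α) : indepLaw p x = ∏ i, p i (x i) := rfl

lemma expect_indepLaw_prod (p : ι → PMF α) (h : ι → α → ℝ≥0∞) :
    expect (indepLaw p) (fun x => ∏ i, h i (x i)) = ∏ i, expect (p i) (h i) := by
  classical
  rw [expect_eq_sum]
  simp only [expect_eq_sum, indepLaw_apply, ← Finset.prod_mul_distrib]
  rw [Fintype.prod_sum fun i a => p i a * h i a]

/-- Drawing independent coordinates in two stages is the same as drawing each of them in two
stages. -/
lemma indepLaw_bind (p : ι → PMF α) (k : ι → α → PMF β) :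
    (indepLaw fun i => (p i).bind (k i)) =
      (indepLaw p).bind fun a => indepLaw fun i => k i (a i) := by
  classical
  ext y
  rw [PMF.bind_apply]
  change _ = expect (indepLaw p) fun a => ∏ i, k i (a i) (y i)
  rw [expect_indepLaw_prod p fun i a => k i a (y i)]
  rfl

lemma indepLaw_pure (x : ι → α) : (indepLaw fun i => PMF.pure (x i)) = PMF.pure x := by
  classical
  ext y
  rw [indepLaw_apply, PMF.pure_apply]
  split_ifs with h
  · subst h; simp
  · obtain ⟨i, hi⟩ := Function.ne_iff.1 h
    exact Finset.prod_eq_zero (Finset.mem_univ i) (by simp [hi])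

lemma indepLaw_map (p : ι → PMF α) (h : ι → α → β) :
    (indepLaw fun i => (p i).map (h i)) = (indepLaw p).map fun x i => h i (x i) := by
  simp only [← PMF.bind_pure_comp, indepLaw_bind]
  congr 1
  ext1 x
  exact indepLaw_pure fun i => h i (x i)

lemma expect_indepLaw_bind (p : ι → PMF α) (k : ι → α → PMF β) (f : (ι → β) → ℝ≥0∞) :
    expect (indepLaw fun i => (p i).bind (k i)) f =
      expect (indepLaw p) fun a => expect (indepLaw fun i => k i (a i)) f := by
  rw [indepLaw_bind, expect_bind]

lemma expect_indepLaw_map (p : ι → PMF α) (h : ι → α → β) (f : (ι → β) → ℝ≥0∞) :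
    expect (indepLaw fun i => (p i).map (h i)) f =
      expect (indepLaw p) fun x => f fun i => h i (x i) := by
  rw [indepLaw_map, expect_map]

/-- Two different coordinates are independent, with the prescribed laws. -/
lemma expect_indepLaw_pair (p : ι → PMF α) {i j : ι} (hij : i ≠ j) (f : α → α → ℝ≥0∞) :
    expect (indepLaw p) (fun x => f (x i) (x j)) =
      expect (p i) fun a => expect (p j) fun b => f a b := by
  classical
  have h1 : ∀ x : ι → α, f (x i) (x j) =
      ∑ a, ∑ b, f a b * ∏ k, (if k = i then (if x k = a then 1 else 0) else
        if k = j then (if x k = b then 1 else 0) else 1 : ℝ≥0∞) := by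
    intro x
    have h2 : ∀ a b, (∏ k, (if k = i then (if x k = a then 1 else 0) else
        if k = j then (if x k = b then 1 else 0) else 1 : ℝ≥0∞)) =
        (if x i = a then 1 else 0) * (if x j = b then 1 else 0) := by
      intro a b
      rw [← Finset.mul_prod_erase _ _ (Finset.mem_univ i),
        ← Finset.mul_prod_erase _ _ (Finset.mem_erase.2 ⟨hij.symm, Finset.mem_univ j⟩),
        Finset.prod_eq_one]
      · simp [hij.symm]
      · intro k hk
        simp only [Finset.mem_erase] at hk
        simp [hk.1, hk.2.1]
    simp [h2]
  simp only [h1, expect_sum, expect_mul_left]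
  have h3 : ∀ a b, expect (indepLaw p) (fun x => ∏ k, (if k = i then (if x k = a then 1 else 0) else
        if k = j then (if x k = b then 1 else 0) else 1 : ℝ≥0∞)) = p i a * p j b := by
    intro a b
    rw [expect_indepLaw_prod p (fun k y => (if k = i then (if y = a then 1 else 0) else
        if k = j then (if y = b then 1 else 0) else 1 : ℝ≥0∞))]
    rw [← Finset.mul_prod_erase _ _ (Finset.mem_univ i),
      ← Finset.mul_prod_erase _ _ (Finset.mem_erase.2 ⟨hij.symm, Finset.mem_univ j⟩),
      Finset.prod_eq_one]
    · simp [hij.symm, ← apply_eq_expect]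
    · intro k hk
      simp only [Finset.mem_erase] at hk
      simp [hk.1, hk.2.1]
  simp only [h3, expect_eq_sum, Finset.mul_sum]
  exact Finset.sum_congr rfl fun a _ => Finset.sum_congr rfl fun b _ => by ring

lemma expect_indepLaw_eval (p : ι → PMF α) (i : ι) (f : α → ℝ≥0∞) :
    expect (indepLaw p) (fun x => f (x i)) = expect (p i) f := by
  classical
  have h := expect_indepLaw_prod p fun k y => if k = i then f y else 1
  have h1 : ∀ x : ι → α, (∏ k, if k = i then f (x k) else 1) = f (x i) := by
    intro x; simp
  have h2 : (∏ k, expect (p k) fun y => if k = i then f y else 1) = expect (p i) f := by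
    rw [Finset.prod_eq_single i]
    · simp
    · intro k _ hk; simp [hk]
    · simp
  simpa only [h1, h2] using h

end IndepLaw

/-! ### Typical sequences: likelihood ratios and concentration -/

/-- The relative entropy `∑ a, p a * log (p a / q a)` in nats. It is the divergence only when
`p ≪ q`: elsewhere the letters with `q a = 0` contribute `0`. -/
def relEnt {α : Type*} [Fintype α] (p q : PMF α) : ℝ :=
  ∑ a, (p a).toReal * Real.log ((p a).toReal / (q a).toReal)

/-- The mean absolute value of the log-likelihood ratio, which bounds the fluctuation of the
log-likelihood ratio over the typical sequences. -/
def relEntAbs {α : Type*} [Fintype α] (p q : PMF α) : ℝ :=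
  ∑ a, (p a).toReal * |Real.log ((p a).toReal / (q a).toReal)|

section Typical

variable {α : Type*} [Fintype α]

lemma expect_mono_support {β : Type*} {p : PMF β} {f g : β → ℝ≥0∞}
    (h : ∀ a, p a ≠ 0 → f a ≤ g a) : expect p f ≤ expect p g :=
  ENNReal.tsum_le_tsum fun a => by
    by_cases ha : p a = 0
    · simp [ha]
    · gcongr; exact h a ha

lemma sum_toReal_eq_one (p : PMF α) : ∑ a, (p a).toReal = 1 := by
  rw [← ENNReal.toReal_sum fun a _ => p.apply_ne_top a, ← tsum_fintype (L := .unconditional _),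
    p.tsum_coe]
  rfl

lemma toReal_pos_of_ne {β : Type*} {p : PMF β} {a : β} (h : p a ≠ 0) : 0 < (p a).toReal :=
  ENNReal.toReal_pos h (p.apply_ne_top a)

lemma expect_ofReal (p : PMF α) (f : α → ℝ) (hf : ∀ a, 0 ≤ f a) :
    expect p (fun a => ENNReal.ofReal (f a)) = ENNReal.ofReal (∑ a, (p a).toReal * f a) := by
  rw [expect_eq_sum, ENNReal.ofReal_sum_of_nonneg fun a _ => by have := hf a; positivity]
  refine Finset.sum_congr rfl fun a _ => ?_
  rw [ENNReal.ofReal_mul ENNReal.toReal_nonneg, ENNReal.ofReal_toReal (p.apply_ne_top a)]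

lemma card_eq_sum_ite {β : Type*} [DecidableEq β] {n : ℕ} (x : Fin n → β) (a : β) :
    (Nat.card {i // x i = a} : ℝ) = ∑ i, if x i = a then 1 else 0 := by
  rw [Nat.card_eq_fintype_card, Fintype.card_subtype, Finset.sum_boole]

lemma sum_comp_eq_sum_card {n : ℕ} (x : Fin n → α) (φ : α → ℝ) :
    ∑ i, φ (x i) = ∑ a, (Nat.card {i // x i = a} : ℝ) * φ a := by
  classical
  simp only [card_eq_sum_ite, Finset.sum_mul]
  rw [Finset.sum_comm]
  simp

variable {ε : ℝ} {p g : PMF α} {n : ℕ} {x : Fin n → α}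

lemma abs_sum_sub_le_of_mem_typicalSet (hn : 0 < n) (hx : x ∈ typicalSet ε p n) (φ : α → ℝ) :
    |∑ i, φ (x i) - n * ∑ a, (p a).toReal * φ a| ≤ n * (ε * ∑ a, (p a).toReal * |φ a|) := by
  have hn' : (0 : ℝ) < n := by exact_mod_cast hn
  have h : ∑ i, φ (x i) - n * ∑ a, (p a).toReal * φ a =
      n * ∑ a, ((Nat.card {i // x i = a} : ℝ) / n - (p a).toReal) * φ a := by
    rw [sum_comp_eq_sum_card, Finset.mul_sum, Finset.mul_sum, ← Finset.sum_sub_distrib]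
    refine Finset.sum_congr rfl fun a _ => ?_
    field_simp
  rw [h, abs_mul, abs_of_pos hn', Finset.mul_sum]
  gcongr
  refine (Finset.abs_sum_le_sum_abs _ _).trans (Finset.sum_le_sum fun a _ => ?_)
  rw [abs_mul, ← mul_assoc]
  gcongr
  exact hx a

lemma ne_zero_of_mem_typicalSet {β : Type*} {p : PMF β} {x : Fin n → β} (hn : 0 < n)
    (hx : x ∈ typicalSet ε p n) (i : Fin n) :
    p (x i) ≠ 0 := by
  intro h
  have h1 := hx (x i)
  rw [h] at h1
  simp only [ENNReal.toReal_zero, sub_zero, mul_zero, abs_nonpos_iff, div_eq_zero_iff,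
    Nat.cast_eq_zero, hn.ne', or_false] at h1
  have : Nonempty {j // x j = x i} := ⟨⟨i, rfl⟩⟩
  exact Nat.card_pos.ne' h1

/-- Change of measure from `g` to `p`, with the log-likelihood ratio in the exponent. -/
lemma indepLaw_eq_exp_mul (hg : ∀ a, p a ≠ 0 → g a ≠ 0) (hx : ∀ i, p (x i) ≠ 0) :
    indepLaw (fun _ => g) x = ENNReal.ofReal
      (Real.exp (-∑ i, Real.log ((p (x i)).toReal / (g (x i)).toReal))) *
        indepLaw (fun _ => p) x := by
  rw [indepLaw_apply, indepLaw_apply, ← Finset.sum_neg_distrib, Real.exp_sum,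
    ENNReal.ofReal_prod_of_nonneg fun i _ => (Real.exp_pos _).le, ← Finset.prod_mul_distrib]
  refine Finset.prod_congr rfl fun i _ => ?_
  have h1 := toReal_pos_of_ne (hx i)
  have h2 := toReal_pos_of_ne (hg _ (hx i))
  rw [Real.exp_neg, Real.exp_log (by positivity)]
  nth_rw 2 [← ENNReal.ofReal_toReal (p.apply_ne_top (x i))]
  rw [← ENNReal.ofReal_mul (by positivity), inv_div, div_mul_cancel₀ _ h1.ne',
    ENNReal.ofReal_toReal (g.apply_ne_top _)]

lemma indepLaw_le_of_mem_typicalSet (hn : 0 < n) (hg : ∀ a, p a ≠ 0 → g a ≠ 0)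
    (hx : x ∈ typicalSet ε p n) :
    indepLaw (fun _ => g) x ≤ ENNReal.ofReal
      (Real.exp (-(n * (relEnt p g - ε * relEntAbs p g)))) * indepLaw (fun _ => p) x := by
  rw [indepLaw_eq_exp_mul hg (ne_zero_of_mem_typicalSet hn hx)]
  have h := abs_le.1 (abs_sum_sub_le_of_mem_typicalSet hn hx
    fun a => Real.log ((p a).toReal / (g a).toReal))
  gcongr
  have h1 := h.1
  rw [relEnt, relEntAbs]
  linarith

lemma le_indepLaw_of_mem_typicalSet (hn : 0 < n) (hg : ∀ a, p a ≠ 0 → g a ≠ 0)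
    (hx : x ∈ typicalSet ε p n) :
    ENNReal.ofReal (Real.exp (-(n * (relEnt p g + ε * relEntAbs p g)))) * indepLaw (fun _ => p) x ≤
      indepLaw (fun _ => g) x := by
  rw [indepLaw_eq_exp_mul hg (ne_zero_of_mem_typicalSet hn hx)]
  have h := abs_le.1 (abs_sum_sub_le_of_mem_typicalSet hn hx
    fun a => Real.log ((p a).toReal / (g a).toReal))
  gcongr
  have h1 := h.2
  rw [relEnt, relEntAbs]
  linarith

/-- Under the memoryless law `g`, the typical sequences for `p` have probability about
`exp (-n D(p‖g))`. -/
lemma expect_typicalSet_le (hn : 0 < n) (hg : ∀ a, p a ≠ 0 → g a ≠ 0) :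
    expect (indepLaw fun _ : Fin n => g) ((typicalSet ε p n).indicator 1) ≤
      ENNReal.ofReal (Real.exp (-(n * (relEnt p g - ε * relEntAbs p g)))) := by
  calc _ ≤ ∑' x, ENNReal.ofReal (Real.exp (-(n * (relEnt p g - ε * relEntAbs p g)))) *
        indepLaw (fun _ : Fin n => p) x := by
        refine ENNReal.tsum_le_tsum fun x => ?_
        by_cases hx : x ∈ typicalSet ε p n
        · simpa [hx] using indepLaw_le_of_mem_typicalSet hn hg hx
        · simp [hx]
    _ = _ := by rw [ENNReal.tsum_mul_left, PMF.tsum_coe, mul_one]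

/-- The single-letter exponential moment behind the Chernoff bound: `s = 1` is the upper and
`s = -1` the lower tail. The exponent `ε / 2` is the minimizer of `-t ε + t ^ 2`, the bound that
comes from `exp x ≤ 1 + x + x ^ 2` for `|x| ≤ 1`. -/
lemma sum_mul_exp_le [DecidableEq α] (hε : 0 < ε) (hε1 : ε ≤ 1) (p : PMF α) (a : α) {s : ℝ}
    (hs : s ^ 2 = 1) :
    ∑ b, (p b).toReal * Real.exp (ε / 2 * (s * ((if b = a then 1 else 0) - (p a).toReal) -
      ε * (p a).toReal)) ≤ Real.exp (-((p a).toReal * ε ^ 2 / 4)) := by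
  set q := (p a).toReal with hq
  have hq0 : 0 ≤ q := ENNReal.toReal_nonneg
  set t := ε / 2 with ht
  have h1 : ∀ b, (p b).toReal * Real.exp (t * (s * ((if b = a then 1 else 0) - q) - ε * q)) =
      Real.exp (-(t * (s * q + ε * q))) *
        ((p b).toReal + if b = a then q * (Real.exp (t * s) - 1) else 0) := by
    intro b
    by_cases hb : b = a
    · subst hb
      rw [if_pos rfl, if_pos rfl, ← hq, show t * (s * (1 - q) - ε * q) =
        -(t * (s * q + ε * q)) + t * s by ring, Real.exp_add]
      ring
    · rw [if_neg hb, if_neg hb, show t * (s * (0 - q) - ε * q) = -(t * (s * q + ε * q)) by ring]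
      ring
  have hts : |t * s| ≤ 1 := by
    refine abs_le_one_iff_mul_self_le_one.2 ?_
    have : t * s * (t * s) = t ^ 2 * s ^ 2 := by ring
    rw [this, hs]
    nlinarith
  have h2 : Real.exp (t * s) - 1 ≤ t * s + t ^ 2 := by
    have := (abs_le.1 (Real.abs_exp_sub_one_sub_id_le hts)).2
    have h3 : (t * s) ^ 2 = t ^ 2 := by rw [mul_pow, hs, mul_one]
    linarith
  simp only [h1]
  rw [← Finset.mul_sum, Finset.sum_add_distrib, sum_toReal_eq_one]
  simp only [Finset.sum_ite_eq', Finset.mem_univ, if_true]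
  calc _ ≤ Real.exp (-(t * (s * q + ε * q))) * Real.exp (q * (t * s + t ^ 2)) := by
        gcongr
        calc 1 + q * (Real.exp (t * s) - 1) ≤ 1 + q * (t * s + t ^ 2) := by gcongr
          _ ≤ _ := by rw [add_comm]; exact Real.add_one_le_exp _
    _ = Real.exp (-(q * ε ^ 2 / 4)) := by rw [← Real.exp_add, ht]; ring_nf

lemma expect_tail_le [DecidableEq α] (hε : 0 < ε) (hε1 : ε ≤ 1) (p : PMF α) (n : ℕ) (a : α)
    {s : ℝ} (hs : s ^ 2 = 1) :
    expect (indepLaw fun _ : Fin n => p) (fun x => ∏ i, ENNReal.ofReal (Real.exp (ε / 2 *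
      (s * ((if x i = a then 1 else 0) - (p a).toReal) - ε * (p a).toReal)))) ≤
      ENNReal.ofReal (Real.exp (-(n * ((p a).toReal * ε ^ 2 / 4)))) := by
  rw [expect_indepLaw_prod (fun _ => p) fun _ y => ENNReal.ofReal (Real.exp (ε / 2 *
      (s * ((if y = a then 1 else 0) - (p a).toReal) - ε * (p a).toReal)))]
  rw [Finset.prod_const, Finset.card_univ, Fintype.card_fin, ← mul_neg, Real.exp_nat_mul,
    ENNReal.ofReal_pow (Real.exp_pos _).le]
  gcongr
  rw [expect_ofReal _ _ fun _ => (Real.exp_pos _).le]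
  exact ENNReal.ofReal_le_ofReal (sum_mul_exp_le hε hε1 p a hs)

/-- Atypical sequences are exponentially unlikely. Letters outside of the support of `p` do not
matter, and the exponent is governed by the smallest mass of the others. -/
theorem exists_expect_atypical_le (hε : 0 < ε) (hε1 : ε ≤ 1) (p : PMF α) :
    ∃ c : ℝ, 0 < c ∧ ∀ n : ℕ, 0 < n →
      expect (indepLaw fun _ : Fin n => p) ((typicalSet ε p n)ᶜ.indicator 1) ≤
        ENNReal.ofReal (2 * Fintype.card α * Real.exp (-(n * c))) := by
  classical
  obtain ⟨m, hm0, hm⟩ : ∃ m : ℝ, 0 < m ∧ ∀ a, p a ≠ 0 → m ≤ (p a).toReal := by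
    obtain ⟨a₀, h₀⟩ := p.support_nonempty
    obtain ⟨a, ha, hmin⟩ := Finset.exists_min_image (Finset.univ.filter fun a => p a ≠ 0)
      (fun a => (p a).toReal) ⟨a₀, by simpa using h₀⟩
    exact ⟨_, toReal_pos_of_ne (Finset.mem_filter.1 ha).2, fun b hb => hmin b (by simpa using hb)⟩
  refine ⟨m * ε ^ 2 / 4, by positivity, fun n hn => ?_⟩
  have hn' : (0 : ℝ) < n := by exact_mod_cast hn
  set T : α → ℝ → (Fin n → α) → ℝ≥0∞ := fun a s x => ∏ i, ENNReal.ofReal (Real.exp (ε / 2 *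
      (s * ((if x i = a then 1 else 0) - (p a).toReal) - ε * (p a).toReal))) with hT
  have hT1 : ∀ a s x, ε * (p a).toReal <
      s * ((Nat.card {i // x i = a} : ℝ) / n - (p a).toReal) → 1 ≤ T a s x := by
    intro a s x h
    rw [hT]
    simp only
    rw [← ENNReal.ofReal_prod_of_nonneg fun i _ => (Real.exp_pos _).le, ← Real.exp_sum,
      ENNReal.one_le_ofReal, Real.one_le_exp_iff, ← Finset.mul_sum, Finset.sum_sub_distrib,
      ← Finset.mul_sum, Finset.sum_sub_distrib, ← card_eq_sum_ite]
    simp only [Finset.sum_const, Finset.card_univ, Fintype.card_fin, nsmul_eq_mul]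
    have h1 : 0 ≤ n * (s * ((Nat.card {i // x i = a} : ℝ) / n - (p a).toReal) -
      ε * (p a).toReal) := by
      have := sub_pos.2 h
      positivity
    have h2 : s * ((Nat.card {i // x i = a} : ℝ) - n * (p a).toReal) - n * (ε * (p a).toReal) =
      n * (s * ((Nat.card {i // x i = a} : ℝ) / n - (p a).toReal) - ε * (p a).toReal) := by
      field_simp
    rw [h2]
    positivity
  have hpt : ∀ x : Fin n → α, indepLaw (fun _ => p) x ≠ 0 →
      (typicalSet ε p n)ᶜ.indicator 1 x ≤ ∑ a, if p a = 0 then 0 else (T a 1 x + T a (-1) x) := by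
    intro x hx
    by_cases hxt : x ∈ typicalSet ε p n
    · simp [hxt]
    rw [Set.indicator_of_mem hxt, Pi.one_apply]
    simp only [typicalSet, Set.mem_ofPred_eq, not_forall, not_le] at hxt
    obtain ⟨a, ha⟩ := hxt
    refine le_trans ?_ (Finset.single_le_sum (fun _ _ => zero_le) (Finset.mem_univ a))
    have hpa : p a ≠ 0 := by
      intro h0
      have : IsEmpty {i // x i = a} := ⟨fun ⟨i, hi⟩ => by
        rw [indepLaw_apply] at hx
        exact Finset.prod_ne_zero_iff.1 hx i (Finset.mem_univ i) (by rw [hi, h0])⟩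
      simp [h0] at ha
    rw [if_neg hpa]
    rcases lt_abs.1 ha with h | h
    · exact (hT1 a 1 x (by linarith)).trans le_self_add
    · exact (hT1 a (-1) x (by linarith)).trans le_add_self
  have hbound : ∀ a s, s ^ 2 = 1 → p a ≠ 0 → expect (indepLaw fun _ : Fin n => p) (T a s) ≤
      ENNReal.ofReal (Real.exp (-(n * (m * ε ^ 2 / 4)))) := by
    intro a s hs ha
    refine (expect_tail_le hε hε1 p n a hs).trans (ENNReal.ofReal_le_ofReal ?_)
    have := hm a ha
    gcongr
  calc _ ≤ expect (indepLaw fun _ : Fin n => p)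
        (fun x => ∑ a, if p a = 0 then 0 else (T a 1 x + T a (-1) x)) := expect_mono_support hpt
    _ ≤ ∑ a : α, 2 * ENNReal.ofReal (Real.exp (-(n * (m * ε ^ 2 / 4)))) := by
        rw [expect_sum]
        refine Finset.sum_le_sum fun a _ => ?_
        by_cases ha : p a = 0
        · simp [ha]
        · simp only [ha, if_false]
          rw [expect_add, two_mul]
          exact add_le_add (hbound a 1 (by norm_num) ha) (hbound a (-1) (by norm_num) ha)
    _ = _ := by
        rw [Finset.sum_const, Finset.card_univ, nsmul_eq_mul, ENNReal.ofReal_mul (by positivity),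
          ENNReal.ofReal_mul (by positivity)]
        simp only [ENNReal.ofReal_natCast, ENNReal.ofReal_ofNat]
        ring

end Typical

/-! ### Entropy, relative entropy and divergence of joint laws -/

/-- The entropy in nats. -/
def natEnt {α : Type*} [Fintype α] (p : PMF α) : ℝ := ∑ a, Real.negMulLog (p a).toReal

/-- The joint law of a sample `s` from `r` and an output of the kernel `V` at `s`. -/
def joint {σ β : Type*} (r : PMF σ) (V : σ → PMF β) : PMF (σ × β) :=
  r.bind fun s => (V s).map fun y => (s, y)

section Joint

variable {α β σ υ : Type*}

lemma entropy_mul_log_two [Fintype α] (p : PMF α) : entropy p * Real.log 2 = natEnt p :=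
  div_mul_cancel₀ _ (Real.log_pos one_lt_two).ne'

lemma expect_joint (r : PMF σ) (V : σ → PMF β) (f : σ × β → ℝ≥0∞) :
    expect (joint r V) f = expect r fun s => expect (V s) fun y => f (s, y) := by
  simp only [joint, expect_bind, expect_map]

lemma joint_apply (r : PMF σ) (V : σ → PMF β) (z : σ × β) : joint r V z = r z.1 * V z.1 z.2 := by
  classical
  obtain ⟨s, y⟩ := z
  rw [apply_eq_expect, expect_joint, expect, tsum_eq_single s]
  · congr 1
    rw [apply_eq_expect]
    simp
  · intro b hb
    simp [hb]

lemma joint_ne_zero_iff (r : PMF σ) (V : σ → PMF β) (z : σ × β) :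
    joint r V z ≠ 0 ↔ r z.1 ≠ 0 ∧ V z.1 z.2 ≠ 0 := by
  rw [joint_apply, mul_ne_zero_iff]

lemma map_fst_joint (r : PMF σ) (V : σ → PMF β) : (joint r V).map Prod.fst = r :=
  pmf_ext_expect fun f => by simp [expect_map, expect_joint]

lemma map_apply_injective {e : α → β} (he : Function.Injective e) (p : PMF α) (a : α) :
    (p.map e) (e a) = p a := by
  classical
  rw [apply_eq_expect, expect_map, apply_eq_expect p a]
  simp only [he.eq_iff]

variable [Fintype α] [Fintype β] [Fintype σ] [Fintype υ]

lemma natEnt_map_injective {e : α → β} (he : Function.Injective e) (p : PMF α) :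
    natEnt (p.map e) = natEnt p := by
  refine (Fintype.sum_of_injective e he _ _ (fun b hb => ?_) fun a => ?_).symm
  · have : (p.map e) b = 0 := by
      rw [PMF.apply_eq_zero_iff, PMF.support_map]
      rintro ⟨a, -, rfl⟩
      exact hb ⟨a, rfl⟩
    simp [this]
  · rw [map_apply_injective he]

lemma sum_map_toReal (p : PMF α) (h : α → β) (φ : β → ℝ) :
    ∑ b, ((p.map h) b).toReal * φ b = ∑ a, (p a).toReal * φ (h a) := by
  classical
  have h1 : ∀ b, ((p.map h) b).toReal = ∑ a, if b = h a then (p a).toReal else 0 := by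
    intro b
    rw [PMF.map_apply, tsum_fintype, ENNReal.toReal_sum]
    · exact Finset.sum_congr rfl fun a _ => by split_ifs <;> simp
    · intro a _
      split_ifs
      · exact p.apply_ne_top a
      · simp
  simp only [h1, Finset.sum_mul, ite_mul, zero_mul]
  rw [Finset.sum_comm]
  simp

lemma sum_joint_toReal (r : PMF σ) (V : σ → PMF β) (φ : σ × β → ℝ) :
    ∑ z, (joint r V z).toReal * φ z = ∑ s, (r s).toReal * ∑ y, (V s y).toReal * φ (s, y) := by
  rw [Fintype.sum_prod_type]
  refine Finset.sum_congr rfl fun s _ => ?_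
  rw [Finset.mul_sum]
  refine Finset.sum_congr rfl fun y _ => ?_
  rw [joint_apply, ENNReal.toReal_mul, mul_assoc]

lemma natEnt_joint (r : PMF σ) (V : σ → PMF β) :
    natEnt (joint r V) = natEnt r + ∑ s, (r s).toReal * natEnt (V s) := by
  simp only [natEnt]
  rw [Fintype.sum_prod_type, ← Finset.sum_add_distrib]
  refine Finset.sum_congr rfl fun s _ => ?_
  simp only [joint_apply, ENNReal.toReal_mul, Real.negMulLog_mul]
  rw [Finset.sum_add_distrib, ← Finset.sum_mul, sum_toReal_eq_one, Finset.mul_sum, one_mul]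

lemma relEnt_self (p : PMF α) : relEnt p p = 0 := by
  refine Finset.sum_eq_zero fun a _ => ?_
  by_cases h : (p a).toReal = 0
  · simp [h]
  · simp [div_self h]

/-- The chain rule for relative entropy. -/
lemma relEnt_joint {r r' : PMF σ} {V V' : σ → PMF β} (hr : ∀ s, r s ≠ 0 → r' s ≠ 0)
    (hV : ∀ s, r s ≠ 0 → ∀ y, V s y ≠ 0 → V' s y ≠ 0) :
    relEnt (joint r V) (joint r' V') =
      relEnt r r' + ∑ s, (r s).toReal * relEnt (V s) (V' s) := by
  simp only [relEnt]
  rw [Fintype.sum_prod_type, ← Finset.sum_add_distrib]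
  refine Finset.sum_congr rfl fun s _ => ?_
  have h1 : ∀ y, (joint r V (s, y)).toReal *
      Real.log ((joint r V (s, y)).toReal / (joint r' V' (s, y)).toReal) =
      (V s y).toReal * ((r s).toReal * Real.log ((r s).toReal / (r' s).toReal)) +
        (r s).toReal * ((V s y).toReal * Real.log ((V s y).toReal / (V' s y).toReal)) := by
    intro y
    simp only [joint_apply, ENNReal.toReal_mul]
    by_cases hs : r s = 0
    · simp [hs]
    by_cases hy : V s y = 0
    · simp [hy]
    have a1 := toReal_pos_of_ne hs
    have a2 := toReal_pos_of_ne (hr s hs)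
    have a3 := toReal_pos_of_ne hy
    have a4 := toReal_pos_of_ne (hV s hs y hy)
    rw [mul_div_mul_comm, Real.log_mul (by positivity) (by positivity)]
    ring
  rw [Finset.sum_congr rfl fun y _ => h1 y, Finset.sum_add_distrib, ← Finset.sum_mul,
    sum_toReal_eq_one, one_mul, Finset.mul_sum]

/-- The divergence of an input-output law from a law in which the output depends on the input `u`
only through `s u`, when `V` is the true conditional law of the output given `s u`. -/
lemma relEnt_joint_comp {l l' : PMF υ} {K : υ → PMF β} {s : υ → σ} {V : σ → PMF β}
    (hV : (joint l K).map (fun z => (s z.1, z.2)) = joint (l.map s) V)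
    (hl : ∀ u, l u ≠ 0 → l' u ≠ 0) :
    (∀ z, joint l K z ≠ 0 → joint l' (fun u => V (s u)) z ≠ 0) ∧
    relEnt (joint l K) (joint l' fun u => V (s u)) =
      relEnt l l' + (∑ u, (l u).toReal * natEnt (V (s u)) - ∑ u, (l u).toReal * natEnt (K u)) := by
  have hac : ∀ u, l u ≠ 0 → ∀ y, K u y ≠ 0 → V (s u) y ≠ 0 := by
    intro u hu y hy
    have h1 : (s u, y) ∈ ((joint l K).map fun z => (s z.1, z.2)).support :=
      (PMF.mem_support_map_iff _ _ _).2 ⟨(u, y), (joint_ne_zero_iff l K (u, y)).2 ⟨hu, hy⟩, rfl⟩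
    rw [hV] at h1
    exact ((joint_ne_zero_iff _ _ _).1 h1).2
  refine ⟨fun z hz => ?_, ?_⟩
  · have h := (joint_ne_zero_iff l K z).1 hz
    exact (joint_ne_zero_iff _ _ z).2 ⟨hl _ h.1, hac _ h.1 _ h.2⟩
  rw [relEnt_joint hl hac]
  congr 1
  have h2 : ∑ u, (l u).toReal * ∑ y, (K u y).toReal * Real.log (V (s u) y).toReal =
      ∑ u, (l u).toReal * -natEnt (V (s u)) := by
    rw [← sum_joint_toReal l K fun z => Real.log (V (s z.1) z.2).toReal,
      ← sum_map_toReal (joint l K) (fun z => (s z.1, z.2)) fun z => Real.log (V z.1 z.2).toReal,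
      hV, sum_joint_toReal, sum_map_toReal l s fun c => ∑ y, (V c y).toReal *
        Real.log (V c y).toReal]
    simp [natEnt, Real.negMulLog]
  have h3 : ∀ u, (l u).toReal * relEnt (K u) (V (s u)) = (l u).toReal * -natEnt (K u) -
      (l u).toReal * ∑ y, (K u y).toReal * Real.log (V (s u) y).toReal := by
    intro u
    by_cases hu : l u = 0
    · simp [hu]
    rw [← mul_sub, relEnt, natEnt, ← Finset.sum_neg_distrib, ← Finset.sum_sub_distrib]
    congr 1
    refine Finset.sum_congr rfl fun y _ => ?_
    by_cases hy : K u y = 0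
    · simp [hy]
    rw [Real.log_div (toReal_pos_of_ne hy).ne' (toReal_pos_of_ne (hac u hu y hy)).ne',
      Real.negMulLog]
    ring
  rw [Finset.sum_congr rfl fun u _ => h3 u, Finset.sum_sub_distrib, h2]
  simp only [mul_neg, Finset.sum_neg_distrib]
  ring

/-- `I(Y; B | S) = H(Y | S) - H(Y | U)`, for an input `U` that corresponds to the pair `(B, S)`. -/
lemma condMutualInfo_mul_log_two {l : PMF υ} {K : υ → PMF β} {s : υ → σ} {V : σ → PMF β}
    (hV : (joint l K).map (fun z => (s z.1, z.2)) = joint (l.map s) V)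
    {b : υ → α} (hb : Function.Injective fun u => (b u, s u)) :
    condMutualInfo (joint l K) (fun z => z.2) (fun z => b z.1) (fun z => s z.1) * Real.log 2 =
      ∑ u, (l u).toReal * natEnt (V (s u)) - ∑ u, (l u).toReal * natEnt (K u) := by
  simp only [condMutualInfo, sub_mul, add_mul, entropy_mul_log_two]
  have h1 : natEnt ((joint l K).map fun z => (z.2, s z.1)) =
      natEnt (l.map s) + ∑ u, (l u).toReal * natEnt (V (s u)) := by
    have : (joint l K).map (fun z => (z.2, s z.1)) =
        ((joint l K).map fun z => (s z.1, z.2)).map Prod.swap := by rw [PMF.map_comp]; rfl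
    rw [this, natEnt_map_injective Prod.swap_injective, hV, natEnt_joint,
      sum_map_toReal l s fun c => natEnt (V c)]
  have h2 : natEnt ((joint l K).map fun z => (b z.1, s z.1)) = natEnt l := by
    have : (joint l K).map (fun z => (b z.1, s z.1)) =
        ((joint l K).map Prod.fst).map fun u => (b u, s u) := by rw [PMF.map_comp]; rfl
    rw [this, natEnt_map_injective hb, map_fst_joint]
  have h3 : natEnt ((joint l K).map fun z => (z.2, b z.1, s z.1)) =
      natEnt l + ∑ u, (l u).toReal * natEnt (K u) := by
    rw [natEnt_map_injective, natEnt_joint]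
    rintro ⟨u, y⟩ ⟨u', y'⟩ h
    simp only [Prod.mk.injEq] at h
    rw [h.1, hb (Prod.ext h.2.1 h.2.2)]
  have h4 : natEnt ((joint l K).map fun z => s z.1) = natEnt (l.map s) := by
    have : (joint l K).map (fun z => s z.1) = ((joint l K).map Prod.fst).map s := by
      rw [PMF.map_comp]; rfl
    rw [this, map_fst_joint]
  rw [h1, h2, h3, h4]
  ring

/-- `I(Y; U) = H(Y) - H(Y | U)`. -/
lemma mutualInfo_mul_log_two (l : PMF υ) (K : υ → PMF β) :
    mutualInfo (joint l K) (fun z => z.2) (fun z => z.1) * Real.log 2 =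
      natEnt (l.bind K) - ∑ u, (l u).toReal * natEnt (K u) := by
  simp only [mutualInfo, sub_mul, add_mul, entropy_mul_log_two]
  have h1 : (joint l K).map (fun z => z.2) = l.bind K :=
    pmf_ext_expect fun f => by simp [expect_map, expect_joint, expect_bind]
  have h2 : (joint l K).map (fun z => z.1) = l := map_fst_joint l K
  have h3 : natEnt ((joint l K).map fun z => (z.2, z.1)) =
      natEnt l + ∑ u, (l u).toReal * natEnt (K u) := by
    rw [natEnt_map_injective (e := fun z : υ × β => (z.2, z.1)) Prod.swap_injective, natEnt_joint]
  rw [h1, h2, h3]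
  ring

open MeasureTheory in
lemma toReal_klDiv_toMeasure [MeasurableSpace α] [MeasurableSingletonClass α] {p q : PMF α}
    (h : ∀ a, p a ≠ 0 → q a ≠ 0) :
    InformationTheory.klDiv p.toMeasure q.toMeasure ≠ ⊤ ∧
    (InformationTheory.klDiv p.toMeasure q.toMeasure).toReal = relEnt p q := by
  have hac : p.toMeasure ≪ q.toMeasure := by
    refine Measure.AbsolutelyContinuous.mk fun s hs h0 => ?_
    rw [PMF.toMeasure_apply_eq_zero_iff _ hs] at h0 ⊢
    rw [Set.disjoint_left] at h0 ⊢
    exact fun a ha => h0 (h a ha)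
  have hint : Integrable (llr p.toMeasure q.toMeasure) p.toMeasure := Integrable.of_finite
  refine ⟨InformationTheory.klDiv_ne_top hac hint, ?_⟩
  rw [InformationTheory.toReal_klDiv_of_measure_eq hac (by simp), PMF.integral_eq_sum, relEnt]
  refine Finset.sum_congr rfl fun a _ => ?_
  by_cases ha : p a = 0
  · simp [ha]
  have hq := toReal_pos_of_ne (h a ha)
  rw [smul_eq_mul, llr]
  congr 2
  have h1 : p a = p.toMeasure.rnDeriv q.toMeasure a * q a := by
    have := Measure.setLIntegral_rnDeriv hac {a}
    rw [lintegral_singleton, PMF.toMeasure_apply_singleton _ _ (measurableSet_singleton a),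
      PMF.toMeasure_apply_singleton _ _ (measurableSet_singleton a)] at this
    exact this.symm
  rw [eq_div_iff hq.ne', ← ENNReal.toReal_mul, ← h1]

lemma divergence_of_ac {p q : PMF α} (h : ∀ a, p a ≠ 0 → q a ≠ 0) :
    0 ≤ relEnt p q ∧ divergence p q = ENNReal.ofReal (relEnt p q / Real.log 2) := by
  let _ : MeasurableSpace α := ⊤
  obtain ⟨h1, h2⟩ := toReal_klDiv_toMeasure h
  refine ⟨h2 ▸ ENNReal.toReal_nonneg, ?_⟩
  rw [divergence, ENNReal.ofReal_div_of_pos (Real.log_pos one_lt_two), ← h2,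
    ENNReal.ofReal_toReal h1]

lemma ac_of_divergence_ne_top {κ : Type*} {p q : PMF κ} (h : divergence p q ≠ ⊤) (a : κ)
    (ha : p a ≠ 0) : q a ≠ 0 := by
  let _ : MeasurableSpace κ := ⊤
  have h1 : InformationTheory.klDiv p.toMeasure q.toMeasure ≠ ⊤ := fun h0 => h (by
    rw [divergence, h0, ENNReal.top_div_of_ne_top ENNReal.ofReal_ne_top])
  have h2 := (InformationTheory.klDiv_ne_top_iff.1 h1).1
  intro hq
  have h3 : q.toMeasure {a} = 0 := by
    rwa [PMF.toMeasure_apply_singleton _ _ (MeasurableSpace.measurableSet_top)]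
  have h4 := h2 h3
  rw [PMF.toMeasure_apply_singleton _ _ (MeasurableSpace.measurableSet_top)] at h4
  exact ha h4

lemma ac_of_condDivergence_ne_top {κ : Type*} {p q : σ → PMF κ} {r : PMF σ}
    (h : condDivergence p q r ≠ ⊤) (s : σ) (hs : r s ≠ 0) (a : κ) (ha : p s a ≠ 0) : q s a ≠ 0 := by
  refine ac_of_divergence_ne_top (p := p s) (fun h0 => h ?_) a ha
  refine ENNReal.sum_eq_top.2 ⟨s, Finset.mem_univ s, ?_⟩
  rw [h0, ENNReal.mul_top hs]

lemma condDivergence_of_ac {p q : σ → PMF α} {r : PMF σ}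
    (h : ∀ s, r s ≠ 0 → ∀ a, p s a ≠ 0 → q s a ≠ 0) :
    0 ≤ ∑ s, (r s).toReal * relEnt (p s) (q s) ∧
    condDivergence p q r =
      ENNReal.ofReal ((∑ s, (r s).toReal * relEnt (p s) (q s)) / Real.log 2) := by
  have h0 : ∀ s, 0 ≤ (r s).toReal * relEnt (p s) (q s) := by
    intro s
    by_cases hs : r s = 0
    · simp [hs]
    · exact mul_nonneg ENNReal.toReal_nonneg (divergence_of_ac (h s hs)).1
  refine ⟨Finset.sum_nonneg fun s _ => h0 s, ?_⟩
  have hl := Real.log_pos one_lt_two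
  rw [Finset.sum_div, ENNReal.ofReal_sum_of_nonneg fun s _ => div_nonneg (h0 s) hl.le,
    condDivergence]
  refine Finset.sum_congr rfl fun s _ => ?_
  by_cases hs : r s = 0
  · simp [hs]
  rw [(divergence_of_ac (h s hs)).2, mul_div_assoc, ENNReal.ofReal_mul ENNReal.toReal_nonneg,
    ENNReal.ofReal_toReal (r.apply_ne_top s)]

end Joint

/-! ### Information quantities of superposition laws -/

namespace SuperpositionLaw

variable {U₀ U₁ U₂ X₁ X₂ Y : Type*}

/-- The law with the base of `P`, the first satellite of `Q` and the second satellite of `P`. -/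
def mix₁ (P Q : SuperpositionLaw U₀ U₁ U₂) : SuperpositionLaw U₀ U₁ U₂ := ⟨P.base, Q.top₁, P.top₂⟩

/-- The law with the base of `P`, the first satellite of `P` and the second satellite of `Q`. -/
def mix₂ (P Q : SuperpositionLaw U₀ U₁ U₂) : SuperpositionLaw U₀ U₁ U₂ := ⟨P.base, P.top₁, Q.top₂⟩

lemma law_eq_joint (P : SuperpositionLaw U₀ U₁ U₂) :
    P.law = joint P.base fun u₀ => joint (P.top₁ u₀) fun _ => P.top₂ u₀ :=
  pmf_ext_expect fun f => by simp [law, expect_joint, expect_bind, expect_map]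

lemma law₁_eq_joint (P : SuperpositionLaw U₀ U₁ U₂) : P.law₁ = joint P.base P.top₁ :=
  pmf_ext_expect fun f => by simp [law₁, law, expect_joint, expect_bind, expect_map]

lemma law₂_eq_joint (P : SuperpositionLaw U₀ U₁ U₂) : P.law₂ = joint P.base P.top₂ :=
  pmf_ext_expect fun f => by simp [law₂, law, expect_joint, expect_bind, expect_map]

lemma lawWithOutput_eq_joint (P : SuperpositionLaw U₀ U₁ U₂) (W : X₁ → X₂ → PMF Y)
    (f₁ : U₀ → U₁ → X₁) (f₂ : U₀ → U₂ → X₂) :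
    P.lawWithOutput W f₁ f₂ = joint P.law fun u => W (f₁ u.1 u.2.1) (f₂ u.1 u.2.2) := rfl

lemma expect_law (P : SuperpositionLaw U₀ U₁ U₂) (f : U₀ × U₁ × U₂ → ℝ≥0∞) :
    expect P.law f = expect P.base fun u₀ => expect (P.top₁ u₀) fun u₁ =>
      expect (P.top₂ u₀) fun u₂ => f (u₀, u₁, u₂) := by
  simp [law, expect_bind, expect_map]

lemma law_ne_zero_iff (P : SuperpositionLaw U₀ U₁ U₂) (u : U₀ × U₁ × U₂) :
    P.law u ≠ 0 ↔ P.base u.1 ≠ 0 ∧ P.top₁ u.1 u.2.1 ≠ 0 ∧ P.top₂ u.1 u.2.2 ≠ 0 := by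
  rw [law_eq_joint, joint_ne_zero_iff, joint_ne_zero_iff]

section Kernels

variable (P : SuperpositionLaw U₀ U₁ U₂) (W : X₁ → X₂ → PMF Y)
  (f₁ : U₀ → U₁ → X₁) (f₂ : U₀ → U₂ → X₂)

/-- The law of the output `Y`. -/
def outAll : PMF Y := P.base.bind fun u₀ => (P.top₁ u₀).bind fun u₁ => (P.top₂ u₀).bind fun u₂ =>
  W (f₁ u₀ u₁) (f₂ u₀ u₂)

/-- The conditional law of the output `Y` given `U₀`. -/
def outBoth (u₀ : U₀) : PMF Y := (P.top₁ u₀).bind fun u₁ => (P.top₂ u₀).bind fun u₂ =>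
  W (f₁ u₀ u₁) (f₂ u₀ u₂)

/-- The conditional law of the output `Y` given `(U₀, U₂)`. -/
def out₁ (c : U₀ × U₂) : PMF Y := (P.top₁ c.1).bind fun u₁ => W (f₁ c.1 u₁) (f₂ c.1 c.2)

/-- The conditional law of the output `Y` given `(U₀, U₁)`. -/
def out₂ (c : U₀ × U₁) : PMF Y := (P.top₂ c.1).bind fun u₂ => W (f₁ c.1 c.2) (f₂ c.1 u₂)

lemma bind_channel_eq_outAll : P.law.bind (fun u => W (f₁ u.1 u.2.1) (f₂ u.1 u.2.2)) =
    P.outAll W f₁ f₂ :=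
  pmf_ext_expect fun f => by simp [outAll, expect_law, expect_bind]

lemma map_outAll : (P.lawWithOutput W f₁ f₂).map (fun z => ((), z.2)) =
    joint (P.law.map fun _ => ()) fun _ => P.outAll W f₁ f₂ :=
  pmf_ext_expect fun f => by
    simp [lawWithOutput_eq_joint, expect_map, expect_joint, expect_law, outAll, expect_bind]

lemma map_outBoth : (P.lawWithOutput W f₁ f₂).map (fun z => (z.1.1, z.2)) =
    joint (P.law.map fun u => u.1) (P.outBoth W f₁ f₂) :=
  pmf_ext_expect fun f => by
    simp [lawWithOutput_eq_joint, expect_map, expect_joint, expect_law, outBoth, expect_bind]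

lemma map_out₁ : (P.lawWithOutput W f₁ f₂).map (fun z => ((z.1.1, z.1.2.2), z.2)) =
    joint (P.law.map fun u => (u.1, u.2.2)) (P.out₁ W f₁ f₂) :=
  pmf_ext_expect fun f => by
    simp only [lawWithOutput_eq_joint, expect_map, expect_joint, expect_law, out₁, expect_bind,
      expect_const]
    congr 1 with u₀
    rw [expect_comm]

lemma map_out₂ : (P.lawWithOutput W f₁ f₂).map (fun z => ((z.1.1, z.1.2.1), z.2)) =
    joint (P.law.map fun u => (u.1, u.2.1)) (P.out₂ W f₁ f₂) :=
  pmf_ext_expect fun f => by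
    simp only [lawWithOutput_eq_joint, expect_map, expect_joint, expect_law, out₂, expect_bind,
      expect_const]

variable [Fintype U₀] [Fintype U₁] [Fintype U₂] [Fintype Y]

/-- `H(Y | U₀, U₁, U₂)` in nats. -/
def noiseEnt : ℝ := ∑ u, (P.law u).toReal * natEnt (W (f₁ u.1 u.2.1) (f₂ u.1 u.2.2))

lemma infoAll_mul_log_two : P.infoAll W f₁ f₂ * Real.log 2 =
    natEnt (P.outAll W f₁ f₂) - P.noiseEnt W f₁ f₂ := by
  rw [infoAll, lawWithOutput_eq_joint, mutualInfo_mul_log_two, bind_channel_eq_outAll, noiseEnt]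

lemma infoBoth_mul_log_two : P.infoBoth W f₁ f₂ * Real.log 2 =
    ∑ u, (P.law u).toReal * natEnt (P.outBoth W f₁ f₂ u.1) - P.noiseEnt W f₁ f₂ :=
  condMutualInfo_mul_log_two (l := P.law) (K := fun u => W (f₁ u.1 u.2.1) (f₂ u.1 u.2.2))
    (s := fun u => u.1) (V := P.outBoth W f₁ f₂) (b := fun u => u.2)
    (P.map_outBoth W f₁ f₂)
    (fun u v h => by simp only [Prod.mk.injEq] at h; exact Prod.ext h.2 h.1)

lemma info₁_mul_log_two : P.info₁ W f₁ f₂ * Real.log 2 =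
    ∑ u, (P.law u).toReal * natEnt (P.out₁ W f₁ f₂ (u.1, u.2.2)) - P.noiseEnt W f₁ f₂ :=
  condMutualInfo_mul_log_two (l := P.law) (K := fun u => W (f₁ u.1 u.2.1) (f₂ u.1 u.2.2))
    (s := fun u => (u.1, u.2.2)) (V := P.out₁ W f₁ f₂) (b := fun u => u.2.1)
    (P.map_out₁ W f₁ f₂)
    (fun u v h => by simp only [Prod.mk.injEq] at h; exact Prod.ext h.2.1 (Prod.ext h.1 h.2.2))

lemma info₂_mul_log_two : P.info₂ W f₁ f₂ * Real.log 2 =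
    ∑ u, (P.law u).toReal * natEnt (P.out₂ W f₁ f₂ (u.1, u.2.1)) - P.noiseEnt W f₁ f₂ :=
  condMutualInfo_mul_log_two (l := P.law) (K := fun u => W (f₁ u.1 u.2.1) (f₂ u.1 u.2.2))
    (s := fun u => (u.1, u.2.1)) (V := P.out₂ W f₁ f₂) (b := fun u => u.2.2)
    (P.map_out₂ W f₁ f₂)
    (fun u v h => by simp only [Prod.mk.injEq] at h; exact Prod.ext h.2.1 (Prod.ext h.2.2 h.1))

end Kernels

/-! ### Divergences of superposition laws -/

section Divergence

variable {P Q : SuperpositionLaw U₀ U₁ U₂}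

/-- At every `u₀` of positive mass, the conditional laws `P_{U₁|U₀}` and `P_{U₂|U₀}` are absolutely
continuous with respect to those of `Q`. -/
def SatelliteAC (P Q : SuperpositionLaw U₀ U₁ U₂) : Prop :=
  (∀ u₀, P.base u₀ ≠ 0 → ∀ a, P.top₁ u₀ a ≠ 0 → Q.top₁ u₀ a ≠ 0) ∧
    ∀ u₀, P.base u₀ ≠ 0 → ∀ a, P.top₂ u₀ a ≠ 0 → Q.top₂ u₀ a ≠ 0

lemma satelliteAC_self (P : SuperpositionLaw U₀ U₁ U₂) : SatelliteAC P P :=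
  ⟨fun _ _ _ h => h, fun _ _ _ h => h⟩

lemma law_ac (hb : P.base = Q.base) (h : SatelliteAC P Q) (u : U₀ × U₁ × U₂) (hu : P.law u ≠ 0) :
    Q.law u ≠ 0 := by
  rw [law_ne_zero_iff] at hu ⊢
  exact ⟨hb ▸ hu.1, h.1 _ hu.1 _ hu.2.1, h.2 _ hu.1 _ hu.2.2⟩

lemma law₁_ac (hb : P.base = Q.base) (h : SatelliteAC P Q) (u : U₀ × U₁) (hu : P.law₁ u ≠ 0) :
    Q.law₁ u ≠ 0 := by
  rw [law₁_eq_joint, joint_ne_zero_iff] at hu ⊢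
  exact ⟨hb ▸ hu.1, h.1 _ hu.1 _ hu.2⟩

lemma law₂_ac (hb : P.base = Q.base) (h : SatelliteAC P Q) (u : U₀ × U₂) (hu : P.law₂ u ≠ 0) :
    Q.law₂ u ≠ 0 := by
  rw [law₂_eq_joint, joint_ne_zero_iff] at hu ⊢
  exact ⟨hb ▸ hu.1, h.2 _ hu.1 _ hu.2⟩

variable [Fintype U₀]

lemma satelliteAC_of_ne_top (h₁ : P.div₁ Q ≠ ⊤) (h₂ : P.div₂ Q ≠ ⊤) : SatelliteAC P Q :=
  ⟨ac_of_condDivergence_ne_top h₁, ac_of_condDivergence_ne_top h₂⟩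

/-- The divergence `D(P_{U₁} ‖ Q_{U₁} | P_{U₀})` in nats. -/
def natDiv₁ [Fintype U₁] (P Q : SuperpositionLaw U₀ U₁ U₂) : ℝ :=
  ∑ u₀, (P.base u₀).toReal * relEnt (P.top₁ u₀) (Q.top₁ u₀)

/-- The divergence `D(P_{U₂} ‖ Q_{U₂} | P_{U₀})` in nats. -/
def natDiv₂ [Fintype U₂] (P Q : SuperpositionLaw U₀ U₁ U₂) : ℝ :=
  ∑ u₀, (P.base u₀).toReal * relEnt (P.top₂ u₀) (Q.top₂ u₀)

lemma natDiv₁_self [Fintype U₁] (P : SuperpositionLaw U₀ U₁ U₂) : P.natDiv₁ P = 0 := by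
  simp [natDiv₁, relEnt_self]

lemma natDiv₂_self [Fintype U₂] (P : SuperpositionLaw U₀ U₁ U₂) : P.natDiv₂ P = 0 := by
  simp [natDiv₂, relEnt_self]

lemma relEnt_law₁ [Fintype U₁] (hb : P.base = Q.base) (h : SatelliteAC P Q) :
    relEnt P.law₁ Q.law₁ = P.natDiv₁ Q := by
  rw [law₁_eq_joint, law₁_eq_joint, relEnt_joint (fun s hs => hb ▸ hs) h.1, ← hb, relEnt_self,
    zero_add, natDiv₁]

lemma relEnt_law₂ [Fintype U₂] (hb : P.base = Q.base) (h : SatelliteAC P Q) :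
    relEnt P.law₂ Q.law₂ = P.natDiv₂ Q := by
  rw [law₂_eq_joint, law₂_eq_joint, relEnt_joint (fun s hs => hb ▸ hs) h.2, ← hb, relEnt_self,
    zero_add, natDiv₂]

lemma div₁_eq [Fintype U₁] (h : SatelliteAC P Q) :
    0 ≤ P.natDiv₁ Q ∧ P.div₁ Q = ENNReal.ofReal (P.natDiv₁ Q / Real.log 2) :=
  condDivergence_of_ac h.1

lemma div₂_eq [Fintype U₂] (h : SatelliteAC P Q) :
    0 ≤ P.natDiv₂ Q ∧ P.div₂ Q = ENNReal.ofReal (P.natDiv₂ Q / Real.log 2) :=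
  condDivergence_of_ac h.2

variable [Fintype U₁] [Fintype U₂]

lemma relEnt_law (hb : P.base = Q.base) (h : SatelliteAC P Q) :
    relEnt P.law Q.law = P.natDiv₁ Q + P.natDiv₂ Q := by
  have h1 : ∀ u₀, (P.base u₀).toReal * relEnt (joint (P.top₁ u₀) fun _ => P.top₂ u₀)
      (joint (Q.top₁ u₀) fun _ => Q.top₂ u₀) =
      (P.base u₀).toReal * relEnt (P.top₁ u₀) (Q.top₁ u₀) +
        (P.base u₀).toReal * relEnt (P.top₂ u₀) (Q.top₂ u₀) := by
    intro u₀
    by_cases hu : P.base u₀ = 0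
    · simp [hu]
    rw [relEnt_joint (h.1 _ hu) fun _ _ => h.2 _ hu, ← Finset.sum_mul, sum_toReal_eq_one, one_mul,
      mul_add]
  rw [law_eq_joint, law_eq_joint, relEnt_joint (fun s hs => hb ▸ hs)]
  · rw [Finset.sum_congr rfl fun u₀ _ => h1 u₀, Finset.sum_add_distrib, ← hb, relEnt_self, zero_add,
      natDiv₁, natDiv₂]
  · intro u₀ hu y hy
    rw [joint_ne_zero_iff] at hy ⊢
    exact ⟨h.1 _ hu _ hy.1, h.2 _ hu _ hy.2⟩

lemma divAll_eq (hb : P.base = Q.base) (h : SatelliteAC P Q) :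
    P.divAll Q = ENNReal.ofReal ((P.natDiv₁ Q + P.natDiv₂ Q) / Real.log 2) := by
  rw [divAll, (divergence_of_ac (law_ac hb h)).2, relEnt_law hb h]

end Divergence

/-! ### The laws of a wrong codeword tuple together with the output -/

section TestLaws

variable (P Q : SuperpositionLaw U₀ U₁ U₂) (W : X₁ → X₂ → PMF Y)
  (f₁ : U₀ → U₁ → X₁) (f₂ : U₀ → U₂ → X₂)

/-- The law of the tested letters when all of the tested codewords are wrong: these come from the
codebook law, and the output, which depends on the sent codewords only, from the encoding law. -/
def testAll : PMF ((U₀ × U₁ × U₂) × Y) := joint Q.law fun _ => P.outAll W f₁ f₂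

/-- The law of the tested letters when only the common codeword is right. -/
def testBoth : PMF ((U₀ × U₁ × U₂) × Y) := joint Q.law fun u => P.outBoth W f₁ f₂ u.1

/-- The law of the tested letters when only the first satellite codeword is wrong. -/
def test₁ : PMF ((U₀ × U₁ × U₂) × Y) := joint (P.mix₁ Q).law fun u => P.out₁ W f₁ f₂ (u.1, u.2.2)

/-- The law of the tested letters when only the second satellite codeword is wrong. -/
def test₂ : PMF ((U₀ × U₁ × U₂) × Y) := joint (P.mix₂ Q).law fun u => P.out₂ W f₁ f₂ (u.1, u.2.1)

variable {P Q} [Fintype U₀] [Fintype U₁] [Fintype U₂] [Fintype Y]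

lemma relEnt_testAll (hb : P.base = Q.base) (h : SatelliteAC P Q) :
    (∀ z, P.lawWithOutput W f₁ f₂ z ≠ 0 → testAll P Q W f₁ f₂ z ≠ 0) ∧
    relEnt (P.lawWithOutput W f₁ f₂) (testAll P Q W f₁ f₂) =
      P.infoAll W f₁ f₂ * Real.log 2 + (P.natDiv₁ Q + P.natDiv₂ Q) := by
  have h1 := relEnt_joint_comp (l := P.law) (K := fun u => W (f₁ u.1 u.2.1) (f₂ u.1 u.2.2))
    (s := fun _ => ()) (V := fun _ => P.outAll W f₁ f₂) (P.map_outAll W f₁ f₂) (law_ac hb h)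
  refine ⟨h1.1, h1.2.trans ?_⟩
  rw [infoAll_mul_log_two, relEnt_law hb h, ← Finset.sum_mul, sum_toReal_eq_one, noiseEnt]
  ring

lemma relEnt_testBoth (hb : P.base = Q.base) (h : SatelliteAC P Q) :
    (∀ z, P.lawWithOutput W f₁ f₂ z ≠ 0 → testBoth P Q W f₁ f₂ z ≠ 0) ∧
    relEnt (P.lawWithOutput W f₁ f₂) (testBoth P Q W f₁ f₂) =
      P.infoBoth W f₁ f₂ * Real.log 2 + (P.natDiv₁ Q + P.natDiv₂ Q) := by
  have h1 := relEnt_joint_comp (l := P.law) (K := fun u => W (f₁ u.1 u.2.1) (f₂ u.1 u.2.2))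
    (s := fun u => u.1) (V := P.outBoth W f₁ f₂) (P.map_outBoth W f₁ f₂) (law_ac hb h)
  refine ⟨h1.1, h1.2.trans ?_⟩
  rw [infoBoth_mul_log_two, relEnt_law hb h, noiseEnt]
  ring

lemma relEnt_test₁ (h : SatelliteAC P Q) :
    (∀ z, P.lawWithOutput W f₁ f₂ z ≠ 0 → test₁ P Q W f₁ f₂ z ≠ 0) ∧
    relEnt (P.lawWithOutput W f₁ f₂) (test₁ P Q W f₁ f₂) =
      P.info₁ W f₁ f₂ * Real.log 2 + P.natDiv₁ Q := by
  have h' : SatelliteAC P (P.mix₁ Q) := ⟨h.1, fun _ _ _ h => h⟩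
  have h1 := relEnt_joint_comp (l := P.law) (K := fun u => W (f₁ u.1 u.2.1) (f₂ u.1 u.2.2))
    (s := fun u => (u.1, u.2.2)) (V := P.out₁ W f₁ f₂) (P.map_out₁ W f₁ f₂)
    (law_ac (P := P) (Q := P.mix₁ Q) rfl h')
  refine ⟨h1.1, h1.2.trans ?_⟩
  have h2 : P.natDiv₁ (P.mix₁ Q) = P.natDiv₁ Q := rfl
  have h3 : P.natDiv₂ (P.mix₁ Q) = 0 := P.natDiv₂_self
  rw [info₁_mul_log_two, relEnt_law (P := P) (Q := P.mix₁ Q) rfl h', noiseEnt, h2, h3]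
  ring

lemma relEnt_test₂ (h : SatelliteAC P Q) :
    (∀ z, P.lawWithOutput W f₁ f₂ z ≠ 0 → test₂ P Q W f₁ f₂ z ≠ 0) ∧
    relEnt (P.lawWithOutput W f₁ f₂) (test₂ P Q W f₁ f₂) =
      P.info₂ W f₁ f₂ * Real.log 2 + P.natDiv₂ Q := by
  have h' : SatelliteAC P (P.mix₂ Q) := ⟨fun _ _ _ h => h, h.2⟩
  have h1 := relEnt_joint_comp (l := P.law) (K := fun u => W (f₁ u.1 u.2.1) (f₂ u.1 u.2.2))
    (s := fun u => (u.1, u.2.1)) (V := P.out₂ W f₁ f₂) (P.map_out₂ W f₁ f₂)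
    (law_ac (P := P) (Q := P.mix₂ Q) rfl h')
  refine ⟨h1.1, h1.2.trans ?_⟩
  have h2 : P.natDiv₂ (P.mix₂ Q) = P.natDiv₂ Q := rfl
  have h3 : P.natDiv₁ (P.mix₂ Q) = 0 := P.natDiv₁_self
  rw [info₂_mul_log_two, relEnt_law (P := P) (Q := P.mix₂ Q) rfl h', noiseEnt, h2, h3]
  ring

end TestLaws

end SuperpositionLaw

/-! ### Marginals of the random codebook -/

section Nested

variable {α : Type*} [Fintype α] {k₀ k₁ k₂ : ℕ}

lemma expect_nested_eval (μ : Fin k₀ → PMF α) (w₀ : Fin k₀) (w : Fin k₁) (b : Fin k₂)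
    (f : α → ℝ≥0∞) :
    expect (indepLaw fun v₀ => indepLaw fun _ : Fin k₁ => indepLaw fun _ : Fin k₂ => μ v₀)
      (fun c => f (c w₀ w b)) = expect (μ w₀) f := by
  rw [expect_indepLaw_eval (fun v₀ => indepLaw fun _ : Fin k₁ => indepLaw fun _ : Fin k₂ => μ v₀)
      w₀ fun c => f (c w b),
    expect_indepLaw_eval (fun _ : Fin k₁ => indepLaw fun _ : Fin k₂ => μ w₀) w fun c => f (c b),
    expect_indepLaw_eval (fun _ : Fin k₂ => μ w₀) b f]

/-- Satellite codewords with different indices are independent. -/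
lemma expect_nested_pair (μ : Fin k₀ → PMF α) {w₀ w₀' : Fin k₀} {w w' : Fin k₁} {b b' : Fin k₂}
    (h : (w₀, w, b) ≠ (w₀', w', b')) (f : α → α → ℝ≥0∞) :
    expect (indepLaw fun v₀ => indepLaw fun _ : Fin k₁ => indepLaw fun _ : Fin k₂ => μ v₀)
      (fun c => f (c w₀ w b) (c w₀' w' b')) =
      expect (μ w₀) fun a => expect (μ w₀') fun a' => f a a' := by
  by_cases h₀ : w₀ = w₀'
  · subst h₀
    rw [expect_indepLaw_eval (fun v₀ => indepLaw fun _ : Fin k₁ => indepLaw fun _ : Fin k₂ => μ v₀)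
      w₀ fun c => f (c w b) (c w' b')]
    by_cases h₁ : w = w'
    · subst h₁
      have h₂ : b ≠ b' := fun h₂ => h (by rw [h₂])
      rw [expect_indepLaw_eval (fun _ : Fin k₁ => indepLaw fun _ : Fin k₂ => μ w₀)
        w fun c => f (c b) (c b'), expect_indepLaw_pair (fun _ : Fin k₂ => μ w₀) h₂ f]
    · rw [expect_indepLaw_pair (fun _ : Fin k₁ => indepLaw fun _ : Fin k₂ => μ w₀) h₁
        fun c c' => f (c b) (c' b')]
      rw [expect_indepLaw_eval (fun _ : Fin k₂ => μ w₀) b fun a =>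
        expect (indepLaw fun _ : Fin k₂ => μ w₀) fun c' => f a (c' b')]
      congr 1 with a
      exact expect_indepLaw_eval (fun _ : Fin k₂ => μ w₀) b' fun a' => f a a'
  · rw [expect_indepLaw_pair (fun v₀ => indepLaw fun _ : Fin k₁ => indepLaw fun _ : Fin k₂ => μ v₀)
      h₀ fun c c' => f (c w b) (c' w' b')]
    rw [expect_indepLaw_eval (fun _ : Fin k₁ => indepLaw fun _ : Fin k₂ => μ w₀) w fun a =>
      expect (indepLaw fun _ : Fin k₁ => indepLaw fun _ : Fin k₂ => μ w₀') fun c' =>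
        f (a b) (c' w' b'),
      expect_indepLaw_eval (fun _ : Fin k₂ => μ w₀) b fun a =>
      expect (indepLaw fun _ : Fin k₁ => indepLaw fun _ : Fin k₂ => μ w₀') fun c' =>
        f a (c' w' b')]
    congr 1 with a
    rw [expect_indepLaw_eval (fun _ : Fin k₁ => indepLaw fun _ : Fin k₂ => μ w₀') w'
      fun a' => f a (a' b')]
    exact expect_indepLaw_eval (fun _ : Fin k₂ => μ w₀') b' fun a' => f a a'

end Nested

section Codebook

variable {U₀ U₁ U₂ X₁ X₂ Y : Type*} [Fintype U₀] [Fintype U₁] [Fintype U₂] [Fintype Y]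
  {n : ℕ} {R : Rates} {B : ℝ × ℝ}

/-- The memoryless law of a first satellite codeword, given the common codeword `u₀`. -/
abbrev SuperpositionLaw.sat₁ (Q : SuperpositionLaw U₀ U₁ U₂) (u₀ : Fin n → U₀) :
    PMF (Fin n → U₁) := indepLaw fun i => Q.top₁ (u₀ i)

/-- The memoryless law of a second satellite codeword, given the common codeword `u₀`. -/
abbrev SuperpositionLaw.sat₂ (Q : SuperpositionLaw U₀ U₁ U₂) (u₀ : Fin n → U₀) :
    PMF (Fin n → U₂) := indepLaw fun i => Q.top₂ (u₀ i)

lemma expect_codebookLaw (Q : SuperpositionLaw U₀ U₁ U₂) (F : Codebook U₀ U₁ U₂ n R B → ℝ≥0∞) :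
    expect (codebookLaw Q n R B) F =
      expect (indepLaw fun _ => indepLaw fun _ => Q.base) fun c₀ =>
      expect (indepLaw fun w₀ => indepLaw fun _ => indepLaw fun _ => Q.sat₁ (c₀ w₀)) fun c₁ =>
      expect (indepLaw fun w₀ => indepLaw fun _ => indepLaw fun _ => Q.sat₂ (c₀ w₀)) fun c₂ =>
        F ⟨c₀, c₁, c₂⟩ := by
  simp only [codebookLaw, expect_bind, expect_map]

variable (Q : SuperpositionLaw U₀ U₁ U₂) {w₀ w₀' : Fin (numIndices n R.1)}
  {w₁ w₁' : Fin (numIndices n R.2.1)} {w₂ w₂' : Fin (numIndices n R.2.2)}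
  {b₁ b₁' : Fin (numIndices n B.1)} {b₂ b₂' : Fin (numIndices n B.2)}

lemma expect_codebook_single (F : (Fin n → U₀) → (Fin n → U₁) → (Fin n → U₂) → ℝ≥0∞) :
    expect (codebookLaw Q n R B) (fun C => F (C.word₀ w₀) (C.word₁ w₀ w₁ b₁) (C.word₂ w₀ w₂ b₂)) =
      expect (indepLaw fun _ => Q.base) fun a₀ => expect (Q.sat₁ a₀) fun a₁ =>
        expect (Q.sat₂ a₀) fun a₂ => F a₀ a₁ a₂ := by
  rw [expect_codebookLaw]
  rw [← expect_indepLaw_eval (fun _ : Fin (numIndices n R.1) => indepLaw fun _ : Fin n => Q.base)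
    w₀]
  congr 1 with c₀
  rw [← expect_nested_eval (fun w₀ => Q.sat₁ (c₀ w₀)) w₀ w₁ b₁]
  congr 1 with c₁
  rw [← expect_nested_eval (fun w₀ => Q.sat₂ (c₀ w₀)) w₀ w₂ b₂]

lemma expect_codebook_wrong₁ (h₁ : (w₁, b₁) ≠ (w₁', b₁'))
    (F : (Fin n → U₀) → (Fin n → U₁) → (Fin n → U₁) → (Fin n → U₂) → ℝ≥0∞) :
    expect (codebookLaw Q n R B) (fun C => F (C.word₀ w₀) (C.word₁ w₀ w₁ b₁) (C.word₁ w₀ w₁' b₁')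
      (C.word₂ w₀ w₂ b₂)) =
      expect (indepLaw fun _ => Q.base) fun a₀ => expect (Q.sat₁ a₀) fun a₁ =>
        expect (Q.sat₁ a₀) fun a₁' => expect (Q.sat₂ a₀) fun a₂ => F a₀ a₁ a₁' a₂ := by
  rw [expect_codebookLaw]
  rw [← expect_indepLaw_eval (fun _ : Fin (numIndices n R.1) => indepLaw fun _ : Fin n => Q.base)
    w₀]
  congr 1 with c₀
  rw [← expect_nested_pair (fun w₀ => Q.sat₁ (c₀ w₀)) (w₀ := w₀) (w₀' := w₀)
    (fun h => h₁ (Prod.ext_iff.1 h).2)]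
  congr 1 with c₁
  rw [← expect_nested_eval (fun w₀ => Q.sat₂ (c₀ w₀)) w₀ w₂ b₂]

lemma expect_codebook_wrong₂ (h₂ : (w₂, b₂) ≠ (w₂', b₂'))
    (F : (Fin n → U₀) → (Fin n → U₁) → (Fin n → U₂) → (Fin n → U₂) → ℝ≥0∞) :
    expect (codebookLaw Q n R B) (fun C => F (C.word₀ w₀) (C.word₁ w₀ w₁ b₁)
      (C.word₂ w₀ w₂ b₂) (C.word₂ w₀ w₂' b₂')) =
      expect (indepLaw fun _ => Q.base) fun a₀ => expect (Q.sat₁ a₀) fun a₁ =>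
        expect (Q.sat₂ a₀) fun a₂ => expect (Q.sat₂ a₀) fun a₂' => F a₀ a₁ a₂ a₂' := by
  rw [expect_codebookLaw]
  rw [← expect_indepLaw_eval (fun _ : Fin (numIndices n R.1) => indepLaw fun _ : Fin n => Q.base)
    w₀]
  congr 1 with c₀
  rw [← expect_nested_eval (fun w₀ => Q.sat₁ (c₀ w₀)) w₀ w₁ b₁]
  congr 1 with c₁
  rw [← expect_nested_pair (fun w₀ => Q.sat₂ (c₀ w₀)) (w₀ := w₀) (w₀' := w₀)
    (fun h => h₂ (Prod.ext_iff.1 h).2)]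

lemma expect_codebook_wrongBoth (h₁ : (w₁, b₁) ≠ (w₁', b₁')) (h₂ : (w₂, b₂) ≠ (w₂', b₂'))
    (F : (Fin n → U₀) → (Fin n → U₁) → (Fin n → U₁) → (Fin n → U₂) → (Fin n → U₂) → ℝ≥0∞) :
    expect (codebookLaw Q n R B) (fun C => F (C.word₀ w₀) (C.word₁ w₀ w₁ b₁) (C.word₁ w₀ w₁' b₁')
      (C.word₂ w₀ w₂ b₂) (C.word₂ w₀ w₂' b₂')) =
      expect (indepLaw fun _ => Q.base) fun a₀ => expect (Q.sat₁ a₀) fun a₁ =>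
        expect (Q.sat₁ a₀) fun a₁' => expect (Q.sat₂ a₀) fun a₂ => expect (Q.sat₂ a₀) fun a₂' =>
          F a₀ a₁ a₁' a₂ a₂' := by
  rw [expect_codebookLaw]
  rw [← expect_indepLaw_eval (fun _ : Fin (numIndices n R.1) => indepLaw fun _ : Fin n => Q.base)
    w₀]
  congr 1 with c₀
  rw [← expect_nested_pair (fun w₀ => Q.sat₁ (c₀ w₀)) (w₀ := w₀) (w₀' := w₀)
    (fun h => h₁ (Prod.ext_iff.1 h).2)]
  congr 1 with c₁
  rw [← expect_nested_pair (fun w₀ => Q.sat₂ (c₀ w₀)) (w₀ := w₀) (w₀' := w₀)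
    (fun h => h₂ (Prod.ext_iff.1 h).2)]

lemma expect_codebook_wrongAll (h₀ : w₀ ≠ w₀')
    (F : (Fin n → U₀) → (Fin n → U₀) → (Fin n → U₁) → (Fin n → U₁) → (Fin n → U₂) →
      (Fin n → U₂) → ℝ≥0∞) :
    expect (codebookLaw Q n R B) (fun C => F (C.word₀ w₀) (C.word₀ w₀')
      (C.word₁ w₀ w₁ b₁) (C.word₁ w₀' w₁' b₁') (C.word₂ w₀ w₂ b₂) (C.word₂ w₀' w₂' b₂')) =
      expect (indepLaw fun _ => Q.base) fun a₀ => expect (indepLaw fun _ => Q.base) fun a₀' =>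
        expect (Q.sat₁ a₀) fun a₁ => expect (Q.sat₁ a₀') fun a₁' =>
        expect (Q.sat₂ a₀) fun a₂ => expect (Q.sat₂ a₀') fun a₂' =>
          F a₀ a₀' a₁ a₁' a₂ a₂' := by
  rw [expect_codebookLaw]
  rw [← expect_indepLaw_pair (fun _ : Fin (numIndices n R.1) => indepLaw fun _ : Fin n => Q.base)
    h₀]
  congr 1 with c₀
  rw [← expect_nested_pair (fun w₀ => Q.sat₁ (c₀ w₀)) (w₀ := w₀) (w₀' := w₀') (w := w₁)
    (w' := w₁') (b := b₁) (b' := b₁') (fun h => h₀ (Prod.ext_iff.1 h).1)]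
  congr 1 with c₁
  rw [← expect_nested_pair (fun w₀ => Q.sat₂ (c₀ w₀)) (w₀ := w₀) (w₀' := w₀') (w := w₂)
    (w' := w₂') (b := b₂) (b' := b₂') (fun h => h₀ (Prod.ext_iff.1 h).1)]

end Codebook

/-! ### Wrong codewords: change of measure and reduction to memoryless laws -/

section Events

variable {U₀ U₁ U₂ X₁ X₂ Y : Type*} [Fintype U₀] [Fintype U₁] [Fintype U₂] [Fintype Y]
  {n : ℕ} {R : Rates} {B : ℝ × ℝ}
  {P Q : SuperpositionLaw U₀ U₁ U₂} (W : X₁ → X₂ → PMF Y)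
  (f₁ : U₀ → U₁ → X₁) (f₂ : U₀ → U₂ → X₂)
  {G₁ : (Fin n → U₀) → (Fin n → U₁) → ℝ≥0∞} {G₂ : (Fin n → U₀) → (Fin n → U₂) → ℝ≥0∞}
  {γ₁ γ₂ : ℝ≥0∞}

/-- The output of the channel when the codewords `a₀, a₁, a₂` are used. -/
abbrev wordOutput (a₀ : Fin n → U₀) (a₁ : Fin n → U₁) (a₂ : Fin n → U₂) : PMF (Fin n → Y) :=
  channelOutput W (fun i => f₁ (a₀ i) (a₁ i)) (fun i => f₂ (a₀ i) (a₂ i))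

/-- The sequence of tuples formed by three codewords and an output. -/
abbrev zipWords (a₀ : Fin n → U₀) (a₁ : Fin n → U₁) (a₂ : Fin n → U₂) (y : Fin n → Y) :
    Fin n → (U₀ × U₁ × U₂) × Y := fun i => ((a₀ i, a₁ i, a₂ i), y i)

/-- The weight `G` turns a sample from `q` into one from `p`, up to the factor `γ`. -/
lemma expect_mul_le_of_le {α : Type*} {p q : PMF α} {G : α → ℝ≥0∞} {γ : ℝ≥0∞}
    (h : ∀ a, q a * G a ≤ γ * p a) (f : α → ℝ≥0∞) :
    expect q (fun a => G a * f a) ≤ γ * expect p f := by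
  rw [expect, expect, ← ENNReal.tsum_mul_left]
  refine ENNReal.tsum_le_tsum fun a => ?_
  rw [← mul_assoc, ← mul_assoc]
  exact mul_le_mul' (h a) le_rfl

variable (hb : P.base = Q.base)
  (hG₁ : ∀ a₀ a₁, Q.sat₁ a₀ a₁ * G₁ a₀ a₁ ≤ γ₁ * P.sat₁ a₀ a₁)
  (hG₂ : ∀ a₀ a₂, Q.sat₂ a₀ a₂ * G₂ a₀ a₂ ≤ γ₂ * P.sat₂ a₀ a₂)
  {w₀ w₀' : Fin (numIndices n R.1)}
  {w₁ w₁' : Fin (numIndices n R.2.1)} {w₂ w₂' : Fin (numIndices n R.2.2)}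
  {b₁ b₁' : Fin (numIndices n B.1)} {b₂ b₂' : Fin (numIndices n B.2)}
  (φ : (Fin n → (U₀ × U₁ × U₂) × Y) → ℝ≥0∞)

include hb hG₁ hG₂

/-- For the sent codewords, the weights turn the codebook law into the encoding law. The following
lemmas give the same change of measure when a tuple is tested that contains wrong codewords, which
keep the codebook law; in each of them the sent codewords that are not tested are averaged out. -/
lemma expect_sent_le :
    expect (codebookLaw Q n R B) (fun C => G₁ (C.word₀ w₀) (C.word₁ w₀ w₁ b₁) *
      (G₂ (C.word₀ w₀) (C.word₂ w₀ w₂ b₂) *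
      expect (wordOutput W f₁ f₂ (C.word₀ w₀) (C.word₁ w₀ w₁ b₁) (C.word₂ w₀ w₂ b₂)) fun y =>
        φ (zipWords (C.word₀ w₀) (C.word₁ w₀ w₁ b₁) (C.word₂ w₀ w₂ b₂) y))) ≤
    γ₁ * γ₂ * expect (indepLaw fun _ => P.lawWithOutput W f₁ f₂) φ := by
  rw [expect_codebook_single Q fun a₀ a₁ a₂ => G₁ a₀ a₁ * (G₂ a₀ a₂ *
    expect (wordOutput W f₁ f₂ a₀ a₁ a₂) fun y => φ (zipWords a₀ a₁ a₂ y))]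
  simp only [SuperpositionLaw.lawWithOutput, SuperpositionLaw.law, expect_indepLaw_bind,
    expect_indepLaw_map, ← hb]
  rw [← expect_mul_left]
  refine expect_mono fun a₀ => ?_
  simp only [expect_mul_left]
  refine (expect_mul_le_of_le (hG₁ a₀) _).trans ?_
  rw [mul_assoc]
  gcongr
  rw [← expect_mul_left]
  exact expect_mono fun a₁ => expect_mul_le_of_le (hG₂ a₀) _

lemma expect_wrong₁_le (h₁ : (w₁, b₁) ≠ (w₁', b₁')) :
    expect (codebookLaw Q n R B) (fun C => G₁ (C.word₀ w₀) (C.word₁ w₀ w₁ b₁) *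
      (G₂ (C.word₀ w₀) (C.word₂ w₀ w₂ b₂) *
      expect (wordOutput W f₁ f₂ (C.word₀ w₀) (C.word₁ w₀ w₁ b₁) (C.word₂ w₀ w₂ b₂)) fun y =>
        φ (zipWords (C.word₀ w₀) (C.word₁ w₀ w₁' b₁') (C.word₂ w₀ w₂ b₂) y))) ≤
    γ₁ * γ₂ * expect (indepLaw fun _ => P.test₁ Q W f₁ f₂) φ := by
  rw [expect_codebook_wrong₁ Q h₁ fun a₀ a₁ a₁' a₂ => G₁ a₀ a₁ * (G₂ a₀ a₂ *
    expect (wordOutput W f₁ f₂ a₀ a₁ a₂) fun y => φ (zipWords a₀ a₁' a₂ y))]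
  simp only [SuperpositionLaw.test₁, joint, SuperpositionLaw.out₁, SuperpositionLaw.mix₁,
    SuperpositionLaw.law, expect_indepLaw_bind, expect_indepLaw_map, ← hb]
  rw [← expect_mul_left]
  refine expect_mono fun a₀ => ?_
  simp only [expect_mul_left]
  refine (expect_mul_le_of_le (hG₁ a₀) _).trans ?_
  rw [mul_assoc]
  gcongr
  rw [expect_comm, ← expect_mul_left]
  refine expect_mono fun a₁' => ?_
  rw [expect_comm (P.sat₂ a₀), ← expect_mul_left]
  exact expect_mono fun a₁ => expect_mul_le_of_le (hG₂ a₀) _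

lemma expect_wrong₂_le (h₂ : (w₂, b₂) ≠ (w₂', b₂')) :
    expect (codebookLaw Q n R B) (fun C => G₁ (C.word₀ w₀) (C.word₁ w₀ w₁ b₁) *
      (G₂ (C.word₀ w₀) (C.word₂ w₀ w₂ b₂) *
      expect (wordOutput W f₁ f₂ (C.word₀ w₀) (C.word₁ w₀ w₁ b₁) (C.word₂ w₀ w₂ b₂)) fun y =>
        φ (zipWords (C.word₀ w₀) (C.word₁ w₀ w₁ b₁) (C.word₂ w₀ w₂' b₂') y))) ≤
    γ₁ * γ₂ * expect (indepLaw fun _ => P.test₂ Q W f₁ f₂) φ := by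
  rw [expect_codebook_wrong₂ Q h₂ fun a₀ a₁ a₂ a₂' => G₁ a₀ a₁ * (G₂ a₀ a₂ *
    expect (wordOutput W f₁ f₂ a₀ a₁ a₂) fun y => φ (zipWords a₀ a₁ a₂' y))]
  simp only [SuperpositionLaw.test₂, joint, SuperpositionLaw.out₂, SuperpositionLaw.mix₂,
    SuperpositionLaw.law, expect_indepLaw_bind, expect_indepLaw_map, ← hb]
  rw [← expect_mul_left]
  refine expect_mono fun a₀ => ?_
  simp only [expect_mul_left]
  refine (expect_mul_le_of_le (hG₁ a₀) _).trans ?_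
  rw [mul_assoc]
  gcongr
  rw [← expect_mul_left]
  refine expect_mono fun a₁ => ?_
  rw [expect_comm (Q.sat₂ a₀) (P.sat₂ a₀)]
  exact expect_mul_le_of_le (hG₂ a₀) _

lemma expect_wrongBoth_le (h₁ : (w₁, b₁) ≠ (w₁', b₁')) (h₂ : (w₂, b₂) ≠ (w₂', b₂')) :
    expect (codebookLaw Q n R B) (fun C => G₁ (C.word₀ w₀) (C.word₁ w₀ w₁ b₁) *
      (G₂ (C.word₀ w₀) (C.word₂ w₀ w₂ b₂) *
      expect (wordOutput W f₁ f₂ (C.word₀ w₀) (C.word₁ w₀ w₁ b₁) (C.word₂ w₀ w₂ b₂)) fun y =>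
        φ (zipWords (C.word₀ w₀) (C.word₁ w₀ w₁' b₁') (C.word₂ w₀ w₂' b₂') y))) ≤
    γ₁ * γ₂ * expect (indepLaw fun _ => P.testBoth Q W f₁ f₂) φ := by
  rw [expect_codebook_wrongBoth Q h₁ h₂ fun a₀ a₁ a₁' a₂ a₂' => G₁ a₀ a₁ * (G₂ a₀ a₂ *
    expect (wordOutput W f₁ f₂ a₀ a₁ a₂) fun y => φ (zipWords a₀ a₁' a₂' y))]
  simp only [SuperpositionLaw.testBoth, joint, SuperpositionLaw.outBoth,
    SuperpositionLaw.law, expect_indepLaw_bind, expect_indepLaw_map, ← hb]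
  rw [← expect_mul_left]
  refine expect_mono fun a₀ => ?_
  simp only [expect_mul_left]
  refine (expect_mul_le_of_le (hG₁ a₀) _).trans ?_
  rw [mul_assoc]
  gcongr
  rw [expect_comm, ← expect_mul_left]
  refine expect_mono fun a₁' => ?_
  rw [expect_comm (Q.sat₂ a₀), ← expect_mul_left]
  refine expect_mono fun a₁ => ?_
  rw [expect_comm (Q.sat₂ a₀)]
  exact expect_mul_le_of_le (hG₂ a₀) _

lemma expect_wrongAll_le (h₀ : w₀ ≠ w₀') :
    expect (codebookLaw Q n R B) (fun C => G₁ (C.word₀ w₀) (C.word₁ w₀ w₁ b₁) *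
      (G₂ (C.word₀ w₀) (C.word₂ w₀ w₂ b₂) *
      expect (wordOutput W f₁ f₂ (C.word₀ w₀) (C.word₁ w₀ w₁ b₁) (C.word₂ w₀ w₂ b₂)) fun y =>
        φ (zipWords (C.word₀ w₀') (C.word₁ w₀' w₁' b₁') (C.word₂ w₀' w₂' b₂') y))) ≤
    γ₁ * γ₂ * expect (indepLaw fun _ => P.testAll Q W f₁ f₂) φ := by
  rw [expect_codebook_wrongAll Q h₀ fun a₀ a₀' a₁ a₁' a₂ a₂' => G₁ a₀ a₁ * (G₂ a₀ a₂ *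
    expect (wordOutput W f₁ f₂ a₀ a₁ a₂) fun y => φ (zipWords a₀' a₁' a₂' y))]
  simp only [SuperpositionLaw.testAll, joint, SuperpositionLaw.outAll,
    SuperpositionLaw.law, expect_indepLaw_bind, expect_indepLaw_map, ← hb]
  rw [expect_comm, ← expect_mul_left]
  refine expect_mono fun a₀' => ?_
  have hcomm : ∀ (r : (Fin n → U₀) → (Fin n → U₁) → (Fin n → U₂) → ℝ≥0∞),
      (expect (Q.sat₁ a₀') fun a₁' => expect (Q.sat₂ a₀') fun a₂' =>
        expect (indepLaw fun _ => P.base) fun a₀ => r a₀ a₁' a₂') =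
      expect (indepLaw fun _ => P.base) fun a₀ => expect (Q.sat₁ a₀') fun a₁' =>
        expect (Q.sat₂ a₀') fun a₂' => r a₀ a₁' a₂' := by
    intro r
    rw [expect_comm (indepLaw fun _ => P.base)]
    exact congrArg _ (funext fun a₁' => expect_comm _ _ _)
  rw [hcomm, ← expect_mul_left]
  refine expect_mono fun a₀ => ?_
  simp only [expect_mul_left]
  refine (expect_mul_le_of_le (hG₁ a₀) _).trans ?_
  rw [mul_assoc]
  gcongr
  rw [expect_comm, ← expect_mul_left]
  refine expect_mono fun a₁' => ?_
  rw [expect_comm (Q.sat₂ a₀'), ← expect_mul_left]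
  refine expect_mono fun a₁ => ?_
  rw [expect_comm (Q.sat₂ a₀')]
  exact expect_mul_le_of_le (hG₂ a₀) _

end Events

/-! ### The union bound for the decoding error -/

section Core

variable {U₀ U₁ U₂ X₁ X₂ Y : Type*}
  {n : ℕ} {R : Rates} {B : ℝ × ℝ}
  (P Q : SuperpositionLaw U₀ U₁ U₂) (W : X₁ → X₂ → PMF Y)
  (f₁ : U₀ → U₁ → X₁) (f₂ : U₀ → U₂ → X₂) (ε : ℝ)

/-- The indicator of a decoding error when `w` was sent and `y` received. -/
def errInd (C : Codebook U₀ U₁ U₂ n R B) (w : Messages n R) (y : Fin n → Y) : ℝ≥0∞ :=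
  {z : Messages n R × Option (Messages n R) | z.2 ≠ some z.1}.indicator 1
    (w, decode P W f₁ f₂ ε C y)

lemma errInd_le_one (C : Codebook U₀ U₁ U₂ n R B) (w : Messages n R) (y : Fin n → Y) :
    errInd P W f₁ f₂ ε C w y ≤ 1 := by
  unfold errInd
  exact Set.indicator_apply_le' (fun _ => le_rfl) fun _ => zero_le

/-- The indicator of the codewords with the given indices being jointly typical with `y`. -/
def typInd (C : Codebook U₀ U₁ U₂ n R B) (y : Fin n → Y) (w₀ : Fin (numIndices n R.1))
    (k₁ : Fin (numIndices n R.2.1) × Fin (numIndices n B.1))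
    (k₂ : Fin (numIndices n R.2.2) × Fin (numIndices n B.2)) : ℝ≥0∞ :=
  (typicalSet ε (P.lawWithOutput W f₁ f₂) n).indicator 1
    (zipWords (C.word₀ w₀) (C.word₁ w₀ k₁.1 k₁.2) (C.word₂ w₀ k₂.1 k₂.2) y)

/-- The wrong index tuples fall into four classes, according to which of the codewords differ from
the sent ones. A codeword with the right message and a wrong bin index counts as a wrong one. -/
lemma errInd_le (C : Codebook U₀ U₁ U₂ n R B) (w : Messages n R) (y : Fin n → Y)
    (b₁ : Fin (numIndices n B.1)) (b₂ : Fin (numIndices n B.2)) :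
    errInd P W f₁ f₂ ε C w y ≤
      (typicalSet ε (P.lawWithOutput W f₁ f₂) n)ᶜ.indicator 1
        (zipWords (C.word₀ w.1) (C.word₁ w.1 w.2.1 b₁) (C.word₂ w.1 w.2.2 b₂) y) +
      ((∑ w₀ ∈ Finset.univ.erase w.1, ∑ k₁, ∑ k₂, typInd P W f₁ f₂ ε C y w₀ k₁ k₂) +
      ((∑ k₁ ∈ Finset.univ.erase (w.2.1, b₁), ∑ k₂ ∈ Finset.univ.erase (w.2.2, b₂),
        typInd P W f₁ f₂ ε C y w.1 k₁ k₂) +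
      ((∑ k₁ ∈ Finset.univ.erase (w.2.1, b₁), typInd P W f₁ f₂ ε C y w.1 k₁ (w.2.2, b₂)) +
      ∑ k₂ ∈ Finset.univ.erase (w.2.2, b₂), typInd P W f₁ f₂ ε C y w.1 (w.2.1, b₁) k₂))) := by
  classical
  by_cases hd : decode P W f₁ f₂ ε C y = some w
  · rw [errInd, Set.indicator_of_notMem (by simp [hd])]
    exact zero_le
  by_cases hs : zipWords (C.word₀ w.1) (C.word₁ w.1 w.2.1 b₁) (C.word₂ w.1 w.2.2 b₂) y ∈
      typicalSet ε (P.lawWithOutput W f₁ f₂) n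
  swap
  · rw [Set.indicator_of_mem (Set.mem_compl hs)]
    exact (errInd_le_one P W f₁ f₂ ε C w y).trans le_self_add
  obtain ⟨w', hne, b₁', b₂', ht⟩ : ∃ w' : Messages n R, w' ≠ w ∧ ∃ b₁' b₂',
      zipWords (C.word₀ w'.1) (C.word₁ w'.1 w'.2.1 b₁') (C.word₂ w'.1 w'.2.2 b₂') y ∈
      typicalSet ε (P.lawWithOutput W f₁ f₂) n := by
    by_contra! hcon
    have hu : ∃! w : Messages n R, ∃ b₁ b₂,
        (fun i => ((C.word₀ w.1 i, C.word₁ w.1 w.2.1 b₁ i, C.word₂ w.1 w.2.2 b₂ i), y i)) ∈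
        typicalSet ε (P.lawWithOutput W f₁ f₂) n := by
      refine ⟨w, ⟨b₁, b₂, hs⟩, fun w' ⟨b₁', b₂', h'⟩ => ?_⟩
      by_contra hne
      exact hcon w' hne b₁' b₂' h'
    refine hd ?_
    rw [decode, dif_pos hu]
    exact congrArg some (hu.unique (Classical.choose_spec hu.exists) ⟨b₁, b₂, hs⟩)
  have htyp : typInd P W f₁ f₂ ε C y w'.1 (w'.2.1, b₁') (w'.2.2, b₂') = 1 := by
    rw [typInd, Set.indicator_of_mem ht, Pi.one_apply]
  refine (errInd_le_one P W f₁ f₂ ε C w y).trans (le_trans ?_ le_add_self)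
  rw [← htyp]
  obtain ⟨v₀, v₁, v₂⟩ := w'
  obtain ⟨w₀, w₁, w₂⟩ := w
  by_cases h₀ : v₀ = w₀
  swap
  · refine le_trans ?_ le_self_add
    refine le_trans ?_ (Finset.single_le_sum (fun _ _ => zero_le)
      (Finset.mem_erase.2 ⟨h₀, Finset.mem_univ _⟩))
    refine le_trans ?_ (Finset.single_le_sum (fun _ _ => zero_le) (Finset.mem_univ (v₁, b₁')))
    exact Finset.single_le_sum
      (f := fun k₂ => typInd P W f₁ f₂ ε C y v₀ (v₁, b₁') k₂) (fun _ _ => zero_le)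
      (Finset.mem_univ (v₂, b₂'))
  subst h₀
  refine le_trans ?_ le_add_self
  by_cases h₁ : (v₁, b₁') = (w₁, b₁)
  · have h₂ : (v₂, b₂') ≠ (w₂, b₂) := by
      intro h₂
      simp only [Prod.mk.injEq] at h₁ h₂
      exact hne (by rw [h₁.1, h₂.1])
    refine le_trans ?_ le_add_self
    refine le_trans ?_ le_add_self
    simp only [h₁]
    exact Finset.single_le_sum
      (f := fun k₂ => typInd P W f₁ f₂ ε C y v₀ (w₁, b₁) k₂) (fun _ _ => zero_le)
      (Finset.mem_erase.2 ⟨h₂, Finset.mem_univ _⟩)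
  by_cases h₂ : (v₂, b₂') = (w₂, b₂)
  · refine le_trans ?_ le_add_self
    refine le_trans ?_ le_self_add
    simp only [h₂]
    exact Finset.single_le_sum
      (f := fun k₁ => typInd P W f₁ f₂ ε C y v₀ k₁ (w₂, b₂)) (fun _ _ => zero_le)
      (Finset.mem_erase.2 ⟨h₁, Finset.mem_univ _⟩)
  · refine le_trans ?_ le_self_add
    refine le_trans ?_ (Finset.single_le_sum (fun _ _ => zero_le)
      (Finset.mem_erase.2 ⟨h₁, Finset.mem_univ _⟩))
    exact Finset.single_le_sum
      (f := fun k₂ => typInd P W f₁ f₂ ε C y v₀ (v₁, b₁') k₂) (fun _ _ => zero_le)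
      (Finset.mem_erase.2 ⟨h₂, Finset.mem_univ _⟩)

variable [Fintype U₀] [Fintype U₁] [Fintype U₂] [Fintype Y]

lemma schemeErrorProb_eq (ε' : ℝ) : schemeErrorProb P Q W f₁ f₂ R B ε ε' n =
    expect (codebookLaw Q n R B) fun C => expect (PMF.uniformOfFintype (Messages n R)) fun w =>
    expect (bin₁ P ε' C w.1 w.2.1) fun b₁ => expect (bin₂ P ε' C w.1 w.2.2) fun b₂ =>
    expect (wordOutput W f₁ f₂ (C.word₀ w.1) (C.word₁ w.1 w.2.1 b₁) (C.word₂ w.1 w.2.2 b₂)) fun y =>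
      errInd P W f₁ f₂ ε C w y := by
  simp only [schemeErrorProb, toOuterMeasure_eq_expect, expect_bind, expect_map, errInd]

/-- The union bound: the probability that the sent tuple is atypical under the encoding law, plus
for each class of wrong tuples the number of its members times the probability that one of them is
typical. The subtracted ones make the terms of classes without members vanish. -/
def errorBound (n : ℕ) (R : Rates) (B : ℝ × ℝ) : ℝ≥0∞ :=
  expect (indepLaw fun _ : Fin n => P.lawWithOutput W f₁ f₂)
      ((typicalSet ε (P.lawWithOutput W f₁ f₂) n)ᶜ.indicator 1) +
    (((numIndices n R.1 - 1 : ℕ) * ((numIndices n R.2.1 * numIndices n B.1 : ℕ) *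
      ((numIndices n R.2.2 * numIndices n B.2 : ℕ) *
      expect (indepLaw fun _ : Fin n => P.testAll Q W f₁ f₂)
        ((typicalSet ε (P.lawWithOutput W f₁ f₂) n).indicator 1)))) +
    (((numIndices n R.2.1 * numIndices n B.1 - 1 : ℕ) *
      ((numIndices n R.2.2 * numIndices n B.2 - 1 : ℕ) *
      expect (indepLaw fun _ : Fin n => P.testBoth Q W f₁ f₂)
        ((typicalSet ε (P.lawWithOutput W f₁ f₂) n).indicator 1))) +
    (((numIndices n R.2.1 * numIndices n B.1 - 1 : ℕ) *
      expect (indepLaw fun _ : Fin n => P.test₁ Q W f₁ f₂)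
        ((typicalSet ε (P.lawWithOutput W f₁ f₂) n).indicator 1)) +
    ((numIndices n R.2.2 * numIndices n B.2 - 1 : ℕ) *
      expect (indepLaw fun _ : Fin n => P.test₂ Q W f₁ f₂)
        ((typicalSet ε (P.lawWithOutput W f₁ f₂) n).indicator 1)))))

variable {P Q ε}
  {G₁ : (Fin n → U₀) → (Fin n → U₁) → ℝ≥0∞} {G₂ : (Fin n → U₀) → (Fin n → U₂) → ℝ≥0∞}
  {γ₁ γ₂ : ℝ≥0∞} (hb : P.base = Q.base)
  (hG₁ : ∀ a₀ a₁, Q.sat₁ a₀ a₁ * G₁ a₀ a₁ ≤ γ₁ * P.sat₁ a₀ a₁)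
  (hG₂ : ∀ a₀ a₂, Q.sat₂ a₀ a₂ * G₂ a₀ a₂ ≤ γ₂ * P.sat₂ a₀ a₂)

include hb hG₁ hG₂

lemma expect_errInd_le (w : Messages n R) (b₁ : Fin (numIndices n B.1))
    (b₂ : Fin (numIndices n B.2)) :
    expect (codebookLaw Q n R B) (fun C => G₁ (C.word₀ w.1) (C.word₁ w.1 w.2.1 b₁) *
      (G₂ (C.word₀ w.1) (C.word₂ w.1 w.2.2 b₂) *
      expect (wordOutput W f₁ f₂ (C.word₀ w.1) (C.word₁ w.1 w.2.1 b₁) (C.word₂ w.1 w.2.2 b₂))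
        fun y => errInd P W f₁ f₂ ε C w y)) ≤ γ₁ * γ₂ * errorBound P Q W f₁ f₂ ε n R B := by
  refine (expect_mono fun C => mul_le_mul' le_rfl (mul_le_mul' le_rfl
    (expect_mono fun y => errInd_le P W f₁ f₂ ε C w y b₁ b₂))).trans ?_
  simp only [expect_add, expect_sum, mul_add, Finset.mul_sum, typInd, errorBound]
  refine add_le_add (expect_sent_le W f₁ f₂ hb hG₁ hG₂ _) (add_le_add ?_ (add_le_add ?_
    (add_le_add ?_ ?_)))
  · refine (Finset.sum_le_sum fun w₀ hw₀ => Finset.sum_le_sum fun k₁ _ =>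
      Finset.sum_le_sum fun k₂ _ => expect_wrongAll_le W f₁ f₂ hb hG₁ hG₂ _
        (Finset.mem_erase.1 hw₀).1.symm).trans ?_
    simp only [Finset.sum_const, Finset.card_erase_of_mem (Finset.mem_univ _), Finset.card_univ,
      Fintype.card_prod, Fintype.card_fin, nsmul_eq_mul]
    exact le_of_eq (by ring)
  · refine (Finset.sum_le_sum fun k₁ hk₁ => Finset.sum_le_sum fun k₂ hk₂ =>
      expect_wrongBoth_le W f₁ f₂ hb hG₁ hG₂ _ (Finset.mem_erase.1 hk₁).1.symm
        (Finset.mem_erase.1 hk₂).1.symm).trans ?_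
    simp only [Finset.sum_const, Finset.card_erase_of_mem (Finset.mem_univ _), Finset.card_univ,
      Fintype.card_prod, Fintype.card_fin, nsmul_eq_mul]
    exact le_of_eq (by ring)
  · refine (Finset.sum_le_sum fun k₁ hk₁ => expect_wrong₁_le W f₁ f₂ hb hG₁ hG₂ _
      (Finset.mem_erase.1 hk₁).1.symm).trans ?_
    simp only [Finset.sum_const, Finset.card_erase_of_mem (Finset.mem_univ _), Finset.card_univ,
      Fintype.card_prod, Fintype.card_fin, nsmul_eq_mul]
    exact le_of_eq (by ring)
  · refine (Finset.sum_le_sum fun k₂ hk₂ => expect_wrong₂_le W f₁ f₂ hb hG₁ hG₂ _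
      (Finset.mem_erase.1 hk₂).1.symm).trans ?_
    simp only [Finset.sum_const, Finset.card_erase_of_mem (Finset.mem_univ _), Finset.card_univ,
      Fintype.card_prod, Fintype.card_fin, nsmul_eq_mul]
    exact le_of_eq (by ring)

/-- The error probability of the scheme, when outside of exceptional sets of codebooks the laws of
the bin indices are dominated by the uniform law times the weights `G₁`, `G₂`. -/
theorem schemeErrorProb_le {ε' : ℝ} {Bad₁ Bad₂ : Messages n R → Set (Codebook U₀ U₁ U₂ n R B)}
    (h₁ : ∀ w, ∀ C ∉ Bad₁ w, ∀ b₁, bin₁ P ε' C w.1 w.2.1 b₁ ≤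
      (numIndices n B.1 : ℝ≥0∞)⁻¹ * G₁ (C.word₀ w.1) (C.word₁ w.1 w.2.1 b₁))
    (h₂ : ∀ w, ∀ C ∉ Bad₂ w, ∀ b₂, bin₂ P ε' C w.1 w.2.2 b₂ ≤
      (numIndices n B.2 : ℝ≥0∞)⁻¹ * G₂ (C.word₀ w.1) (C.word₂ w.1 w.2.2 b₂))
    {β₁ β₂ : ℝ≥0∞}
    (hβ₁ : ∀ w, expect (codebookLaw Q n R B) ((Bad₁ w).indicator 1) ≤ β₁)
    (hβ₂ : ∀ w, expect (codebookLaw Q n R B) ((Bad₂ w).indicator 1) ≤ β₂) :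
    schemeErrorProb P Q W f₁ f₂ R B ε ε' n ≤
      β₁ + β₂ + γ₁ * γ₂ * errorBound P Q W f₁ f₂ ε n R B := by
  rw [schemeErrorProb_eq, expect_comm]
  refine expect_le_of_le fun w => ?_
  have key : ∀ C : Codebook U₀ U₁ U₂ n R B,
      (expect (bin₁ P ε' C w.1 w.2.1) fun b₁ => expect (bin₂ P ε' C w.1 w.2.2) fun b₂ =>
        expect (wordOutput W f₁ f₂ (C.word₀ w.1) (C.word₁ w.1 w.2.1 b₁) (C.word₂ w.1 w.2.2 b₂))
          fun y => errInd P W f₁ f₂ ε C w y) ≤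
      (Bad₁ w).indicator 1 C + (Bad₂ w).indicator 1 C +
        ∑ b₁, ∑ b₂, (numIndices n B.1 : ℝ≥0∞)⁻¹ * (numIndices n B.2 : ℝ≥0∞)⁻¹ *
        (G₁ (C.word₀ w.1) (C.word₁ w.1 w.2.1 b₁) * (G₂ (C.word₀ w.1) (C.word₂ w.1 w.2.2 b₂) *
        expect (wordOutput W f₁ f₂ (C.word₀ w.1) (C.word₁ w.1 w.2.1 b₁) (C.word₂ w.1 w.2.2 b₂))
          fun y => errInd P W f₁ f₂ ε C w y)) := by
    intro C
    have hone : (expect (bin₁ P ε' C w.1 w.2.1) fun b₁ => expect (bin₂ P ε' C w.1 w.2.2) fun b₂ =>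
        expect (wordOutput W f₁ f₂ (C.word₀ w.1) (C.word₁ w.1 w.2.1 b₁) (C.word₂ w.1 w.2.2 b₂))
          fun y => errInd P W f₁ f₂ ε C w y) ≤ 1 :=
      expect_le_of_le fun _ => expect_le_of_le fun _ => expect_le_of_le fun _ =>
        errInd_le_one P W f₁ f₂ ε C w _
    by_cases c₁ : C ∈ Bad₁ w
    · rw [Set.indicator_of_mem c₁, Pi.one_apply, add_assoc]
      exact hone.trans le_self_add
    by_cases c₂ : C ∈ Bad₂ w
    · rw [Set.indicator_of_mem c₂, Pi.one_apply, add_comm _ 1, add_assoc]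
      exact hone.trans le_self_add
    rw [Set.indicator_of_notMem c₁, Set.indicator_of_notMem c₂, zero_add, zero_add, expect_eq_sum]
    refine Finset.sum_le_sum fun b₁ _ => ?_
    rw [expect_eq_sum, Finset.mul_sum]
    refine Finset.sum_le_sum fun b₂ _ => ?_
    rw [← mul_assoc]
    refine (mul_le_mul' (mul_le_mul' (h₁ w C c₁ b₁) (h₂ w C c₂ b₂)) le_rfl).trans (le_of_eq ?_)
    ring
  refine (expect_mono key).trans ?_
  simp only [expect_add, expect_sum, expect_mul_left]
  refine add_le_add (add_le_add (hβ₁ w) (hβ₂ w)) ?_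
  refine (Finset.sum_le_sum fun b₁ _ => Finset.sum_le_sum fun b₂ _ => mul_le_mul' le_rfl
    (expect_errInd_le W f₁ f₂ hb hG₁ hG₂ w b₁ b₂)).trans (le_of_eq ?_)
  simp only [Finset.sum_const, Finset.card_univ, Fintype.card_fin, nsmul_eq_mul]
  have e1 : (numIndices n B.1 : ℝ≥0∞) * (numIndices n B.1 : ℝ≥0∞)⁻¹ = 1 :=
    ENNReal.mul_inv_cancel (Nat.cast_ne_zero.2 (NeZero.ne _)) (ENNReal.natCast_ne_top _)
  have e2 : (numIndices n B.2 : ℝ≥0∞) * (numIndices n B.2 : ℝ≥0∞)⁻¹ = 1 :=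
    ENNReal.mul_inv_cancel (Nat.cast_ne_zero.2 (NeZero.ne _)) (ENNReal.natCast_ne_top _)
  calc _ = ((numIndices n B.1 : ℝ≥0∞) * (numIndices n B.1 : ℝ≥0∞)⁻¹) *
        ((numIndices n B.2 : ℝ≥0∞) * (numIndices n B.2 : ℝ≥0∞)⁻¹) *
        (γ₁ * γ₂ * errorBound P Q W f₁ f₂ ε n R B) := by ring
    _ = _ := by rw [e1, e2, one_mul, one_mul]

end Core

/-! ### Binning: the law of the selected codeword -/

section Binning

variable {υ α : Type*} [Fintype υ] [Fintype α] {n : ℕ}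

lemma indepLaw_joint (r : PMF υ) (p : υ → PMF α) (a₀ : Fin n → υ) (a₁ : Fin n → α) :
    indepLaw (fun _ => joint r p) (fun i => (a₀ i, a₁ i)) =
      indepLaw (fun _ => r) a₀ * indepLaw (fun i => p (a₀ i)) a₁ := by
  simp only [indepLaw_apply, joint_apply, Finset.prod_mul_distrib]

lemma indepLaw_ne_top {ι : Type*} [Fintype ι] (p : ι → PMF α) (x : ι → α) : indepLaw p x ≠ ⊤ :=
  (indepLaw p).apply_ne_top x

lemma expect_indepLaw_joint (r : PMF υ) (p : υ → PMF α) (f : (Fin n → υ × α) → ℝ≥0∞) :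
    expect (indepLaw fun _ => joint r p) f = expect (indepLaw fun _ => r) fun a₀ =>
      expect (indepLaw fun i => p (a₀ i)) fun a₁ => f fun i => (a₀ i, a₁ i) := by
  simp only [joint, expect_indepLaw_bind, expect_indepLaw_map]

variable {ε : ℝ} {r : PMF υ} {p q : υ → PMF α} {a₀ : Fin n → υ} {a₁ : Fin n → α}

/-- On a typical pair of sequences, the conditional law `p` exceeds the conditional law `q` by the
exponential factor given by their divergence. -/
lemma condLaw_le_of_mem_typicalSet (hn : 0 < n)
    (hac : ∀ z, joint r p z ≠ 0 → joint r q z ≠ 0)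
    (hx : (fun i => (a₀ i, a₁ i)) ∈ typicalSet ε (joint r p) n) :
    indepLaw (fun i => q (a₀ i)) a₁ ≤ ENNReal.ofReal (Real.exp (-(n * (relEnt (joint r p)
      (joint r q) - ε * relEntAbs (joint r p) (joint r q))))) *
        indepLaw (fun i => p (a₀ i)) a₁ := by
  have h := indepLaw_le_of_mem_typicalSet hn hac hx
  rw [indepLaw_joint, indepLaw_joint, mul_left_comm] at h
  have h0 : indepLaw (fun _ => r) a₀ ≠ 0 := by
    rw [indepLaw_apply]
    exact Finset.prod_ne_zero_iff.2 fun i _ =>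
      ((joint_ne_zero_iff r p _).1 (ne_zero_of_mem_typicalSet hn hx i)).1
  exact (ENNReal.mul_le_mul_iff_right h0 (indepLaw_ne_top _ _)).1 h

lemma le_condLaw_of_mem_typicalSet (hn : 0 < n)
    (hac : ∀ z, joint r p z ≠ 0 → joint r q z ≠ 0)
    (hx : (fun i => (a₀ i, a₁ i)) ∈ typicalSet ε (joint r p) n) :
    ENNReal.ofReal (Real.exp (-(n * (relEnt (joint r p) (joint r q) +
      ε * relEntAbs (joint r p) (joint r q))))) * indepLaw (fun i => p (a₀ i)) a₁ ≤
      indepLaw (fun i => q (a₀ i)) a₁ := by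
  have h := le_indepLaw_of_mem_typicalSet hn hac hx
  rw [indepLaw_joint, indepLaw_joint, mul_left_comm] at h
  have h0 : indepLaw (fun _ => r) a₀ ≠ 0 := by
    rw [indepLaw_apply]
    exact Finset.prod_ne_zero_iff.2 fun i _ =>
      ((joint_ne_zero_iff r p _).1 (ne_zero_of_mem_typicalSet hn hx i)).1
  exact (ENNReal.mul_le_mul_iff_right h0 (indepLaw_ne_top _ _)).1 h

/-- Lower tail of a binomial: it is unlikely that at most half of the expected number of
independent samples falls into `S`. -/
lemma expect_few_le {β : Type*} [Fintype β] (μ : PMF β) (S : Set β) (k : ℕ) {τ : ℝ}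
    (hS : ENNReal.ofReal τ ≤ expect μ (S.indicator 1)) :
    expect (indepLaw fun _ : Fin k => μ)
      ({c | (({b | c b ∈ S}.ncard : ℕ) : ℝ) ≤ k * τ / 2}.indicator 1) ≤
      ENNReal.ofReal (Real.exp (-(k * τ / 8))) := by
  classical
  rcases le_or_gt τ 0 with hτ0 | hτ0
  · refine le_trans (b := 1) (expect_le_of_le fun c => Set.indicator_apply_le' (fun _ => le_rfl)
      fun _ => zero_le) ?_
    rw [ENNReal.one_le_ofReal, Real.one_le_exp_iff]
    have : (k : ℝ) * τ ≤ 0 := mul_nonpos_of_nonneg_of_nonpos (Nat.cast_nonneg k) hτ0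
    linarith
  -- Chernoff's bound for the moment `2⁻¹ ^ N`, where `N` is the number of samples in `S`
  set h : β → ℝ≥0∞ := fun v => ENNReal.ofReal (if v ∈ S then 1 / 2 else 1) with hh
  have hpt : ∀ c : Fin k → β, {c : Fin k → β | (({b | c b ∈ S}.ncard : ℕ) : ℝ) ≤
      k * τ / 2}.indicator (1 : (Fin k → β) → ℝ≥0∞) c ≤
      ENNReal.ofReal (Real.exp (k * τ / 2 * Real.log 2)) * ∏ b, h (c b) := by
    intro c
    refine Set.indicator_apply_le' (fun hc => ?_) fun _ => zero_le
    have hprod : ∏ b, h (c b) =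
        ENNReal.ofReal (Real.exp (-(({b | c b ∈ S}.ncard : ℕ) * Real.log 2))) := by
      rw [hh, ← ENNReal.ofReal_prod_of_nonneg fun _ _ => by positivity, Finset.prod_ite,
        Finset.prod_const, Finset.prod_const_one, mul_one, Set.ncard_eq_toFinset_card',
        ← mul_neg, Real.exp_nat_mul, Real.exp_neg, Real.exp_log two_pos, one_div]
      congr 3
      ext b
      simp
    rw [hprod, ← ENNReal.ofReal_mul (Real.exp_pos _).le, ← Real.exp_add, Pi.one_apply,
      ENNReal.one_le_ofReal, Real.one_le_exp_iff]
    have hc' : (({b | c b ∈ S}.ncard : ℕ) : ℝ) ≤ k * τ / 2 := hc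
    have := mul_le_mul_of_nonneg_right hc' (Real.log_pos one_lt_two).le
    linarith
  have hsingle : expect μ h ≤ ENNReal.ofReal (Real.exp (-(τ / 2))) := by
    have hle : τ ≤ ∑ v, (μ v).toReal * (if v ∈ S then 1 else 0) := by
      have h1 : expect μ (S.indicator 1) =
          ENNReal.ofReal (∑ v, (μ v).toReal * (if v ∈ S then 1 else 0)) := by
        rw [← expect_ofReal _ _ fun _ => by positivity]
        congr 1 with v
        by_cases hv : v ∈ S <;> simp [hv]
      rw [h1] at hS
      exact (ENNReal.ofReal_le_ofReal_iff
        (Finset.sum_nonneg fun _ _ => by positivity)).1 hS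
    rw [hh, expect_ofReal _ _ fun _ => by positivity]
    refine ENNReal.ofReal_le_ofReal ?_
    have h2 : ∑ v, (μ v).toReal * (if v ∈ S then (1 / 2 : ℝ) else 1) =
        ∑ v, (μ v).toReal - (∑ v, (μ v).toReal * (if v ∈ S then 1 else 0)) / 2 := by
      rw [Finset.sum_div, ← Finset.sum_sub_distrib]
      refine Finset.sum_congr rfl fun v _ => ?_
      split_ifs <;> ring
    rw [h2, sum_toReal_eq_one]
    have := Real.add_one_le_exp (-(τ / 2))
    linarith
  refine (expect_mono hpt).trans ?_
  rw [expect_mul_left, expect_indepLaw_prod (fun _ => μ) fun _ => h, Finset.prod_const,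
    Finset.card_univ, Fintype.card_fin]
  calc _ ≤ ENNReal.ofReal (Real.exp (k * τ / 2 * Real.log 2)) *
        ENNReal.ofReal (Real.exp (-(τ / 2))) ^ k := by gcongr
    _ = ENNReal.ofReal (Real.exp (k * τ / 2 * Real.log 2 + k * (-(τ / 2)))) := by
        rw [← ENNReal.ofReal_pow (Real.exp_pos _).le, ← Real.exp_nat_mul,
          ← ENNReal.ofReal_mul (Real.exp_pos _).le, ← Real.exp_add]
    _ ≤ _ := by
        refine ENNReal.ofReal_le_ofReal (Real.exp_le_exp.2 ?_)
        have := Real.log_two_lt_d9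
        have hk : 0 ≤ (k : ℝ) * τ := by positivity
        nlinarith

/-- About half of a lower bound for the probability that a codeword from `q` is typical for `p`,
given a typical common codeword. -/
def binThreshold (ε : ℝ) (r : PMF υ) (p q : υ → PMF α) (n : ℕ) : ℝ :=
  Real.exp (-(n * (relEnt (joint r p) (joint r q) + ε * relEntAbs (joint r p) (joint r q)))) / 2

/-- The weight of a codeword in the law of the selected one, relative to the law `q`. -/
def binWeight (ε : ℝ) (r : PMF υ) (p q : υ → PMF α) (a₀ : Fin n → υ) (a₁ : Fin n → α) : ℝ≥0∞ :=
  (typicalSet ε (joint r p) n).indicator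
    (fun _ => ENNReal.ofReal (2 / binThreshold ε r p q n)) fun i => (a₀ i, a₁ i)

lemma binThreshold_pos : 0 < binThreshold ε r p q n := by
  unfold binThreshold; positivity

/-- The law of the selected codeword is dominated by the conditional law `p`, up to a factor of
arbitrarily small exponential growth. -/
lemma mul_binWeight_le (hn : 0 < n) (hac : ∀ z, joint r p z ≠ 0 → joint r q z ≠ 0)
    (a₀ : Fin n → υ) (a₁ : Fin n → α) :
    indepLaw (fun i => q (a₀ i)) a₁ * binWeight ε r p q a₀ a₁ ≤
      ENNReal.ofReal (4 * Real.exp (n * (2 * ε * relEntAbs (joint r p) (joint r q)))) *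
        indepLaw (fun i => p (a₀ i)) a₁ := by
  by_cases hx : (fun i => (a₀ i, a₁ i)) ∈ typicalSet ε (joint r p) n
  · rw [binWeight, Set.indicator_of_mem hx]
    refine (mul_le_mul' (condLaw_le_of_mem_typicalSet hn hac hx) le_rfl).trans (le_of_eq ?_)
    rw [mul_right_comm, ← ENNReal.ofReal_mul (Real.exp_pos _).le]
    congr 2
    rw [binThreshold, div_div_eq_mul_div, Real.exp_neg (n * (_ + _)), div_inv_eq_mul,
      show ∀ x y : ℝ, x * (2 * 2 * y) = 4 * (x * y) by intros; ring, ← Real.exp_add]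
    ring_nf
  · rw [binWeight, Set.indicator_of_notMem hx, mul_zero]
    exact zero_le

/-- It is unlikely that a bin of `k` codewords from `q` holds few codewords typical for `p`. -/
lemma expect_few_typical_le (hn : 0 < n) (hac : ∀ z, joint r p z ≠ 0 → joint r q z ≠ 0) (k : ℕ) :
    (expect (indepLaw fun _ : Fin n => r) fun a₀ =>
      expect (indepLaw fun _ : Fin k => indepLaw fun i => q (a₀ i))
        ({c | (({b | (fun i => (a₀ i, c b i)) ∈ typicalSet ε (joint r p) n}.ncard : ℕ) : ℝ) ≤
          k * binThreshold ε r p q n / 2}.indicator 1)) ≤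
      2 * expect (indepLaw fun _ : Fin n => joint r p) ((typicalSet ε (joint r p) n)ᶜ.indicator 1) +
        ENNReal.ofReal (Real.exp (-(k * binThreshold ε r p q n / 8))) := by
  set τ := binThreshold ε r p q n with hτ
  set T : (Fin n → υ) → Set (Fin n → α) := fun a₀ =>
    {v | (fun i => (a₀ i, v i)) ∈ typicalSet ε (joint r p) n} with hT
  have hgood : ∀ a₀, ¬ (2⁻¹ < expect (indepLaw fun i => p (a₀ i)) ((T a₀)ᶜ.indicator 1)) →
      ENNReal.ofReal τ ≤ expect (indepLaw fun i => q (a₀ i)) ((T a₀).indicator 1) := by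
    intro a₀ h
    have h1 : expect (indepLaw fun i => p (a₀ i)) ((T a₀).indicator 1) +
        expect (indepLaw fun i => p (a₀ i)) ((T a₀)ᶜ.indicator 1) = 1 := by
      rw [← expect_add, ← expect_const (indepLaw fun i => p (a₀ i)) 1]
      congr 1 with v
      by_cases hv : v ∈ T a₀ <;> simp [hv]
    have h2 : 2⁻¹ ≤ expect (indepLaw fun i => p (a₀ i)) ((T a₀).indicator 1) := by
      by_contra! h3
      refine absurd h1 (ne_of_lt ?_)
      calc _ < (2⁻¹ : ℝ≥0∞) + 2⁻¹ := ENNReal.add_lt_add_of_lt_of_le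
            (ne_top_of_le_ne_top (by simp) (not_lt.1 h)) h3 (not_lt.1 h)
        _ = 1 := ENNReal.inv_two_add_inv_two
    calc ENNReal.ofReal τ = ENNReal.ofReal (Real.exp (-(n * (relEnt (joint r p) (joint r q) +
          ε * relEntAbs (joint r p) (joint r q))))) * 2⁻¹ := by
          rw [hτ, binThreshold, ENNReal.ofReal_div_of_pos two_pos, div_eq_mul_inv]
          simp
      _ ≤ ENNReal.ofReal (Real.exp (-(n * (relEnt (joint r p) (joint r q) +
          ε * relEntAbs (joint r p) (joint r q))))) *
            expect (indepLaw fun i => p (a₀ i)) ((T a₀).indicator 1) := by gcongr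
      _ ≤ _ := by
          rw [expect, expect, ← ENNReal.tsum_mul_left]
          refine ENNReal.tsum_le_tsum fun v => ?_
          by_cases hv : v ∈ T a₀
          · simpa [hv] using le_condLaw_of_mem_typicalSet hn hac hv
          · simp [hv]
  have hpt : ∀ a₀, expect (indepLaw fun _ : Fin k => indepLaw fun i => q (a₀ i))
      ({c | (({b | (fun i => (a₀ i, c b i)) ∈ typicalSet ε (joint r p) n}.ncard : ℕ) : ℝ) ≤
        k * τ / 2}.indicator 1) ≤
      {a₀ | 2⁻¹ < expect (indepLaw fun i => p (a₀ i)) ((T a₀)ᶜ.indicator 1)}.indicator 1 a₀ +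
        ENNReal.ofReal (Real.exp (-(k * τ / 8))) := by
    intro a₀
    by_cases h : 2⁻¹ < expect (indepLaw fun i => p (a₀ i)) ((T a₀)ᶜ.indicator 1)
    · rw [Set.indicator_of_mem (by exact h)]
      refine le_trans ?_ le_self_add
      exact expect_le_of_le fun c => Set.indicator_apply_le' (fun _ => le_rfl) fun _ => zero_le
    · exact (expect_few_le _ (T a₀) k (hgood a₀ h)).trans le_add_self
  refine (expect_mono hpt).trans ?_
  rw [expect_add, expect_const]
  gcongr
  refine (expect_indicator_half_le _ _).trans (le_of_eq ?_)
  rw [expect_indepLaw_joint]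
  rfl

lemma chooseIndex_le {k : ℕ} [NeZero k] (S : Set (Fin k)) {τ : ℝ} (hτ : 0 < τ)
    (hS : (k : ℝ) * τ / 2 < (S.ncard : ℕ)) (b : Fin k) :
    chooseIndex S b ≤ (k : ℝ≥0∞)⁻¹ * S.indicator (fun _ => ENNReal.ofReal (2 / τ)) b := by
  classical
  have hk : (0 : ℝ) < k := by exact_mod_cast Nat.pos_of_ne_zero (NeZero.ne k)
  have hpos : (0 : ℝ) < (S.ncard : ℕ) := lt_of_le_of_lt (by positivity) hS
  have hne : S.toFinset.Nonempty := by
    rw [← Finset.card_pos, ← Set.ncard_eq_toFinset_card']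
    exact_mod_cast hpos
  rw [chooseIndex, dif_pos (by convert hne)]
  by_cases hb : b ∈ S
  · rw [PMF.uniformOfFinset_apply_of_mem _ (by simpa using hb), Set.indicator_of_mem hb]
    have hcard : ((S.ncard : ℕ) : ℝ≥0∞) = ENNReal.ofReal (S.ncard : ℕ) := by simp
    have hk' : (k : ℝ≥0∞) = ENNReal.ofReal k := by simp
    rw [← Set.ncard_eq_toFinset_card', hcard, hk', ← ENNReal.ofReal_inv_of_pos hpos,
      ← ENNReal.ofReal_inv_of_pos hk, ← ENNReal.ofReal_mul (by positivity)]
    refine ENNReal.ofReal_le_ofReal ?_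
    rw [show (k : ℝ)⁻¹ * (2 / τ) = (k * τ / 2)⁻¹ by field_simp]
    gcongr
  · rw [PMF.uniformOfFinset_apply_of_notMem _ (by simpa using hb)]
    exact zero_le

end Binning

/-! ### Exponential growth rates -/

/-- The sequence `f` grows at most like `exp (n a)`, up to a constant factor. -/
def ExpBound (f : ℕ → ℝ≥0∞) (a : ℝ) : Prop :=
  ∃ C : ℝ, 0 ≤ C ∧ ∀ n : ℕ, 0 < n → f n ≤ ENNReal.ofReal (C * Real.exp (n * a))

namespace ExpBound

variable {f g : ℕ → ℝ≥0∞} {a b : ℝ}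

lemma mono (hg : ExpBound g a) (h : ∀ n, 0 < n → f n ≤ g n) : ExpBound f a := by
  obtain ⟨C, hC, hg⟩ := hg
  exact ⟨C, hC, fun n hn => (h n hn).trans (hg n hn)⟩

lemma mul (hf : ExpBound f a) (hg : ExpBound g b) : ExpBound (fun n => f n * g n) (a + b) := by
  obtain ⟨C, hC, hf⟩ := hf
  obtain ⟨D, hD, hg⟩ := hg
  refine ⟨C * D, mul_nonneg hC hD, fun n hn => (mul_le_mul' (hf n hn) (hg n hn)).trans ?_⟩
  rw [← ENNReal.ofReal_mul (by positivity), mul_add, Real.exp_add]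
  exact le_of_eq (by ring_nf)

lemma one : ExpBound (fun _ => 1) 0 := ⟨1, zero_le_one, fun n _ => by simp⟩

lemma tendsto_zero (hf : ExpBound f a) (ha : a < 0) : Tendsto f atTop (𝓝 0) := by
  obtain ⟨C, -, hf⟩ := hf
  have h1 : Tendsto (fun n : ℕ => C * Real.exp (n * a)) atTop (𝓝 (C * 0)) :=
    (Real.tendsto_exp_atBot.comp
      (tendsto_natCast_atTop_atTop.atTop_mul_const_of_neg ha)).const_mul C
  rw [mul_zero] at h1
  have h2 := (ENNReal.continuous_ofReal.tendsto 0).comp h1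
  rw [ENNReal.ofReal_zero] at h2
  exact tendsto_of_tendsto_of_tendsto_of_le_of_le' tendsto_const_nhds h2
    (Eventually.of_forall fun _ => zero_le)
    ((eventually_gt_atTop 0).mono fun n hn => hf n hn)

end ExpBound

lemma two_rpow_eq_exp (n : ℕ) (R : ℝ) :
    (2 : ℝ) ^ ((n : ℝ) * R) = Real.exp (n * (R * Real.log 2)) := by
  rw [Real.rpow_def_of_pos two_pos]
  ring_nf

lemma exp_le_numIndices (n : ℕ) (R : ℝ) : Real.exp (n * (R * Real.log 2)) ≤ numIndices n R := by
  rw [← two_rpow_eq_exp]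
  exact Nat.le_ceil _

lemma numIndices_zero (n : ℕ) : numIndices n 0 = 1 := by simp [numIndices]

lemma expBound_numIndices {R : ℝ} (hR : 0 ≤ R) :
    ExpBound (fun n => (numIndices n R : ℝ≥0∞)) (R * Real.log 2) := by
  refine ⟨2, zero_le_two, fun n _ => ?_⟩
  have h1 : (numIndices n R : ℝ) ≤ 2 * Real.exp (n * (R * Real.log 2)) := by
    have h2 : (numIndices n R : ℝ) < (2 : ℝ) ^ ((n : ℝ) * R) + 1 :=
      Nat.ceil_lt_add_one (by positivity)
    have h3 : (1 : ℝ) ≤ (2 : ℝ) ^ ((n : ℝ) * R) := Real.one_le_rpow one_le_two (by positivity)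
    rw [← two_rpow_eq_exp]
    linarith
  calc (numIndices n R : ℝ≥0∞) = ENNReal.ofReal (numIndices n R : ℝ) := by simp
    _ ≤ _ := ENNReal.ofReal_le_ofReal h1

lemma expBound_typical {α : Type*} [Fintype α] {p g : PMF α} {ε : ℝ}
    (hg : ∀ a, p a ≠ 0 → g a ≠ 0) :
    ExpBound (fun n => expect (indepLaw fun _ : Fin n => g) ((typicalSet ε p n).indicator 1))
      (-(relEnt p g - ε * relEntAbs p g)) :=
  ⟨1, zero_le_one, fun n hn => (expect_typicalSet_le hn hg).trans (by rw [one_mul, mul_neg])⟩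

section Asymptotics

variable {U₀ U₁ U₂ X₁ X₂ Y : Type*} [Fintype U₀] [Fintype U₁] [Fintype U₂] [Fintype Y]
  {R : Rates} {B : ℝ × ℝ}
  {P Q : SuperpositionLaw U₀ U₁ U₂} (W : X₁ → X₂ → PMF Y)
  (f₁ : U₀ → U₁ → X₁) (f₂ : U₀ → U₂ → X₂) {ε : ℝ}

/-- The union bound vanishes, even after multiplication by a sequence of small exponential growth
`g`, when each class of wrong index tuples is empty or grows slower than the probability that one
of them looks typical decays. -/
lemma tendsto_mul_errorBound (hb : P.base = Q.base) (h : P.SatelliteAC Q)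
    (hR₀ : 0 ≤ R.1) (hR₁ : 0 ≤ R.2.1) (hR₂ : 0 ≤ R.2.2) (hB₁ : 0 ≤ B.1) (hB₂ : 0 ≤ B.2)
    {γ : ℕ → ℝ≥0∞} {g c : ℝ} (hγ : ExpBound γ g)
    (hc : ExpBound (fun n => expect (indepLaw fun _ : Fin n => P.lawWithOutput W f₁ f₂)
      ((typicalSet ε (P.lawWithOutput W f₁ f₂) n)ᶜ.indicator 1)) (-c)) (hgc : g < c)
    (hall : R.1 = 0 ∨ g + (R.1 + (R.2.1 + B.1) + (R.2.2 + B.2)) * Real.log 2 <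
      P.infoAll W f₁ f₂ * Real.log 2 + (P.natDiv₁ Q + P.natDiv₂ Q) -
        ε * relEntAbs (P.lawWithOutput W f₁ f₂) (P.testAll Q W f₁ f₂))
    (hboth : (R.2.1 = 0 ∧ B.1 = 0) ∨ (R.2.2 = 0 ∧ B.2 = 0) ∨
      g + ((R.2.1 + B.1) + (R.2.2 + B.2)) * Real.log 2 <
      P.infoBoth W f₁ f₂ * Real.log 2 + (P.natDiv₁ Q + P.natDiv₂ Q) -
        ε * relEntAbs (P.lawWithOutput W f₁ f₂) (P.testBoth Q W f₁ f₂))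
    (h₁ : (R.2.1 = 0 ∧ B.1 = 0) ∨ g + (R.2.1 + B.1) * Real.log 2 <
      P.info₁ W f₁ f₂ * Real.log 2 + P.natDiv₁ Q -
        ε * relEntAbs (P.lawWithOutput W f₁ f₂) (P.test₁ Q W f₁ f₂))
    (h₂ : (R.2.2 = 0 ∧ B.2 = 0) ∨ g + (R.2.2 + B.2) * Real.log 2 <
      P.info₂ W f₁ f₂ * Real.log 2 + P.natDiv₂ Q -
        ε * relEntAbs (P.lawWithOutput W f₁ f₂) (P.test₂ Q W f₁ f₂)) :
    Tendsto (fun n => γ n * errorBound P Q W f₁ f₂ ε n R B) atTop (𝓝 0) := by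
  have e₁ : ExpBound (fun n => ((numIndices n R.2.1 * numIndices n B.1 : ℕ) : ℝ≥0∞))
      (R.2.1 * Real.log 2 + B.1 * Real.log 2) :=
    ((expBound_numIndices hR₁).mul (expBound_numIndices hB₁)).mono fun n _ => by
      rw [Nat.cast_mul]
  have e₂ : ExpBound (fun n => ((numIndices n R.2.2 * numIndices n B.2 : ℕ) : ℝ≥0∞))
      (R.2.2 * Real.log 2 + B.2 * Real.log 2) :=
    ((expBound_numIndices hR₂).mul (expBound_numIndices hB₂)).mono fun n _ => by
      rw [Nat.cast_mul]
  have sub : ∀ {m : ℕ → ℕ} {a : ℝ}, ExpBound (fun n => (m n : ℝ≥0∞)) a →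
      ExpBound (fun n => ((m n - 1 : ℕ) : ℝ≥0∞)) a := fun hm =>
    hm.mono fun n _ => by exact_mod_cast Nat.sub_le _ _
  have z₁ : R.2.1 = 0 ∧ B.1 = 0 → ∀ n, numIndices n R.2.1 * numIndices n B.1 - 1 = 0 := by
    rintro ⟨h1, h2⟩ n
    rw [h1, h2, numIndices_zero]
  have z₂ : R.2.2 = 0 ∧ B.2 = 0 → ∀ n, numIndices n R.2.2 * numIndices n B.2 - 1 = 0 := by
    rintro ⟨h1, h2⟩ n
    rw [h1, h2, numIndices_zero]
  have ka := SuperpositionLaw.relEnt_testAll W f₁ f₂ hb h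
  have kb := SuperpositionLaw.relEnt_testBoth W f₁ f₂ hb h
  have k₁ := SuperpositionLaw.relEnt_test₁ W f₁ f₂ h
  have k₂ := SuperpositionLaw.relEnt_test₂ W f₁ f₂ h
  simp only [errorBound, mul_add]
  have t0 := (hγ.mul hc).tendsto_zero (by linarith)
  have ta : Tendsto (fun n => γ n * ((numIndices n R.1 - 1 : ℕ) *
      ((numIndices n R.2.1 * numIndices n B.1 : ℕ) * ((numIndices n R.2.2 * numIndices n B.2 : ℕ) *
      expect (indepLaw fun _ : Fin n => P.testAll Q W f₁ f₂)
        ((typicalSet ε (P.lawWithOutput W f₁ f₂) n).indicator 1))))) atTop (𝓝 0) := by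
    rcases hall with h0 | h0
    · simp [h0, numIndices_zero]
    · refine (hγ.mul ((sub (expBound_numIndices hR₀)).mul (e₁.mul (e₂.mul
        (expBound_typical ka.1))))).tendsto_zero ?_
      rw [ka.2]
      linarith
  have tb : Tendsto (fun n => γ n * ((numIndices n R.2.1 * numIndices n B.1 - 1 : ℕ) *
      ((numIndices n R.2.2 * numIndices n B.2 - 1 : ℕ) *
      expect (indepLaw fun _ : Fin n => P.testBoth Q W f₁ f₂)
        ((typicalSet ε (P.lawWithOutput W f₁ f₂) n).indicator 1)))) atTop (𝓝 0) := by
    rcases hboth with h0 | h0 | h0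
    · simp [z₁ h0]
    · simp [z₂ h0]
    · refine (hγ.mul ((sub e₁).mul ((sub e₂).mul (expBound_typical kb.1)))).tendsto_zero ?_
      rw [kb.2]
      linarith
  have t₁ : Tendsto (fun n => γ n * ((numIndices n R.2.1 * numIndices n B.1 - 1 : ℕ) *
      expect (indepLaw fun _ : Fin n => P.test₁ Q W f₁ f₂)
        ((typicalSet ε (P.lawWithOutput W f₁ f₂) n).indicator 1))) atTop (𝓝 0) := by
    rcases h₁ with h0 | h0
    · simp [z₁ h0]
    · refine (hγ.mul ((sub e₁).mul (expBound_typical k₁.1))).tendsto_zero ?_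
      rw [k₁.2]
      linarith
  have t₂ : Tendsto (fun n => γ n * ((numIndices n R.2.2 * numIndices n B.2 - 1 : ℕ) *
      expect (indepLaw fun _ : Fin n => P.test₂ Q W f₁ f₂)
        ((typicalSet ε (P.lawWithOutput W f₁ f₂) n).indicator 1))) atTop (𝓝 0) := by
    rcases h₂ with h0 | h0
    · simp [z₂ h0]
    · refine (hγ.mul ((sub e₂).mul (expBound_typical k₂.1))).tendsto_zero ?_
      rw [k₂.2]
      linarith
  simpa using t0.add (ta.add (tb.add (t₁.add t₂)))

lemma expect_codebook_bin₁ (Q : SuperpositionLaw U₀ U₁ U₂) {n : ℕ} (w₀ : Fin (numIndices n R.1))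
    (w₁ : Fin (numIndices n R.2.1))
    (F : (Fin n → U₀) → (Fin (numIndices n B.1) → Fin n → U₁) → ℝ≥0∞) :
    expect (codebookLaw Q n R B) (fun C => F (C.word₀ w₀) (C.word₁ w₀ w₁)) =
      expect (indepLaw fun _ => Q.base) fun a₀ => expect (indepLaw fun _ => Q.sat₁ a₀) fun c =>
        F a₀ c := by
  rw [expect_codebookLaw,
    ← expect_indepLaw_eval (fun _ : Fin (numIndices n R.1) => indepLaw fun _ : Fin n => Q.base) w₀]
  congr 1 with c₀
  simp only [expect_const]
  rw [expect_indepLaw_eval (fun w₀ => indepLaw fun _ : Fin (numIndices n R.2.1) =>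
    indepLaw fun _ : Fin (numIndices n B.1) => Q.sat₁ (c₀ w₀)) w₀ fun c => F (c₀ w₀) (c w₁),
    expect_indepLaw_eval (fun _ : Fin (numIndices n R.2.1) =>
    indepLaw fun _ : Fin (numIndices n B.1) => Q.sat₁ (c₀ w₀)) w₁ fun c => F (c₀ w₀) c]

lemma expect_codebook_bin₂ (Q : SuperpositionLaw U₀ U₁ U₂) {n : ℕ} (w₀ : Fin (numIndices n R.1))
    (w₂ : Fin (numIndices n R.2.2))
    (F : (Fin n → U₀) → (Fin (numIndices n B.2) → Fin n → U₂) → ℝ≥0∞) :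
    expect (codebookLaw Q n R B) (fun C => F (C.word₀ w₀) (C.word₂ w₀ w₂)) =
      expect (indepLaw fun _ => Q.base) fun a₀ => expect (indepLaw fun _ => Q.sat₂ a₀) fun c =>
        F a₀ c := by
  rw [expect_codebookLaw,
    ← expect_indepLaw_eval (fun _ : Fin (numIndices n R.1) => indepLaw fun _ : Fin n => Q.base) w₀]
  congr 1 with c₀
  simp only [expect_const]
  rw [expect_indepLaw_eval (fun w₀ => indepLaw fun _ : Fin (numIndices n R.2.2) =>
    indepLaw fun _ : Fin (numIndices n B.2) => Q.sat₂ (c₀ w₀)) w₀ fun c => F (c₀ w₀) (c w₂),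
    expect_indepLaw_eval (fun _ : Fin (numIndices n R.2.2) =>
    indepLaw fun _ : Fin (numIndices n B.2) => Q.sat₂ (c₀ w₀)) w₂ fun c => F (c₀ w₀) c]

/-- An upper bound for the probability that a bin of rate `b` holds few typical codewords. -/
def binFailure {υ α : Type*} [Fintype υ] [Fintype α] (ε : ℝ) (r : PMF υ) (p q : υ → PMF α) (b : ℝ)
    (n : ℕ) : ℝ≥0∞ :=
  2 * expect (indepLaw fun _ : Fin n => joint r p) ((typicalSet ε (joint r p) n)ᶜ.indicator 1) +
    ENNReal.ofReal (Real.exp (-(numIndices n b * binThreshold ε r p q n / 8)))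

/-- Bins of a rate above the divergence of the encoding law from the codebook law are large enough
to hold typical codewords. -/
lemma tendsto_binFailure {υ α : Type*} [Fintype υ] [Fintype α] {ε : ℝ} (hε : 0 < ε) (hε1 : ε ≤ 1)
    (r : PMF υ) (p q : υ → PMF α) {b : ℝ}
    (hlt : relEnt (joint r p) (joint r q) + ε * relEntAbs (joint r p) (joint r q) <
      b * Real.log 2) :
    Tendsto (binFailure ε r p q b) atTop (𝓝 0) := by
  obtain ⟨c, hc, hatyp⟩ := exists_expect_atypical_le hε hε1 (joint r p)
  have h1 : ExpBound (fun n => 2 * expect (indepLaw fun _ : Fin n => joint r p)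
      ((typicalSet ε (joint r p) n)ᶜ.indicator 1)) (0 + -c) := by
    refine ExpBound.mul ⟨2, zero_le_two, fun n _ => by simp⟩
      ⟨2 * Fintype.card (υ × α), by positivity, fun n hn => ?_⟩
    rw [mul_neg]
    exact hatyp n hn
  have h2 : Tendsto (fun n : ℕ => ENNReal.ofReal
      (Real.exp (-(numIndices n b * binThreshold ε r p q n / 8)))) atTop (𝓝 0) := by
    rw [← ENNReal.ofReal_zero]
    refine (ENNReal.continuous_ofReal.tendsto 0).comp (Real.tendsto_exp_atBot.comp ?_)
    rw [tendsto_neg_atBot_iff]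
    have h3 : Tendsto (fun n : ℕ => Real.exp (n * (b * Real.log 2 -
        (relEnt (joint r p) (joint r q) + ε * relEntAbs (joint r p) (joint r q)))) / 16)
        atTop atTop :=
      (Real.tendsto_exp_atTop.comp (tendsto_natCast_atTop_atTop.atTop_mul_const
        (sub_pos.2 hlt))).atTop_div_const (by norm_num)
    refine tendsto_atTop_mono (fun n => ?_) h3
    have h4 := mul_le_mul_of_nonneg_right (exp_le_numIndices n b)
      (Real.exp_pos (-(n * (relEnt (joint r p) (joint r q) +
        ε * relEntAbs (joint r p) (joint r q))))).le
    rw [← Real.exp_add, ← sub_eq_add_neg, ← mul_sub] at h4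
    rw [binThreshold]
    linarith
  have h5 := (h1.tendsto_zero (by linarith)).add h2
  rw [add_zero] at h5
  exact h5

/-- A finite-blocklength bound for the error probability of the scheme: the exceptional codebooks
are those in which the bin of the message holds at most half of the expected number of typical
codewords. -/
lemma schemeErrorProb_le_explicit {n : ℕ} (hn : 0 < n) (hb : P.base = Q.base)
    (h : P.SatelliteAC Q) (ε ε' : ℝ) :
    schemeErrorProb P Q W f₁ f₂ R B ε ε' n ≤
      binFailure ε' P.base P.top₁ Q.top₁ B.1 n + binFailure ε' P.base P.top₂ Q.top₂ B.2 n +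
      ENNReal.ofReal (4 * Real.exp (n * (2 * ε' * relEntAbs P.law₁ Q.law₁))) *
      ENNReal.ofReal (4 * Real.exp (n * (2 * ε' * relEntAbs P.law₂ Q.law₂))) *
        errorBound P Q W f₁ f₂ ε n R B := by
  have hac₁ : ∀ z, joint P.base P.top₁ z ≠ 0 → joint P.base Q.top₁ z ≠ 0 := by
    have := SuperpositionLaw.law₁_ac hb h
    rwa [SuperpositionLaw.law₁_eq_joint, SuperpositionLaw.law₁_eq_joint, ← hb] at this
  have hac₂ : ∀ z, joint P.base P.top₂ z ≠ 0 → joint P.base Q.top₂ z ≠ 0 := by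
    have := SuperpositionLaw.law₂_ac hb h
    rwa [SuperpositionLaw.law₂_eq_joint, SuperpositionLaw.law₂_eq_joint, ← hb] at this
  rw [SuperpositionLaw.law₁_eq_joint, SuperpositionLaw.law₂_eq_joint,
    SuperpositionLaw.law₁_eq_joint, SuperpositionLaw.law₂_eq_joint, ← hb]
  refine schemeErrorProb_le (n := n) W f₁ f₂ hb (mul_binWeight_le hn hac₁)
    (mul_binWeight_le hn hac₂)
    (Bad₁ := fun w => {C | (({b | (fun i => (C.word₀ w.1 i, C.word₁ w.1 w.2.1 b i)) ∈
      typicalSet ε' (joint P.base P.top₁) n}.ncard : ℕ) : ℝ) ≤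
        numIndices n B.1 * binThreshold ε' P.base P.top₁ Q.top₁ n / 2})
    (Bad₂ := fun w => {C | (({b | (fun i => (C.word₀ w.1 i, C.word₂ w.1 w.2.2 b i)) ∈
      typicalSet ε' (joint P.base P.top₂) n}.ncard : ℕ) : ℝ) ≤
        numIndices n B.2 * binThreshold ε' P.base P.top₂ Q.top₂ n / 2})
    (fun w C hC b₁ => ?_) (fun w C hC b₂ => ?_) (fun w => ?_) (fun w => ?_)
  · rw [bin₁, SuperpositionLaw.law₁_eq_joint]
    exact chooseIndex_le _ binThreshold_pos (not_le.1 hC) b₁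
  · rw [bin₂, SuperpositionLaw.law₂_eq_joint]
    exact chooseIndex_le _ binThreshold_pos (not_le.1 hC) b₂
  · refine le_trans (le_of_eq ?_) (expect_few_typical_le hn hac₁ (numIndices n B.1))
    rw [hb, ← expect_codebook_bin₁ Q w.1 w.2.1]
    refine congrArg _ (funext fun C => ?_)
    simp only [Set.indicator_apply, Set.mem_ofPred_eq, Pi.one_apply]
  · refine le_trans (le_of_eq ?_) (expect_few_typical_le hn hac₂ (numIndices n B.2))
    rw [hb, ← expect_codebook_bin₂ Q w.1 w.2.2]
    refine congrArg _ (funext fun C => ?_)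
    simp only [Set.indicator_apply, Set.mem_ofPred_eq, Pi.one_apply]

lemma exists_expBound_atypical {α : Type*} [Fintype α] (hε : 0 < ε) (hε1 : ε ≤ 1) (p : PMF α) :
    ∃ c : ℝ, 0 < c ∧ ExpBound (fun n => expect (indepLaw fun _ : Fin n => p)
      ((typicalSet ε p n)ᶜ.indicator 1)) (-c) := by
  obtain ⟨c, hc, h⟩ := exists_expect_atypical_le hε hε1 p
  refine ⟨c, hc, 2 * Fintype.card α, by positivity, fun n hn => ?_⟩
  rw [mul_neg]
  exact h n hn

/-- A strict inequality at `ε = 0` persists for small positive `ε`. -/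
lemma eventually_lt_sub_mul {a b C : ℝ} (hab : a < b) :
    ∀ᶠ ε in 𝓝[>] (0 : ℝ), a < b - ε * C := by
  have h : Tendsto (fun ε : ℝ => b - ε * C) (𝓝[>] 0) (𝓝 (b - 0 * C)) :=
    (Continuous.tendsto (by fun_prop) _).mono_left nhdsWithin_le_nhds
  rw [zero_mul, sub_zero] at h
  exact h.eventually (lt_mem_nhds hab)

lemma eventually_small : ∀ᶠ ε in 𝓝[>] (0 : ℝ), 0 < ε ∧ ε ≤ 1 :=
  (eventually_mem_nhdsWithin).and
    (nhdsWithin_le_nhds ((gt_mem_nhds one_pos).mono fun _ h => le_of_lt h))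

/-- The random coding scheme succeeds at rates satisfying the strict inequalities (in nats). -/
theorem tendsto_schemeErrorProb (hb : P.base = Q.base) (h : P.SatelliteAC Q)
    (hR₀ : 0 ≤ R.1) (hR₁ : 0 ≤ R.2.1) (hR₂ : 0 ≤ R.2.2) (hB₁ : 0 ≤ B.1) (hB₂ : 0 ≤ B.2)
    (hD₁ : P.natDiv₁ Q < B.1 * Real.log 2) (hD₂ : P.natDiv₂ Q < B.2 * Real.log 2)
    (hall : (R.1 + (R.2.1 + B.1) + (R.2.2 + B.2)) * Real.log 2 <
      P.infoAll W f₁ f₂ * Real.log 2 + (P.natDiv₁ Q + P.natDiv₂ Q))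
    (hboth : ((R.2.1 + B.1) + (R.2.2 + B.2)) * Real.log 2 <
      P.infoBoth W f₁ f₂ * Real.log 2 + (P.natDiv₁ Q + P.natDiv₂ Q))
    (h₁ : (R.2.1 + B.1) * Real.log 2 < P.info₁ W f₁ f₂ * Real.log 2 + P.natDiv₁ Q)
    (h₂ : (R.2.2 + B.2) * Real.log 2 < P.info₂ W f₁ f₂ * Real.log 2 + P.natDiv₂ Q) :
    ∀ᶠ ε in 𝓝[>] (0 : ℝ), ∀ᶠ ε' in 𝓝[>] (0 : ℝ),
      Tendsto (fun n => schemeErrorProb P Q W f₁ f₂ R B ε ε' n) atTop (𝓝 0) := by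
  filter_upwards [eventually_small,
    eventually_lt_sub_mul (C := relEntAbs (P.lawWithOutput W f₁ f₂) (P.testAll Q W f₁ f₂)) hall,
    eventually_lt_sub_mul (C := relEntAbs (P.lawWithOutput W f₁ f₂) (P.testBoth Q W f₁ f₂)) hboth,
    eventually_lt_sub_mul (C := relEntAbs (P.lawWithOutput W f₁ f₂) (P.test₁ Q W f₁ f₂)) h₁,
    eventually_lt_sub_mul (C := relEntAbs (P.lawWithOutput W f₁ f₂) (P.test₂ Q W f₁ f₂)) h₂]
    with ε hε i₁ i₂ i₃ i₄
  obtain ⟨c, hc, hatyp⟩ := exists_expBound_atypical hε.1 hε.2 (P.lawWithOutput W f₁ f₂)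
  -- `ε' * C` is the growth rate of the weights; it has to be small against all slacks for `ε`
  set C := 2 * relEntAbs P.law₁ Q.law₁ + 2 * relEntAbs P.law₂ Q.law₂ with hC
  filter_upwards [eventually_small, eventually_lt_sub_mul (C := C) hc,
    eventually_lt_sub_mul (C := C) i₁, eventually_lt_sub_mul (C := C) i₂,
    eventually_lt_sub_mul (C := C) i₃, eventually_lt_sub_mul (C := C) i₄,
    eventually_lt_sub_mul (C := relEntAbs P.law₁ Q.law₁) hD₁,
    eventually_lt_sub_mul (C := relEntAbs P.law₂ Q.law₂) hD₂] with ε' hε' j₀ j₁ j₂ j₃ j₄ j₅ j₆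
  have hγ : ExpBound (fun n : ℕ =>
      ENNReal.ofReal (4 * Real.exp (n * (2 * ε' * relEntAbs P.law₁ Q.law₁))) *
      ENNReal.ofReal (4 * Real.exp (n * (2 * ε' * relEntAbs P.law₂ Q.law₂)))) (ε' * C) := by
    have := ExpBound.mul (f := fun n : ℕ =>
      ENNReal.ofReal (4 * Real.exp (n * (2 * ε' * relEntAbs P.law₁ Q.law₁))))
      (g := fun n : ℕ => ENNReal.ofReal (4 * Real.exp (n * (2 * ε' * relEntAbs P.law₂ Q.law₂))))
      ⟨4, by norm_num, fun n _ => le_rfl⟩ ⟨4, by norm_num, fun n _ => le_rfl⟩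
    convert this using 1
    rw [hC]
    ring
  have t := tendsto_mul_errorBound W f₁ f₂ hb h hR₀ hR₁ hR₂ hB₁ hB₂ hγ hatyp (by linarith)
    (Or.inr (by linarith)) (Or.inr (Or.inr (by linarith))) (Or.inr (by linarith))
    (Or.inr (by linarith))
  have r₁ := SuperpositionLaw.relEnt_law₁ hb h
  have r₂ := SuperpositionLaw.relEnt_law₂ hb h
  have t₁ := tendsto_binFailure hε'.1 hε'.2 P.base P.top₁ Q.top₁ (b := B.1) (by
    rw [SuperpositionLaw.law₁_eq_joint, SuperpositionLaw.law₁_eq_joint, ← hb] at r₁ j₅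
    linarith)
  have t₂ := tendsto_binFailure hε'.1 hε'.2 P.base P.top₂ Q.top₂ (b := B.2) (by
    rw [SuperpositionLaw.law₂_eq_joint, SuperpositionLaw.law₂_eq_joint, ← hb] at r₂ j₆
    linarith)
  have tt := (t₁.add t₂).add t
  simp only [add_zero] at tt
  exact tendsto_of_tendsto_of_tendsto_of_le_of_le' tendsto_const_nhds tt
    (Eventually.of_forall fun _ => zero_le)
    ((eventually_gt_atTop 0).mono fun n hn => schemeErrorProb_le_explicit W f₁ f₂ hn hb h ε ε')

end Asymptotics

/-! ### The binning region in terms of real numbers -/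

namespace SuperpositionLaw

section Regions

variable {U₀ U₁ U₂ X₁ X₂ Y : Type*} [Fintype U₀] [Fintype U₁] [Fintype U₂] [Fintype Y]
  {P Q : SuperpositionLaw U₀ U₁ U₂} (W : X₁ → X₂ → PMF Y)
  (f₁ : U₀ → U₁ → X₁) (f₂ : U₀ → U₂ → X₂)

lemma coe_ofReal_div_log_two {x : ℝ} (hx : 0 ≤ x) :
    ((ENNReal.ofReal (x / Real.log 2) : ℝ≥0∞) : EReal) = ((x / Real.log 2 : ℝ) : EReal) := by
  rw [EReal.coe_ennreal_ofReal, max_eq_left (div_nonneg hx (Real.log_pos one_lt_two).le)]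

omit [Fintype U₂] in
lemma coe_div₁ (h : P.SatelliteAC Q) :
    (P.div₁ Q : EReal) = ((P.natDiv₁ Q / Real.log 2 : ℝ) : EReal) := by
  rw [(div₁_eq h).2, coe_ofReal_div_log_two (div₁_eq h).1]

omit [Fintype U₁] in
lemma coe_div₂ (h : P.SatelliteAC Q) :
    (P.div₂ Q : EReal) = ((P.natDiv₂ Q / Real.log 2 : ℝ) : EReal) := by
  rw [(div₂_eq h).2, coe_ofReal_div_log_two (div₂_eq h).1]

lemma coe_divAll (hb : P.base = Q.base) (h : P.SatelliteAC Q) :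
    (P.divAll Q : EReal) = (((P.natDiv₁ Q + P.natDiv₂ Q) / Real.log 2 : ℝ) : EReal) := by
  rw [divAll_eq hb h, coe_ofReal_div_log_two (add_nonneg (div₁_eq h).1 (div₂_eq h).1)]

omit [Fintype U₁] [Fintype U₂] in
lemma satelliteAC_of_coe_le {B₁ B₂ : ℝ} (h₁ : (P.div₁ Q : EReal) ≤ (B₁ : EReal))
    (h₂ : (P.div₂ Q : EReal) ≤ (B₂ : EReal)) : P.SatelliteAC Q := by
  refine satelliteAC_of_ne_top (fun h => ?_) fun h => ?_
  · rw [h] at h₁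
    exact absurd h₁ (by simp)
  · rw [h] at h₂
    exact absurd h₂ (by simp)

/-- Eliminating the binning rates: the total rates exceed the message rates by at least the
divergences, which are what the constraints on the total rates gain, and equality is possible. -/
lemma image_binningRegion (hb : P.base = Q.base) (h : P.SatelliteAC Q) :
    Prod.fst '' P.binningRegion Q W f₁ f₂ = P.slepianWolfRegion W f₁ f₂ := by
  have d₁ := (div₁_eq h).1
  have d₂ := (div₂_eq h).1
  have hl := Real.log_pos one_lt_two
  ext R
  constructor
  · rintro ⟨z, ⟨R₀, R₁, R₂, B₁, B₂, L₁, L₂, rfl, h0, h1, h2, hB1, hB2, rfl, rfl, i₁, i₂, i₃, i₄, i₅,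
      i₆⟩, rfl⟩
    rw [coe_div₁ h] at i₁ i₅
    rw [coe_div₂ h] at i₂ i₆
    rw [coe_divAll hb h] at i₃ i₄
    norm_cast at i₁ i₂ i₃ i₄ i₅ i₆
    rw [add_div] at i₃ i₄
    exact ⟨R₀, R₁, R₂, rfl, h0, h1, h2, by linarith, by linarith, by linarith, by linarith⟩
  · rintro ⟨R₀, R₁, R₂, rfl, h0, h1, h2, i₃, i₄, i₅, i₆⟩
    refine ⟨((R₀, R₁, R₂), P.natDiv₁ Q / Real.log 2, P.natDiv₂ Q / Real.log 2),
      ⟨R₀, R₁, R₂, _, _, _, _, rfl, h0, h1, h2, by positivity, by positivity, rfl, rfl, ?_⟩, rfl⟩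
    rw [coe_div₁ h, coe_div₂ h, coe_divAll hb h]
    norm_cast
    rw [add_div]
    exact ⟨le_rfl, le_rfl, by linarith, by linarith, by linarith, by linarith⟩

lemma image_binningRegion_subset (hb : P.base = Q.base) :
    Prod.fst '' P.binningRegion Q W f₁ f₂ ⊆ P.slepianWolfRegion W f₁ f₂ := by
  intro R hR
  have h : P.SatelliteAC Q := by
    obtain ⟨z, ⟨_, _, _, _, _, _, _, _, _, _, _, _, _, _, _, h₁, h₂, _⟩, _⟩ := hR
    exact satelliteAC_of_coe_le h₁ h₂
  rwa [image_binningRegion W f₁ f₂ hb h] at hR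

/-- The random coding scheme succeeds on the strict binning region. -/
theorem tendsto_of_mem_strictBinningRegion (hb : P.base = Q.base) {R : Rates} {B : ℝ × ℝ}
    (hz : (R, B) ∈ P.strictBinningRegion Q W f₁ f₂) :
    ∀ᶠ ε in 𝓝[>] (0 : ℝ), ∀ᶠ ε' in 𝓝[>] (0 : ℝ),
      Tendsto (fun n => schemeErrorProb P Q W f₁ f₂ R B ε ε' n) atTop (𝓝 0) := by
  obtain ⟨R₀, R₁, R₂, B₁, B₂, L₁, L₂, hz, h0, h1, h2, hB1, hB2, rfl, rfl, i₁, i₂, i₃, i₄, i₅, i₆⟩ :=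
    hz
  obtain ⟨rfl, rfl⟩ := Prod.mk.inj hz
  have h := satelliteAC_of_coe_le i₁.le i₂.le
  have hl := Real.log_pos one_lt_two
  rw [coe_div₁ h] at i₁ i₅
  rw [coe_div₂ h] at i₂ i₆
  rw [coe_divAll hb h] at i₃ i₄
  norm_cast at i₁ i₂ i₃ i₄ i₅ i₆
  have key : ∀ {x I d : ℝ}, x < I + d / Real.log 2 → x * Real.log 2 < I * Real.log 2 + d := by
    intro x I d hx
    have := mul_lt_mul_of_pos_right hx hl
    rwa [add_mul, div_mul_cancel₀ _ hl.ne'] at this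
  refine tendsto_schemeErrorProb W f₁ f₂ hb h h0 h1 h2 hB1 hB2 ((div_lt_iff₀ hl).1 i₁)
    ((div_lt_iff₀ hl).1 i₂) (key ?_) (key ?_) (key i₅) (key i₆)
  · simpa [add_assoc] using i₃
  · simpa using i₄

end Regions

end SuperpositionLaw

/-! ### Achievability of the Slepian-Wolf region -/

section Direct

variable {U₀ U₁ U₂ X₁ X₂ Y : Type*} [Fintype U₀] [Fintype U₁] [Fintype U₂] [Fintype Y]
  {R : Rates} (P Q : SuperpositionLaw U₀ U₁ U₂) (W : X₁ → X₂ → PMF Y)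
  (f₁ : U₀ → U₁ → X₁) (f₂ : U₀ → U₂ → X₂) {ε : ℝ}

instance (n : ℕ) : Subsingleton (Fin (numIndices n 0)) := by
  rw [numIndices_zero]; infer_instance

/-- With bins of one codeword, some codebook is at least as good as the average one. -/
lemma exists_code_errorProb_le (R : Rates) (ε ε' : ℝ) (n : ℕ) :
    ∃ C : Code X₁ X₂ Y n R, C.errorProb W ≤ schemeErrorProb P Q W f₁ f₂ R (0, 0) ε ε' n := by
  rw [schemeErrorProb_eq]
  obtain ⟨K, hK⟩ := exists_le_of_expect_le
    (le_refl (expect (codebookLaw Q n R (0, 0)) fun C =>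
      expect (PMF.uniformOfFintype (Messages n R)) fun w =>
      expect (bin₁ P ε' C w.1 w.2.1) fun b₁ => expect (bin₂ P ε' C w.1 w.2.2) fun b₂ =>
      expect (wordOutput W f₁ f₂ (C.word₀ w.1) (C.word₁ w.1 w.2.1 b₁) (C.word₂ w.1 w.2.2 b₂))
        fun y => errInd P W f₁ f₂ ε C w y))
  let β : Fin (numIndices n 0) := ⟨0, Nat.pos_of_ne_zero (NeZero.ne _)⟩
  refine ⟨⟨fun w₀ w₁ i => f₁ (K.word₀ w₀ i) (K.word₁ w₀ w₁ β i),
    fun w₀ w₂ i => f₂ (K.word₀ w₀ i) (K.word₂ w₀ w₂ β i),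
    fun y => (decode P W f₁ f₂ ε K y).getD 0⟩, le_trans ?_ hK⟩
  simp only [Code.errorProb, toOuterMeasure_eq_expect, expect_bind, expect_map]
  refine expect_mono fun w => ?_
  have h₁ : ∀ (p : PMF (Fin (numIndices n 0))) (F : Fin (numIndices n 0) → ℝ≥0∞),
      expect p F = F β := by
    intro p F
    rw [← expect_const p (F β)]
    exact congrArg _ (funext fun b => by rw [Subsingleton.elim b β])
  rw [h₁, h₁]
  refine expect_mono fun y => ?_
  unfold errInd
  by_cases hd : decode P W f₁ f₂ ε K y = some w
  · rw [Set.indicator_of_notMem (by simp [hd])]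
    exact zero_le
  · rw [Set.indicator_of_mem (a := (w, decode P W f₁ f₂ ε K y)) (by exact hd)]
    exact Set.indicator_apply_le' (fun _ => le_rfl) fun _ => zero_le

variable {P}

lemma schemeErrorProb_direct_le (ε ε' : ℝ) (n : ℕ) :
    schemeErrorProb P P W f₁ f₂ R (0, 0) ε ε' n ≤ errorBound P P W f₁ f₂ ε n R (0, 0) := by
  have h := schemeErrorProb_le (n := n) (R := R) (B := (0, 0)) (P := P) (Q := P) W f₁ f₂ (ε := ε)
    (ε' := ε') (G₁ := fun _ _ => 1) (G₂ := fun _ _ => 1) (γ₁ := 1) (γ₂ := 1) rfl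
    (fun _ _ => by rw [mul_one, one_mul]) (fun _ _ => by rw [mul_one, one_mul])
    (Bad₁ := fun _ => ∅) (Bad₂ := fun _ => ∅)
    (fun w C _ b₁ => by simpa [numIndices_zero] using PMF.coe_le_one _ _)
    (fun w C _ b₂ => by simpa [numIndices_zero] using PMF.coe_le_one _ _)
    (β₁ := 0) (β₂ := 0) (fun w => by simp) (fun w => by simp)
  simpa using h

/-- Superposition coding without binning achieves the rates for which each of the Slepian-Wolf
inequalities is strict or concerns only messages of rate zero. -/
lemma isAchievable_of_lt (hR₀ : 0 ≤ R.1) (hR₁ : 0 ≤ R.2.1) (hR₂ : 0 ≤ R.2.2)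
    (hall : R.1 = 0 ∨ R.1 + R.2.1 + R.2.2 < P.infoAll W f₁ f₂)
    (hboth : R.2.1 = 0 ∨ R.2.2 = 0 ∨ R.2.1 + R.2.2 < P.infoBoth W f₁ f₂)
    (h₁ : R.2.1 = 0 ∨ R.2.1 < P.info₁ W f₁ f₂) (h₂ : R.2.2 = 0 ∨ R.2.2 < P.info₂ W f₁ f₂) :
    IsAchievable W R := by
  have hl := Real.log_pos one_lt_two
  have key : ∀ {x I : ℝ} (C : ℝ), x < I → ∀ᶠ ε in 𝓝[>] (0 : ℝ),
      0 + x * Real.log 2 < I * Real.log 2 - ε * C := fun C hx => by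
    rw [zero_add]
    exact eventually_lt_sub_mul (mul_lt_mul_of_pos_right hx hl)
  have ev : ∀ {p : Prop} {q : ℝ → Prop}, (p ∨ ∀ᶠ ε in 𝓝[>] (0 : ℝ), q ε) →
      ∀ᶠ ε in 𝓝[>] (0 : ℝ), p ∨ q ε := fun hpq =>
    hpq.elim (fun h => Eventually.of_forall fun _ => Or.inl h) fun h => h.mono fun _ => Or.inr
  obtain ⟨ε, ⟨hε, hε1⟩, i₁, i₂, i₃, i₄⟩ := (eventually_small.and
    ((ev (hall.imp_right (key (relEntAbs (P.lawWithOutput W f₁ f₂) (P.testAll P W f₁ f₂))))).and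
    ((ev (hboth.imp_right fun h => ev (h.imp_right
      (key (relEntAbs (P.lawWithOutput W f₁ f₂) (P.testBoth P W f₁ f₂)))))).and
    ((ev (h₁.imp_right (key (relEntAbs (P.lawWithOutput W f₁ f₂) (P.test₁ P W f₁ f₂))))).and
    (ev (h₂.imp_right (key (relEntAbs (P.lawWithOutput W f₁ f₂) (P.test₂ P W f₁ f₂))))))))).exists
  obtain ⟨c, hc, hatyp⟩ := exists_expBound_atypical hε hε1 (P.lawWithOutput W f₁ f₂)
  have t := tendsto_mul_errorBound (B := (0, 0)) W f₁ f₂ rfl P.satelliteAC_self hR₀ hR₁ hR₂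
    le_rfl le_rfl ExpBound.one hatyp hc
    (by simpa only [SuperpositionLaw.natDiv₁_self, SuperpositionLaw.natDiv₂_self, add_zero]
      using i₁)
    (by simpa only [SuperpositionLaw.natDiv₁_self, SuperpositionLaw.natDiv₂_self, add_zero,
      and_true] using i₂)
    (by simpa only [SuperpositionLaw.natDiv₁_self, add_zero, and_true] using i₃)
    (by simpa only [SuperpositionLaw.natDiv₂_self, add_zero, and_true] using i₄)
  simp only [one_mul] at t
  choose C hC using fun n => exists_code_errorProb_le P P W f₁ f₂ R ε 0 n
  exact ⟨hR₀, hR₁, hR₂, C, tendsto_of_tendsto_of_tendsto_of_le_of_le tendsto_const_nhds t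
    (fun _ => zero_le) fun n => (hC n).trans (schemeErrorProb_direct_le W f₁ f₂ ε 0 n)⟩

/-- Shrinking a rate triple makes every inequality strict that concerns a message of positive
rate. -/
theorem slepianWolfRegion_subset_capacityRegion :
    P.slepianWolfRegion W f₁ f₂ ⊆ capacityRegion W := by
  rintro R ⟨R₀, R₁, R₂, rfl, h0, h1, h2, i₁, i₂, i₃, i₄⟩
  have hlim : Tendsto (fun θ : ℝ => ((θ * R₀, θ * R₁, θ * R₂) : Rates)) (𝓝[<] 1)
      (𝓝 (R₀, R₁, R₂)) := by
    have : Tendsto (fun θ : ℝ => ((θ * R₀, θ * R₁, θ * R₂) : Rates)) (𝓝[<] 1)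
        (𝓝 (1 * R₀, 1 * R₁, 1 * R₂)) :=
      (Continuous.tendsto (by fun_prop) _).mono_left nhdsWithin_le_nhds
    simpa using this
  refine mem_closure_of_tendsto hlim ?_
  filter_upwards [Ioo_mem_nhdsLT one_pos] with θ ⟨hθ0, hθ1⟩
  have shrink : ∀ {x I : ℝ}, 0 < x → x ≤ I → θ * x < I := fun {x I} hx hI => by nlinarith
  refine isAchievable_of_lt W f₁ f₂ (P := P) (by positivity) (by positivity) (by positivity)
    ?_ ?_ ?_ ?_
  · rcases h0.eq_or_lt with h | h
    · exact Or.inl (by simp [← h])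
    · have := shrink (x := R₀ + R₁ + R₂) (by linarith) i₁
      exact Or.inr (by simp only; linarith)
  · rcases h1.eq_or_lt with h | h
    · exact Or.inl (by simp [← h])
    · have := shrink (x := R₁ + R₂) (by linarith) i₂
      exact Or.inr (Or.inr (by simp only; linarith))
  · rcases h1.eq_or_lt with h | h
    · exact Or.inl (by simp [← h])
    · exact Or.inr (shrink h i₃)
  · rcases h2.eq_or_lt with h | h
    · exact Or.inl (by simp [← h])
    · exact Or.inr (shrink h i₄)

end Direct

/-! ### A converse for memoryless transmission of one message -/

section Converse

variable {M Y : Type*} [Fintype M] [Nonempty M] [Fintype Y] {n : ℕ}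

lemma map_eval_indepLaw {ι α : Type*} [Fintype ι] [Fintype α] (p : ι → PMF α) (i : ι) :
    (indepLaw p).map (fun x => x i) = p i :=
  pmf_ext_expect fun f => by rw [expect_map, expect_indepLaw_eval]

lemma sum_indepLaw_eval {ι α : Type*} [Fintype ι] [DecidableEq ι] [Fintype α] (p : ι → PMF α)
    (i : ι) (φ : α → ℝ) :
    ∑ x, (indepLaw p x).toReal * φ (x i) = ∑ a, (p i a).toReal * φ a := by
  rw [← map_eval_indepLaw p i, sum_map_toReal (indepLaw p) (fun x => x i) φ]

lemma bind_toReal {α β : Type*} [Fintype α] (r : PMF α) (V : α → PMF β) (y : β) :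
    (r.bind V y).toReal = ∑ a, (r a).toReal * (V a y).toReal := by
  rw [PMF.bind_apply, tsum_fintype, ENNReal.toReal_sum fun a _ =>
    ENNReal.mul_ne_top (r.apply_ne_top a) ((V a).apply_ne_top y)]
  simp only [ENNReal.toReal_mul]

lemma uniform_toReal (m : M) :
    (PMF.uniformOfFintype M m).toReal = (Fintype.card M : ℝ)⁻¹ := by simp

/-- The probability of decoding a uniformly distributed message correctly, when the letters of the
output are independent with laws `V m i`. -/
def successProb [DecidableEq M] (V : M → Fin n → PMF Y) (g : (Fin n → Y) → M) : ℝ :=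
  (Fintype.card M : ℝ)⁻¹ * ∑ m, ∑ y, (indepLaw (V m) y).toReal * (if g y = m then 1 else 0)

/-- The converse for one message: the information about the message in the `n` output letters is at
most the sum of the single-letter informations, and by the data processing inequality for the
event of correct decoding it is at least the left-hand side, up to `log 2`. Both are obtained at
once by Gibbs' inequality, comparing the joint law of the message and the output with the product
of the uniform law and the output marginals, tilted by the event of correct decoding. -/
theorem successProb_mul_log_card_le [DecidableEq M] (V : M → Fin n → PMF Y)
    (g : (Fin n → Y) → M) :
    successProb V g * Real.log (Fintype.card M) ≤
      ∑ i, (natEnt ((PMF.uniformOfFintype M).bind fun m => V m i) -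
        (Fintype.card M : ℝ)⁻¹ * ∑ m, natEnt (V m i)) + Real.log 2 := by
  classical
  set c : ℝ := (Fintype.card M : ℝ) with hc
  have hc0 : 0 < c := by rw [hc]; exact_mod_cast Fintype.card_pos
  set q : Fin n → PMF Y := fun i => (PMF.uniformOfFintype M).bind fun m => V m i with hq
  set v : M → (Fin n → Y) → ℝ := fun m y => (indepLaw (V m) y).toReal with hv
  set ν : (Fin n → Y) → ℝ := fun y => (indepLaw q y).toReal with hν
  -- the tilt; its mass under the product law is at most `2 c`, hence the division by `2` below
  set t : M → (Fin n → Y) → ℝ := fun m y => if g y = m then c else 1 with ht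
  have hqpos : ∀ m i b, V m i b ≠ 0 → q i b ≠ 0 := by
    intro m i b hb
    exact (PMF.mem_support_bind_iff _ _ _).2 ⟨m, PMF.mem_support_uniformOfFintype m, hb⟩
  have htpos : ∀ m y, 0 < t m y := by
    intro m y
    simp only [ht]
    split_ifs
    · exact hc0
    · exact one_pos
  have hpt : ∀ m y, v m y * (∑ i, (Real.log (q i (y i)).toReal - Real.log (V m i (y i)).toReal) +
      Real.log (t m y) - Real.log 2) ≤ ν y * t m y / 2 - v m y := by
    intro m y
    by_cases h0 : indepLaw (V m) y = 0
    · have hv0 : v m y = 0 := by simp [hv, h0]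
      rw [hv0, zero_mul, sub_zero]
      have := htpos m y
      have : 0 ≤ ν y := ENNReal.toReal_nonneg
      positivity
    · have h1 : ∀ i, V m i (y i) ≠ 0 := fun i => by
        rw [indepLaw_apply] at h0
        exact Finset.prod_ne_zero_iff.1 h0 i (Finset.mem_univ i)
      have h2 : ∀ i, q i (y i) ≠ 0 := fun i => hqpos m i _ (h1 i)
      have hvp : 0 < v m y := toReal_pos_of_ne h0
      have hνp : 0 < ν y := by
        refine toReal_pos_of_ne ?_
        rw [indepLaw_apply]
        exact Finset.prod_ne_zero_iff.2 fun i _ => h2 i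
      have hlv : Real.log (v m y) = ∑ i, Real.log (V m i (y i)).toReal := by
        simp only [hv, indepLaw_apply, ENNReal.toReal_prod]
        exact Real.log_prod fun i _ => (toReal_pos_of_ne (h1 i)).ne'
      have hlν : Real.log (ν y) = ∑ i, Real.log (q i (y i)).toReal := by
        simp only [hν, indepLaw_apply, ENNReal.toReal_prod]
        exact Real.log_prod fun i _ => (toReal_pos_of_ne (h2 i)).ne'
      have htp := htpos m y
      rw [Finset.sum_sub_distrib, ← hlv, ← hlν]
      have h3 : Real.log (ν y) - Real.log (v m y) + Real.log (t m y) - Real.log 2 =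
          Real.log (ν y * t m y / 2 / v m y) := by
        rw [Real.log_div (by positivity) hvp.ne', Real.log_div (by positivity) two_ne_zero,
          Real.log_mul hνp.ne' htp.ne']
        ring
      rw [h3]
      have h4 := Real.log_le_sub_one_of_pos (show 0 < ν y * t m y / 2 / v m y by positivity)
      calc _ ≤ v m y * (ν y * t m y / 2 / v m y - 1) := by gcongr
        _ = _ := by field_simp
  have hsum := Finset.sum_le_sum fun m (_ : m ∈ Finset.univ) =>
    Finset.sum_le_sum fun y (_ : y ∈ Finset.univ) => hpt m y
  have hR : ∑ m, ∑ y, (ν y * t m y / 2 - v m y) ≤ 0 := by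
    have h1 : ∀ m, ∑ y, v m y = 1 := fun m => sum_toReal_eq_one _
    have h2 : ∑ y, ν y = 1 := sum_toReal_eq_one _
    have h3 : ∀ y, ∑ m, t m y ≤ 2 * c := by
      intro y
      have : ∀ m, t m y ≤ (if g y = m then c else 0) + 1 := by
        intro m
        simp only [ht]
        split_ifs <;> linarith
      refine (Finset.sum_le_sum fun m _ => this m).trans (le_of_eq ?_)
      rw [Finset.sum_add_distrib]
      simp [hc]
      ring
    simp only [Finset.sum_sub_distrib, h1]
    rw [Finset.sum_comm]
    have h4 : ∑ y, ∑ m, ν y * t m y / 2 ≤ ∑ y, ν y * c := by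
      refine Finset.sum_le_sum fun y _ => ?_
      have hνy : 0 ≤ ν y := ENNReal.toReal_nonneg
      rw [← Finset.sum_div, ← Finset.mul_sum]
      have := mul_le_mul_of_nonneg_left (h3 y) hνy
      linarith
    rw [← Finset.sum_mul, h2] at h4
    have h5 : ∑ _m : M, (1 : ℝ) = c := by simp [hc]
    rw [h5]
    linarith
  have hL : ∑ m, ∑ y, v m y * (∑ i, (Real.log (q i (y i)).toReal -
      Real.log (V m i (y i)).toReal) + Real.log (t m y) - Real.log 2) =
      c * (successProb V g * Real.log c - ∑ i, (natEnt (q i) - c⁻¹ * ∑ m, natEnt (V m i)) -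
        Real.log 2) := by
    have e1 : ∀ m, ∑ y, v m y * Real.log 2 = Real.log 2 := fun m => by
      rw [← Finset.sum_mul, sum_toReal_eq_one, one_mul]
    have e2 : ∑ m, ∑ y, v m y * Real.log (t m y) = c * (successProb V g * Real.log c) := by
      rw [successProb, ← hc, ← mul_assoc, mul_inv_cancel_left₀ hc0.ne', Finset.sum_mul]
      refine Finset.sum_congr rfl fun m _ => ?_
      rw [Finset.sum_mul]
      refine Finset.sum_congr rfl fun y _ => ?_
      simp only [ht]
      split_ifs <;> simp [hv]
    have e3 : ∀ m i, ∑ y, v m y * Real.log (V m i (y i)).toReal = -natEnt (V m i) := by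
      intro m i
      rw [hv]
      simp only
      rw [sum_indepLaw_eval (V m) i fun b => Real.log (V m i b).toReal]
      simp [natEnt, Real.negMulLog]
    have e4 : ∀ i, ∑ m, ∑ y, v m y * Real.log (q i (y i)).toReal = -(c * natEnt (q i)) := by
      intro i
      have : ∀ m, ∑ y, v m y * Real.log (q i (y i)).toReal =
          ∑ b, (V m i b).toReal * Real.log (q i b).toReal := fun m =>
        sum_indepLaw_eval (V m) i fun b => Real.log (q i b).toReal
      rw [Finset.sum_congr rfl fun m _ => this m, Finset.sum_comm, natEnt, Finset.mul_sum,
        ← Finset.sum_neg_distrib]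
      refine Finset.sum_congr rfl fun b _ => ?_
      have hb : (q i b).toReal = c⁻¹ * ∑ m, (V m i b).toReal := by
        rw [hq, bind_toReal, Finset.mul_sum]
        exact Finset.sum_congr rfl fun m _ => by rw [uniform_toReal]
      rw [← Finset.sum_mul, Real.negMulLog]
      have : ∑ m, (V m i b).toReal = c * (q i b).toReal := by
        rw [hb, mul_inv_cancel_left₀ hc0.ne']
      rw [this]
      ring
    have e5 : ∑ m, ∑ y, v m y * ∑ i, (Real.log (q i (y i)).toReal -
        Real.log (V m i (y i)).toReal) = ∑ i, (-(c * natEnt (q i)) + ∑ m, natEnt (V m i)) := by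
      have h1 : ∀ m, ∑ y, v m y * ∑ i, (Real.log (q i (y i)).toReal -
          Real.log (V m i (y i)).toReal) =
          ∑ i, (∑ y, v m y * Real.log (q i (y i)).toReal + natEnt (V m i)) := by
        intro m
        simp only [Finset.mul_sum, mul_sub]
        rw [Finset.sum_comm]
        refine Finset.sum_congr rfl fun i _ => ?_
        rw [Finset.sum_sub_distrib, e3, sub_neg_eq_add]
      rw [Finset.sum_congr rfl fun m _ => h1 m, Finset.sum_comm]
      refine Finset.sum_congr rfl fun i _ => ?_
      rw [Finset.sum_add_distrib, e4]
    simp only [mul_sub, mul_add, Finset.sum_sub_distrib, Finset.sum_add_distrib] at e5 e2 ⊢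
    simp only [e1, e2, e5]
    simp only [← Finset.mul_sum, Finset.sum_neg_distrib]
    rw [Finset.sum_const, Finset.card_univ, nsmul_eq_mul, ← hc, mul_inv_cancel_left₀ hc0.ne']
    ring
  rw [hL] at hsum
  have h6 := hsum.trans hR
  have h7 : successProb V g * Real.log c - ∑ i, (natEnt (q i) - c⁻¹ * ∑ m, natEnt (V m i)) -
      Real.log 2 ≤ 0 := by
    by_contra! hpos
    exact absurd h6 (not_le.2 (mul_pos hc0 hpos))
  linarith

end Converse

/-! ### Convex hulls of compact sets -/

/-- In finite dimension the convex hull of a compact set is compact, by Carathéodory's theorem. -/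
theorem isCompact_convexHull_of_finiteDimensional {E : Type*} [NormedAddCommGroup E]
    [NormedSpace ℝ E] [FiniteDimensional ℝ E] {s : Set E} (hs : IsCompact s) :
    IsCompact (convexHull ℝ s) := by
  classical
  rcases s.eq_empty_or_nonempty with rfl | ⟨z₀, hz₀⟩
  · simp
  set d := Module.finrank ℝ E + 1 with hd
  -- points are padded with zero weights so that all combinations have the same number of terms
  have himage : convexHull ℝ s = (fun a : (Fin d → ℝ) × (Fin d → E) => ∑ j, a.1 j • a.2 j) ''
      (stdSimplex ℝ (Fin d) ×ˢ Set.univ.pi fun _ => s) := by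
    apply Set.Subset.antisymm
    · intro x hx
      obtain ⟨ι, _, z, w, hz, hind, hw, hw1, rfl⟩ := eq_pos_convex_span_of_mem_convexHull hx
      have hcard : Fintype.card ι ≤ Fintype.card (Fin d) := by
        rw [Fintype.card_fin, hd]
        exact hind.card_le_finrank_succ.trans
          (Nat.add_le_add_right (Submodule.finrank_le _) 1)
      obtain ⟨e⟩ := Function.Embedding.nonempty_of_card_le hcard
      refine ⟨(Function.extend e w 0, Function.extend e z fun _ => z₀),
        ⟨⟨fun j => ?_, ?_⟩, fun j _ => ?_⟩, ?_⟩
      · by_cases hj : ∃ i, e i = j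
        · obtain ⟨i, rfl⟩ := hj
          simpa [e.injective.extend_apply] using (hw i).le
        · simp [Function.extend_apply' _ _ _ hj]
      · rw [← hw1]
        refine (Fintype.sum_of_injective e e.injective _ _ (fun j hj => ?_) fun i => ?_).symm
        · exact Function.extend_apply' _ _ _ hj
        · exact (e.injective.extend_apply _ _ _).symm
      · by_cases hj : ∃ i, e i = j
        · obtain ⟨i, rfl⟩ := hj
          simpa [e.injective.extend_apply] using hz ⟨i, rfl⟩
        · simpa [Function.extend_apply' _ _ _ hj] using hz₀
      · refine (Fintype.sum_of_injective e e.injective _ _ (fun j hj => ?_) fun i => ?_).symm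
        · simp [Function.extend_apply' _ _ _ hj]
        · simp [e.injective.extend_apply]
    · rintro _ ⟨⟨w, z⟩, ⟨hw, hz⟩, rfl⟩
      exact mem_convexHull_of_exists_fintype w z hw.1 hw.2 (fun j => hz j (Set.mem_univ j)) rfl
  rw [himage]
  exact ((isCompact_stdSimplex ℝ (Fin d)).prod (isCompact_univ_pi fun _ => hs)).image (by fun_prop)

/-! ### Mutual information as a function of the input distribution -/

/-- A probability mass function as a real vector. -/
def massFun {α : Type*} (p : PMF α) : α → ℝ := fun a => (p a).toReal

/-- The mutual information (in nats) of the input and the output of the channel `V` whose input has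
the mass function `π`. It is defined for every real vector `π`. -/
def chanInfo {X Y : Type*} [Fintype X] [Fintype Y] (V : X → PMF Y) (π : X → ℝ) : ℝ :=
  ∑ y, Real.negMulLog (∑ x, π x * (V x y).toReal) - ∑ x, π x * natEnt (V x)

/-- The mass function of two independent letters. -/
def prodVec {X₁ X₂ : Type*} (p : X₁ → ℝ) (q : X₂ → ℝ) : X₁ × X₂ → ℝ := fun x => p x.1 * q x.2

section ChanInfo

variable {M X Y : Type*} [Fintype M] [Fintype X] [Fintype Y]

lemma massFun_mem_stdSimplex (p : PMF X) : massFun p ∈ stdSimplex ℝ X :=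
  ⟨fun _ => ENNReal.toReal_nonneg, sum_toReal_eq_one p⟩

lemma exists_massFun_eq {p : X → ℝ} (hp : p ∈ stdSimplex ℝ X) : ∃ P : PMF X, massFun P = p := by
  refine ⟨PMF.ofFintype (fun x => ENNReal.ofReal (p x)) ?_, funext fun x => ?_⟩
  · rw [← ENNReal.ofReal_sum_of_nonneg fun x _ => hp.1 x, hp.2, ENNReal.ofReal_one]
  · exact ENNReal.toReal_ofReal (hp.1 x)

lemma chanInfo_massFun_map (V : X → PMF Y) (r : PMF M) (x : M → X) :
    chanInfo V (massFun (r.map x)) =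
      natEnt (r.bind fun m => V (x m)) - ∑ m, (r m).toReal * natEnt (V (x m)) := by
  simp only [chanInfo, massFun, natEnt, bind_toReal, sum_map_toReal]

lemma prodVec_massFun {M₁ M₂ Z₁ Z₂ : Type*} (a : PMF M₁) (b : PMF M₂) (f : M₁ → Z₁)
    (g : M₂ → Z₂) :
    prodVec (massFun (a.map f)) (massFun (b.map g)) =
      massFun ((joint a fun _ => b).map fun z => (f z.1, g z.2)) := by
  have h : (joint a fun _ => b).map (fun z => (f z.1, g z.2)) =
      joint (a.map f) fun _ => b.map g :=
    pmf_ext_expect fun φ => by simp [expect_map, expect_joint]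
  funext x
  rw [h, massFun, joint_apply, ENNReal.toReal_mul]
  rfl

lemma continuous_chanInfo (V : X → PMF Y) : Continuous (chanInfo V) := by
  unfold chanInfo
  refine (continuous_finsetSum _ fun y _ => Real.continuous_negMulLog.comp ?_).sub ?_ <;> fun_prop

lemma concaveOn_chanInfo (V : X → PMF Y) : ConcaveOn ℝ (Set.Ici 0) (chanInfo V) := by
  refine ⟨convex_Ici 0, fun π hπ ρ hρ a b ha hb hab => ?_⟩
  have h0 : ∀ σ : X → ℝ, σ ∈ Set.Ici (0 : X → ℝ) → ∀ y, 0 ≤ ∑ x, σ x * (V x y).toReal :=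
    fun σ hσ y => Finset.sum_nonneg fun x _ => mul_nonneg (hσ x) ENNReal.toReal_nonneg
  have hlin : ∀ φ : X → ℝ, ∑ x, (a • π + b • ρ) x * φ x =
      a * ∑ x, π x * φ x + b * ∑ x, ρ x * φ x := by
    intro φ
    simp only [Pi.add_apply, Pi.smul_apply, smul_eq_mul, add_mul, Finset.sum_add_distrib,
      Finset.mul_sum, mul_assoc]
  have h1 := Finset.sum_le_sum fun y (_ : y ∈ Finset.univ) =>
    Real.concaveOn_negMulLog.2 (Set.mem_Ici.2 (h0 π hπ y)) (Set.mem_Ici.2 (h0 ρ hρ y)) ha hb hab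
  simp only [smul_eq_mul, Finset.sum_add_distrib, ← Finset.mul_sum] at h1
  simp only [chanInfo, hlin, smul_eq_mul]
  linarith

end ChanInfo

/-! ### The region of the hull of single-letter rate points -/

section Hull

variable {X₁ X₂ Y : Type*} [Fintype X₁] [Fintype X₂] [Fintype Y] (W : X₁ → X₂ → PMF Y)

/-- The data of independent inputs with mass functions `p` and `q` that enter the outer bound: their
joint mass function and the informations `I(X₁, X₂; Y)`, `I(X₁; Y | X₂)`, `I(X₂; Y | X₁)`. -/
def ratePoint (a : (X₁ → ℝ) × (X₂ → ℝ)) : (X₁ × X₂ → ℝ) × ℝ × ℝ × ℝ :=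
  (prodVec a.1 a.2, chanInfo (fun x : X₁ × X₂ => W x.1 x.2) (prodVec a.1 a.2),
    ∑ x₂, a.2 x₂ * chanInfo (fun x₁ => W x₁ x₂) a.1,
    ∑ x₁, a.1 x₁ * chanInfo (W x₁) a.2)

/-- The convex hull of the rate points; convex combination is time sharing, with `U₀` as the
time-sharing variable. -/
def rateHull : Set ((X₁ × X₂ → ℝ) × ℝ × ℝ × ℝ) :=
  convexHull ℝ (ratePoint W '' (stdSimplex ℝ X₁ ×ˢ stdSimplex ℝ X₂))

/-- The rates `R` satisfy, up to `δ`, the inequalities given by the point `k`. The bound for the sum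
of all rates is computed from the averaged input mass function `k.1`, since the receiver learns
`U₀` too and `I(Y; U₀, X₁, X₂) = I(Y; X₁, X₂)`. -/
def Supports (R : Rates) (δ : ℝ) (k : (X₁ × X₂ → ℝ) × ℝ × ℝ × ℝ) : Prop :=
  0 ≤ R.1 ∧ 0 ≤ R.2.1 ∧ 0 ≤ R.2.2 ∧
    (R.1 + R.2.1 + R.2.2) * Real.log 2 ≤ chanInfo (fun x : X₁ × X₂ => W x.1 x.2) k.1 + δ ∧
    (R.2.1 + R.2.2) * Real.log 2 ≤ k.2.1 + δ ∧
    R.2.1 * Real.log 2 ≤ k.2.2.1 + δ ∧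
    R.2.2 * Real.log 2 ≤ k.2.2.2 + δ

lemma isCompact_rateHull : IsCompact (rateHull W) := by
  refine isCompact_convexHull_of_finiteDimensional
    (((isCompact_stdSimplex ℝ X₁).prod (isCompact_stdSimplex ℝ X₂)).image ?_)
  have h1 : Continuous fun a : (X₁ → ℝ) × (X₂ → ℝ) => prodVec a.1 a.2 := by
    unfold prodVec; fun_prop
  have h2 := (continuous_chanInfo fun x : X₁ × X₂ => W x.1 x.2).comp h1
  have h3 : ∀ x₂, Continuous fun a : (X₁ → ℝ) × (X₂ → ℝ) => chanInfo (fun x₁ => W x₁ x₂) a.1 :=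
    fun x₂ => (continuous_chanInfo _).comp continuous_fst
  have h4 : ∀ x₁, Continuous fun a : (X₁ → ℝ) × (X₂ → ℝ) => chanInfo (W x₁) a.2 :=
    fun x₁ => (continuous_chanInfo _).comp continuous_snd
  exact h1.prodMk (h2.prodMk ((by fun_prop : Continuous fun a : (X₁ → ℝ) × (X₂ → ℝ) =>
    ∑ x₂, a.2 x₂ * chanInfo (fun x₁ => W x₁ x₂) a.1).prodMk (by fun_prop)))

/-- By compactness, limits of rates supported up to vanishing slack are supported. -/
lemma exists_supports_of_tendsto {R : ℕ → Rates} {R' : Rates} {δ : ℕ → ℝ}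
    (hR : Tendsto R atTop (𝓝 R')) (hδ : Tendsto δ atTop (𝓝 0))
    (h : ∀ n, ∃ k ∈ rateHull W, Supports W (R n) (δ n) k) :
    ∃ k ∈ rateHull W, Supports W R' 0 k := by
  choose k hk hs using h
  obtain ⟨k', hk', φ, hφ, hlim⟩ := (isCompact_rateHull W).tendsto_subseq hk
  have hR := hR.comp hφ.tendsto_atTop
  have hδ := hδ.comp hφ.tendsto_atTop
  have r0 := hR.fst_nhds
  have r1 := hR.snd_nhds.fst_nhds
  have r2 := hR.snd_nhds.snd_nhds
  have k1 := ((continuous_chanInfo fun x : X₁ × X₂ => W x.1 x.2).tendsto k'.1).comp hlim.fst_nhds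
  have k2 := hlim.snd_nhds.fst_nhds
  have k3 := hlim.snd_nhds.snd_nhds.fst_nhds
  have k4 := hlim.snd_nhds.snd_nhds.snd_nhds
  have hs' := fun n => hs (φ n)
  exact ⟨k', hk', ge_of_tendsto' r0 fun n => (hs' n).1, ge_of_tendsto' r1 fun n => (hs' n).2.1,
    ge_of_tendsto' r2 fun n => (hs' n).2.2.1,
    le_of_tendsto_of_tendsto' (((r0.add r1).add r2).mul_const _) (k1.add hδ)
      fun n => (hs' n).2.2.2.1,
    le_of_tendsto_of_tendsto' ((r1.add r2).mul_const _) (k2.add hδ)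
      fun n => (hs' n).2.2.2.2.1,
    le_of_tendsto_of_tendsto' (r1.mul_const _) (k3.add hδ) fun n => (hs' n).2.2.2.2.2.1,
    le_of_tendsto_of_tendsto' (r2.mul_const _) (k4.add hδ) fun n => (hs' n).2.2.2.2.2.2⟩

namespace SuperpositionLaw

variable {U₀ U₁ U₂ : Type*} [Fintype U₀] [Fintype U₁] [Fintype U₂]
  (P : SuperpositionLaw U₀ U₁ U₂) (f₁ : U₀ → U₁ → X₁) (f₂ : U₀ → U₂ → X₂)

/-- The mass functions of the two inputs, given `U₀ = u₀`. -/
def inputs (u₀ : U₀) : (X₁ → ℝ) × (X₂ → ℝ) :=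
  (massFun ((P.top₁ u₀).map (f₁ u₀)), massFun ((P.top₂ u₀).map (f₂ u₀)))

/-- The point of the hull that belongs to a superposition law. -/
def hullPoint : (X₁ × X₂ → ℝ) × ℝ × ℝ × ℝ :=
  ∑ u₀, (P.base u₀).toReal • ratePoint W (P.inputs f₁ f₂ u₀)

lemma infoAll_eq_hullPoint : P.infoAll W f₁ f₂ * Real.log 2 =
    chanInfo (fun x : X₁ × X₂ => W x.1 x.2) (P.hullPoint W f₁ f₂).1 := by
  have h : (P.hullPoint W f₁ f₂).1 =
      massFun (P.law.map fun u => (f₁ u.1 u.2.1, f₂ u.1 u.2.2)) := by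
    have h1 : P.law.map (fun u => (f₁ u.1 u.2.1, f₂ u.1 u.2.2)) =
        P.base.bind fun u₀ => (joint (P.top₁ u₀) fun _ => P.top₂ u₀).map
          fun z => (f₁ u₀ z.1, f₂ u₀ z.2) :=
      pmf_ext_expect fun φ => by simp [expect_map, expect_law, expect_joint, expect_bind]
    funext x
    rw [h1, massFun, bind_toReal, hullPoint, Prod.fst_sum, Finset.sum_apply]
    refine Finset.sum_congr rfl fun u₀ _ => ?_
    rw [Prod.smul_fst, Pi.smul_apply, smul_eq_mul, ratePoint, inputs]
    simp only [prodVec_massFun]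
    rfl
  rw [h, chanInfo_massFun_map, infoAll_mul_log_two, ← bind_channel_eq_outAll]
  rfl

lemma infoBoth_eq_hullPoint : P.infoBoth W f₁ f₂ * Real.log 2 = (P.hullPoint W f₁ f₂).2.1 := by
  rw [infoBoth_mul_log_two, noiseEnt, law_eq_joint, sum_joint_toReal, sum_joint_toReal, hullPoint,
    Prod.snd_sum, Prod.fst_sum, ← Finset.sum_sub_distrib]
  refine Finset.sum_congr rfl fun u₀ _ => ?_
  simp only [ratePoint, inputs, prodVec_massFun, Prod.smul_snd, Prod.smul_fst, smul_eq_mul]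
  have h1 : ((joint (P.top₁ u₀) fun _ => P.top₂ u₀).bind fun z => W (f₁ u₀ z.1) (f₂ u₀ z.2)) =
      P.outBoth W f₁ f₂ u₀ :=
    pmf_ext_expect fun φ => by simp [outBoth, expect_joint, expect_bind]
  rw [chanInfo_massFun_map, h1, ← Finset.sum_mul, sum_toReal_eq_one, one_mul, mul_sub]

lemma info₁_eq_hullPoint : P.info₁ W f₁ f₂ * Real.log 2 = (P.hullPoint W f₁ f₂).2.2.1 := by
  rw [info₁_mul_log_two, noiseEnt, law_eq_joint, sum_joint_toReal, sum_joint_toReal, hullPoint,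
    Prod.snd_sum, Prod.snd_sum, Prod.fst_sum, ← Finset.sum_sub_distrib]
  refine Finset.sum_congr rfl fun u₀ _ => ?_
  rw [sum_joint_toReal, sum_joint_toReal, ← mul_sub]
  simp only [ratePoint, inputs, Prod.smul_snd, Prod.smul_fst, smul_eq_mul]
  congr 1
  rw [← Finset.sum_mul, sum_toReal_eq_one, one_mul]
  simp only [massFun]
  rw [sum_map_toReal]
  simp only [Finset.mul_sum, mul_left_comm ((P.top₁ u₀ _).toReal)]
  rw [Finset.sum_comm (s := Finset.univ (α := U₁)), ← Finset.sum_sub_distrib]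
  refine Finset.sum_congr rfl fun u₂ _ => ?_
  rw [← Finset.mul_sum, ← mul_sub]
  congr 1
  exact (chanInfo_massFun_map (fun x₁ => W x₁ (f₂ u₀ u₂)) (P.top₁ u₀) (f₁ u₀)).symm

lemma info₂_eq_hullPoint : P.info₂ W f₁ f₂ * Real.log 2 = (P.hullPoint W f₁ f₂).2.2.2 := by
  rw [info₂_mul_log_two, noiseEnt, law_eq_joint, sum_joint_toReal, sum_joint_toReal, hullPoint,
    Prod.snd_sum, Prod.snd_sum, Prod.snd_sum, ← Finset.sum_sub_distrib]
  refine Finset.sum_congr rfl fun u₀ _ => ?_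
  rw [sum_joint_toReal, sum_joint_toReal, ← mul_sub]
  simp only [ratePoint, inputs, Prod.smul_snd, smul_eq_mul]
  congr 1
  simp only [massFun]
  rw [sum_map_toReal, ← Finset.sum_sub_distrib]
  refine Finset.sum_congr rfl fun u₁ _ => ?_
  rw [← mul_sub, ← Finset.sum_mul, sum_toReal_eq_one, one_mul]
  congr 1
  exact (chanInfo_massFun_map (W (f₁ u₀ u₁)) (P.top₂ u₀) (f₂ u₀)).symm

lemma mem_slepianWolfRegion_of_supports {R : Rates} (h : Supports W R 0 (P.hullPoint W f₁ f₂)) :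
    R ∈ P.slepianWolfRegion W f₁ f₂ := by
  have hlog : 0 < Real.log 2 := Real.log_pos one_lt_two
  obtain ⟨h0, h1, h2, hA, hB, hC, hD⟩ := h
  rw [← infoAll_eq_hullPoint, add_zero] at hA
  rw [← infoBoth_eq_hullPoint, add_zero] at hB
  rw [← info₁_eq_hullPoint, add_zero] at hC
  rw [← info₂_eq_hullPoint, add_zero] at hD
  exact ⟨R.1, R.2.1, R.2.2, rfl, h0, h1, h2, le_of_mul_le_mul_right hA hlog,
    le_of_mul_le_mul_right hB hlog, le_of_mul_le_mul_right hC hlog, le_of_mul_le_mul_right hD hlog⟩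

end SuperpositionLaw

/-- Every point of the hull comes from a superposition law, with `U₁ = X₁` and `U₂ = X₂`. -/
lemma exists_hullPoint_eq {k : (X₁ × X₂ → ℝ) × ℝ × ℝ × ℝ} (hk : k ∈ rateHull W) :
    ∃ (k₀ k₁ k₂ : ℕ) (P : SuperpositionLaw (Fin k₀) (Fin k₁) (Fin k₂))
      (f₁ : Fin k₀ → Fin k₁ → X₁) (f₂ : Fin k₀ → Fin k₂ → X₂), P.hullPoint W f₁ f₂ = k := by
  obtain ⟨ι, _, w, z, hw0, hw1, hz, rfl⟩ := mem_convexHull_iff_exists_fintype.1 hk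
  choose a ha haz using hz
  choose p hp using fun i => exists_massFun_eq (ha i).1
  choose q hq using fun i => exists_massFun_eq (ha i).2
  obtain ⟨r, hr⟩ := exists_massFun_eq (p := w) ⟨hw0, hw1⟩
  let e := Fintype.equivFin ι
  let e₁ := Fintype.equivFin X₁
  let e₂ := Fintype.equivFin X₂
  refine ⟨_, _, _, ⟨r.map e, fun u => (p (e.symm u)).map e₁, fun u => (q (e.symm u)).map e₂⟩,
    fun _ => e₁.symm, fun _ => e₂.symm, ?_⟩
  rw [SuperpositionLaw.hullPoint, ← e.sum_comp]
  refine Finset.sum_congr rfl fun i _ => ?_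
  have h1 : ((p i).map e₁).map e₁.symm = p i := by simp [PMF.map_comp, PMF.map_id]
  have h2 : ((q i).map e₂).map e₂.symm = q i := by simp [PMF.map_comp, PMF.map_id]
  have h3 : (r.map e (e i)).toReal = w i := by
    rw [map_apply_injective e.injective, ← hr]
    rfl
  simp only [SuperpositionLaw.inputs, e.symm_apply_apply, h1, h2, h3, hp, hq]
  rw [← haz i]

theorem mem_unionSlepianWolfRegion_of_supports {R : Rates}
    (h : ∃ k ∈ rateHull W, Supports W R 0 k) : R ∈ unionSlepianWolfRegion W := by
  obtain ⟨k, hk, hs⟩ := h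
  obtain ⟨k₀, k₁, k₂, P, f₁, f₂, rfl⟩ := exists_hullPoint_eq W hk
  exact ⟨k₀, k₁, k₂, P, f₁, f₂, P.mem_slepianWolfRegion_of_supports W f₁ f₂ hs⟩

end Hull

/-! ### Single-letter bounds for codes -/

section CodeBound

/-- The converse for a part `b` of the message `(a, b)`, when the letters of the output depend on
`b` through letters `ξ a b i` sent over channels `K a i` that may depend on the other part `a`. The
receiver is only required to decode `b`, with `a` given. -/
lemma successProb_mul_log_card_le_average {A B M X Y : Type*} [Fintype A] [Nonempty A] [Fintype B]
    [Nonempty B] [Fintype M] [DecidableEq M] [Fintype X] [Fintype Y] {n : ℕ} (e : A × B ≃ M)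
    {V : M → Fin n → PMF Y} (g : (Fin n → Y) → M) {K : A → Fin n → X → PMF Y}
    {ξ : A → B → Fin n → X} (h : ∀ a b i, V (e (a, b)) i = K a i (ξ a b i)) :
    successProb V g * Real.log (Fintype.card B) ≤
      (Fintype.card A : ℝ)⁻¹ * ∑ a, ∑ i,
        chanInfo (K a i) (massFun ((PMF.uniformOfFintype B).map fun b => ξ a b i)) +
      Real.log 2 := by
  classical
  have hA : (0 : ℝ) < Fintype.card A := by exact_mod_cast Fintype.card_pos
  have hB : (1 : ℝ) ≤ Fintype.card B := by exact_mod_cast Fintype.card_pos (α := B)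
  have h1 : successProb V g ≤ (Fintype.card A : ℝ)⁻¹ *
      ∑ a, successProb (fun b => V (e (a, b))) fun y => (e.symm (g y)).2 := by
    simp only [successProb]
    rw [← Finset.mul_sum, ← mul_assoc, ← Fintype.card_congr e, Fintype.card_prod, Nat.cast_mul,
      mul_inv, ← e.sum_comp, Fintype.sum_prod_type]
    gcongr with a _ b _ y _
    by_cases hy : g y = e (a, b)
    · simp [hy]
    · rw [if_neg hy]
      split_ifs <;> norm_num
  have h2 : ∀ a, successProb (fun b => V (e (a, b))) (fun y => (e.symm (g y)).2) *
      Real.log (Fintype.card B) ≤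
      ∑ i, chanInfo (K a i) (massFun ((PMF.uniformOfFintype B).map fun b => ξ a b i)) +
        Real.log 2 := by
    intro a
    refine (successProb_mul_log_card_le _ _).trans (le_of_eq ?_)
    congr 1
    refine Finset.sum_congr rfl fun i _ => ?_
    rw [chanInfo_massFun_map]
    simp only [h, uniform_toReal, Finset.mul_sum]
  calc _ ≤ (Fintype.card A : ℝ)⁻¹ * (∑ a, successProb (fun b => V (e (a, b)))
        fun y => (e.symm (g y)).2) * Real.log (Fintype.card B) :=
        mul_le_mul_of_nonneg_right h1 (Real.log_nonneg hB)
    _ ≤ (Fintype.card A : ℝ)⁻¹ * ∑ a, (∑ i, chanInfo (K a i)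
        (massFun ((PMF.uniformOfFintype B).map fun b => ξ a b i)) + Real.log 2) := by
      rw [mul_assoc, Finset.sum_mul]
      gcongr with a
      exact h2 a
    _ = _ := by
      rw [Finset.sum_add_distrib, mul_add, Finset.sum_const, Finset.card_univ, nsmul_eq_mul,
        inv_mul_cancel_left₀ hA.ne']

lemma uniformOfFintype_prod (A B : Type*) [Fintype A] [Nonempty A] [Fintype B] [Nonempty B] :
    PMF.uniformOfFintype (A × B) =
      joint (PMF.uniformOfFintype A) fun _ => PMF.uniformOfFintype B := by
  ext z
  rw [joint_apply]
  simp [ENNReal.mul_inv]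

variable {X₁ X₂ Y : Type*} [Fintype Y] (W : X₁ → X₂ → PMF Y)
  {n : ℕ} {R : Rates} (C : Code X₁ X₂ Y n R)

namespace Code

/-- The output letter laws, given the messages. -/
def letterLaw (w : Messages n R) (i : Fin n) : PMF Y := W (C.enc₁ w.1 w.2.1 i) (C.enc₂ w.1 w.2.2 i)

lemma errorProb_toReal :
    (C.errorProb W).toReal = 1 - successProb (C.letterLaw W) C.dec := by
  classical
  have h1 : ∀ w y, (Set.indicator {z : Messages n R × Messages n R | z.2 ≠ z.1} 1 (w, C.dec y) :
      ℝ≥0∞) = ENNReal.ofReal (1 - if C.dec y = w then 1 else 0) := by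
    intro w y
    by_cases h : C.dec y = w <;> simp [h]
  have h2 : ∀ (w : Messages n R) (y : Fin n → Y),
      (0 : ℝ) ≤ 1 - if C.dec y = w then 1 else 0 := by
    intro w y
    split_ifs <;> norm_num
  have h3 : ∀ w : Messages n R, 0 ≤ ∑ y, (indepLaw (C.letterLaw W w) y).toReal *
      (1 - if C.dec y = w then 1 else 0) := fun w =>
    Finset.sum_nonneg fun y _ => mul_nonneg ENNReal.toReal_nonneg (h2 w y)
  have h4 : C.errorProb W = ENNReal.ofReal (∑ w, (PMF.uniformOfFintype (Messages n R) w).toReal *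
      ∑ y, (indepLaw (C.letterLaw W w) y).toReal * (1 - if C.dec y = w then 1 else 0)) := by
    rw [← expect_ofReal _ _ h3, errorProb, toOuterMeasure_eq_expect, expect_bind]
    congr 1
    funext w
    rw [expect_map, ← expect_ofReal _ _ (h2 w)]
    simp only [h1]
    rfl
  rw [h4, ENNReal.toReal_ofReal
    (Finset.sum_nonneg fun w _ => mul_nonneg ENNReal.toReal_nonneg (h3 w))]
  simp only [mul_sub, mul_one, Finset.sum_sub_distrib, sum_toReal_eq_one, successProb,
    uniform_toReal, ← Finset.mul_sum]
  have hN : (Fintype.card (Messages n R) : ℝ) ≠ 0 := by exact_mod_cast Fintype.card_ne_zero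
  rw [Finset.sum_const, Finset.card_univ, nsmul_eq_mul, mul_inv_cancel₀ hN]

variable [Fintype X₁] [Fintype X₂]

/-- The mass functions of the two input letters at time `i`, given the common message. -/
def inputs (i : Fin n) (w₀ : Fin (numIndices n R.1)) : (X₁ → ℝ) × (X₂ → ℝ) :=
  (massFun ((PMF.uniformOfFintype _).map fun w₁ => C.enc₁ w₀ w₁ i),
    massFun ((PMF.uniformOfFintype _).map fun w₂ => C.enc₂ w₀ w₂ i))

/-- The point of the hull that belongs to a code: the average of the rate points over the common
message and the time. -/
def hullPoint : (X₁ × X₂ → ℝ) × ℝ × ℝ × ℝ :=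
  ∑ i, (n : ℝ)⁻¹ • ∑ w₀, (numIndices n R.1 : ℝ)⁻¹ • ratePoint W (C.inputs i w₀)

lemma hullPoint_mem (hn : 0 < n) : C.hullPoint W ∈ rateHull W := by
  have hn' : (n : ℝ) ≠ 0 := by positivity
  have hN : (numIndices n R.1 : ℝ) ≠ 0 := by exact_mod_cast NeZero.ne _
  refine (convex_convexHull ℝ _).sum_mem (fun _ _ => by positivity) (by simp [hn']) fun i _ => ?_
  refine (convex_convexHull ℝ _).sum_mem (fun _ _ => by positivity) (by simp [hN]) fun w₀ _ => ?_
  exact subset_convexHull ℝ _ ⟨_, ⟨massFun_mem_stdSimplex _, massFun_mem_stdSimplex _⟩, rfl⟩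

end Code

variable [Fintype X₁] [Fintype X₂]

lemma le_log_numIndices (n : ℕ) (r : ℝ) : n * (r * Real.log 2) ≤ Real.log (numIndices n r) := by
  rw [Real.le_log_iff_exp_le (by exact_mod_cast Nat.pos_of_ne_zero (NeZero.ne _))]
  exact exp_le_numIndices n r

/-- The rates of a code, reduced by the factor of its success probability, are supported by its
point of the hull up to `log 2 / n`. -/
theorem Code.supports_hullPoint (hn : 0 < n) (h₀ : 0 ≤ R.1) (h₁ : 0 ≤ R.2.1) (h₂ : 0 ≤ R.2.2) :
    Supports W (successProb (C.letterLaw W) C.dec • R) (Real.log 2 / n) (C.hullPoint W) := by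
  have hn' : (0 : ℝ) < n := by exact_mod_cast hn
  set S := successProb (C.letterLaw W) C.dec with hS
  have hS0 : 0 ≤ S := by
    refine mul_nonneg (by positivity) (Finset.sum_nonneg fun w _ => Finset.sum_nonneg fun y _ =>
      mul_nonneg ENNReal.toReal_nonneg ?_)
    split_ifs <;> norm_num
  -- passing from the bound for `n` letters to the bound per letter
  have key : ∀ {r l k : ℝ}, n * (r * Real.log 2) ≤ l → S * l ≤ n * k + Real.log 2 →
      S * r * Real.log 2 ≤ k + Real.log 2 / n := by
    intro r l k h h'
    have h3 : n * (S * r * Real.log 2) ≤ n * (k + Real.log 2 / n) := by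
      rw [mul_add, mul_div_cancel₀ _ hn'.ne']
      calc n * (S * r * Real.log 2) = S * (n * (r * Real.log 2)) := by ring
        _ ≤ S * l := by gcongr
        _ ≤ _ := h'
    exact le_of_mul_le_mul_left h3 hn'
  have l0 := le_log_numIndices n R.1
  have l1 := le_log_numIndices n R.2.1
  have l2 := le_log_numIndices n R.2.2
  have hne : ∀ r, (numIndices n r : ℝ) ≠ 0 := fun r => by exact_mod_cast NeZero.ne _
  have hprod : ∀ i w₀, massFun ((PMF.uniformOfFintype
      (Fin (numIndices n R.2.1) × Fin (numIndices n R.2.2))).map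
        fun b => (C.enc₁ w₀ b.1 i, C.enc₂ w₀ b.2 i)) =
      prodVec (C.inputs i w₀).1 (C.inputs i w₀).2 := fun i w₀ => by
    rw [uniformOfFintype_prod]
    exact (prodVec_massFun (PMF.uniformOfFintype _) (PMF.uniformOfFintype _)
      (fun w₁ => C.enc₁ w₀ w₁ i) fun w₂ => C.enc₂ w₀ w₂ i).symm
  have hk : C.hullPoint W = (n : ℝ)⁻¹ • (numIndices n R.1 : ℝ)⁻¹ •
      ∑ w₀, ∑ i, ratePoint W (C.inputs i w₀) := by
    rw [Finset.sum_comm, Code.hullPoint]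
    simp only [← Finset.smul_sum]
  refine ⟨mul_nonneg hS0 h₀, mul_nonneg hS0 h₁, mul_nonneg hS0 h₂, ?_, ?_, ?_, ?_⟩
  · have hc := successProb_mul_log_card_le_average (A := Unit) (B := Messages n R)
      (Equiv.punitProd _) (V := C.letterLaw W) C.dec (K := fun _ _ (x : X₁ × X₂) => W x.1 x.2)
      (ξ := fun _ w i => (C.enc₁ w.1 w.2.1 i, C.enc₂ w.1 w.2.2 i)) fun _ _ _ => rfl
    have hconc := (concaveOn_chanInfo fun x : X₁ × X₂ => W x.1 x.2).le_map_sum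
      (t := Finset.univ) (w := fun _ : Fin n => (n : ℝ)⁻¹)
      (p := fun i => massFun ((PMF.uniformOfFintype (Messages n R)).map
        fun w => (C.enc₁ w.1 w.2.1 i, C.enc₂ w.1 w.2.2 i)))
      (fun _ _ => by positivity) (by simp [hn'.ne'])
      (fun i _ => Set.mem_Ici.2 fun x => ENNReal.toReal_nonneg)
    have hfst : ∑ i, (n : ℝ)⁻¹ • massFun ((PMF.uniformOfFintype (Messages n R)).map
        fun w => (C.enc₁ w.1 w.2.1 i, C.enc₂ w.1 w.2.2 i)) = (C.hullPoint W).1 := by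
      rw [Code.hullPoint, Prod.fst_sum]
      refine Finset.sum_congr rfl fun i _ => ?_
      rw [Prod.smul_fst, Prod.fst_sum]
      congr 1
      have h1 : (PMF.uniformOfFintype (Messages n R)).map
          (fun w => (C.enc₁ w.1 w.2.1 i, C.enc₂ w.1 w.2.2 i)) =
          (PMF.uniformOfFintype (Fin (numIndices n R.1))).bind fun w₀ =>
            (PMF.uniformOfFintype (Fin (numIndices n R.2.1) × Fin (numIndices n R.2.2))).map
              fun b => (C.enc₁ w₀ b.1 i, C.enc₂ w₀ b.2 i) :=
        pmf_ext_expect fun φ => by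
          simp [uniformOfFintype_prod (Fin (numIndices n R.1)), expect_map, expect_joint,
            expect_bind]
      funext x
      rw [h1, massFun, bind_toReal, Finset.sum_apply]
      refine Finset.sum_congr rfl fun w₀ _ => ?_
      rw [uniform_toReal, Fintype.card_fin, Prod.smul_fst, Pi.smul_apply, smul_eq_mul]
      congr 1
      exact congrFun (hprod i w₀) x
    rw [hfst] at hconc
    have hl : n * ((R.1 + R.2.1 + R.2.2) * Real.log 2) ≤
        Real.log (Fintype.card (Messages n R)) := by
      rw [Fintype.card_prod, Fintype.card_prod, Fintype.card_fin, Fintype.card_fin,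
        Fintype.card_fin, Nat.cast_mul, Nat.cast_mul, Real.log_mul (hne _)
          (mul_ne_zero (hne _) (hne _)), Real.log_mul (hne _) (hne _)]
      linarith
    have := key (k := chanInfo (fun x : X₁ × X₂ => W x.1 x.2) (C.hullPoint W).1) hl (by
      refine hc.trans ?_
      simp only [Fintype.card_unit, Nat.cast_one, inv_one, one_mul, Finset.univ_unique,
        Finset.sum_singleton]
      simp only [smul_eq_mul, ← Finset.mul_sum] at hconc
      have := (inv_mul_le_iff₀ hn').1 hconc
      gcongr)
    simpa [mul_add] using this
  · have hc := successProb_mul_log_card_le_average (A := Fin (numIndices n R.1))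
      (B := Fin (numIndices n R.2.1) × Fin (numIndices n R.2.2))
      (Equiv.refl _) (V := C.letterLaw W) C.dec (K := fun _ _ (x : X₁ × X₂) => W x.1 x.2)
      (ξ := fun w₀ b i => (C.enc₁ w₀ b.1 i, C.enc₂ w₀ b.2 i)) fun _ _ _ => rfl
    have hl : n * ((R.2.1 + R.2.2) * Real.log 2) ≤
        Real.log (Fintype.card (Fin (numIndices n R.2.1) × Fin (numIndices n R.2.2))) := by
      rw [Fintype.card_prod, Fintype.card_fin, Fintype.card_fin, Nat.cast_mul,
        Real.log_mul (hne _) (hne _)]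
      linarith
    have := key (k := (C.hullPoint W).2.1) hl (by
      refine hc.trans (le_of_eq ?_)
      simp only [hk, hprod, Prod.smul_snd, Prod.smul_fst, Prod.snd_sum, Prod.fst_sum, ratePoint,
        smul_eq_mul, Fintype.card_fin]
      rw [mul_inv_cancel_left₀ hn'.ne'])
    simpa [mul_add] using this
  · have hc := successProb_mul_log_card_le_average
      (A := Fin (numIndices n R.1) × Fin (numIndices n R.2.2)) (B := Fin (numIndices n R.2.1))
      (M := Messages n R) ⟨fun z => (z.1.1, z.2, z.1.2), fun w => ((w.1, w.2.2), w.2.1),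
        fun _ => rfl, fun _ => rfl⟩ (V := C.letterLaw W) C.dec
      (K := fun a i (x₁ : X₁) => W x₁ (C.enc₂ a.1 a.2 i))
      (ξ := fun a w₁ i => C.enc₁ a.1 w₁ i) fun _ _ _ => rfl
    rw [Fintype.card_fin] at hc
    have := key (k := (C.hullPoint W).2.2.1) l1 (by
      refine hc.trans (le_of_eq ?_)
      simp only [hk, Prod.smul_snd, Prod.smul_fst, Prod.snd_sum, Prod.fst_sum, ratePoint,
        smul_eq_mul]
      rw [mul_inv_cancel_left₀ hn'.ne', Fintype.card_prod, Fintype.card_fin, Fintype.card_fin,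
        Nat.cast_mul, mul_inv, mul_assoc, Fintype.sum_prod_type, Finset.mul_sum]
      congr 2
      refine Finset.sum_congr rfl fun w₀ _ => ?_
      rw [Finset.sum_comm, Finset.mul_sum]
      refine Finset.sum_congr rfl fun i _ => ?_
      simp only [Code.inputs, massFun]
      rw [sum_map_toReal]
      simp only [uniform_toReal, Fintype.card_fin, Finset.mul_sum])
    simpa using this
  · have hc := successProb_mul_log_card_le_average
      (A := Fin (numIndices n R.1) × Fin (numIndices n R.2.1)) (B := Fin (numIndices n R.2.2))
      (M := Messages n R) (Equiv.prodAssoc _ _ _) (V := C.letterLaw W) C.dec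
      (K := fun a i => W (C.enc₁ a.1 a.2 i))
      (ξ := fun a w₂ i => C.enc₂ a.1 w₂ i) fun _ _ _ => rfl
    rw [Fintype.card_fin] at hc
    have := key (k := (C.hullPoint W).2.2.2) l2 (by
      refine hc.trans (le_of_eq ?_)
      simp only [hk, Prod.smul_snd, Prod.snd_sum, ratePoint, smul_eq_mul]
      rw [mul_inv_cancel_left₀ hn'.ne', Fintype.card_prod, Fintype.card_fin, Fintype.card_fin,
        Nat.cast_mul, mul_inv, mul_assoc, Fintype.sum_prod_type, Finset.mul_sum]
      congr 2
      refine Finset.sum_congr rfl fun w₀ _ => ?_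
      rw [Finset.sum_comm, Finset.mul_sum]
      refine Finset.sum_congr rfl fun i _ => ?_
      simp only [Code.inputs, massFun]
      rw [sum_map_toReal]
      simp only [uniform_toReal, Fintype.card_fin, Finset.mul_sum])
    simpa using this

/-! ### The capacity region -/

theorem capacityRegion_subset_unionSlepianWolfRegion :
    capacityRegion W ⊆ unionSlepianWolfRegion W := by
  intro R hR
  refine mem_unionSlepianWolfRegion_of_supports W ?_
  obtain ⟨x, hx, hlim⟩ := mem_closure_iff_seq_limit.1 hR
  refine exists_supports_of_tendsto W hlim tendsto_const_nhds fun j => ?_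
  obtain ⟨h₀, h₁, h₂, C, hC⟩ := hx j
  have hS : Tendsto (fun n : ℕ => successProb ((C (n + 1)).letterLaw W) (C (n + 1)).dec • x j)
      atTop (𝓝 (x j)) := by
    have h3 := ((ENNReal.tendsto_toReal ENNReal.zero_ne_top).comp hC).comp (tendsto_add_atTop_nat 1)
    have h4 := (tendsto_const_nhds (x := (1 : ℝ))).sub h3
    have h5 := h4.smul_const (x j)
    simp only [ENNReal.toReal_zero, sub_zero, one_smul] at h5
    refine h5.congr fun n => ?_
    simp [Code.errorProb_toReal]
  have hδ : Tendsto (fun n : ℕ => Real.log 2 / ((n + 1 : ℕ) : ℝ)) atTop (𝓝 0) :=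
    (tendsto_const_div_atTop_nhds_zero_nat _).comp (tendsto_add_atTop_nat 1)
  exact exists_supports_of_tendsto W hS hδ fun n =>
    ⟨_, (C (n + 1)).hullPoint_mem W n.succ_pos,
      (C (n + 1)).supports_hullPoint W n.succ_pos h₀ h₁ h₂⟩

theorem unionSlepianWolfRegion_eq_capacityRegion :
    unionSlepianWolfRegion W = capacityRegion W := by
  refine Set.Subset.antisymm ?_ (capacityRegion_subset_unionSlepianWolfRegion W)
  rintro R ⟨k₀, k₁, k₂, P, f₁, f₂, hR⟩
  exact slepianWolfRegion_subset_capacityRegion W f₁ f₂ hR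

end CodeBound

/-- The auxiliary codebook law does not matter, and `Q = P` is always admissible. -/
theorem unionBinningRegion_eq_unionSlepianWolfRegion {X₁ X₂ Y : Type*} [Fintype Y]
    (W : X₁ → X₂ → PMF Y) : unionBinningRegion W = unionSlepianWolfRegion W := by
  apply Set.Subset.antisymm
  · rintro R ⟨k₀, k₁, k₂, P, Q, f₁, f₂, hb, B, hB⟩
    exact ⟨k₀, k₁, k₂, P, f₁, f₂,
      SuperpositionLaw.image_binningRegion_subset W f₁ f₂ hb ⟨_, hB, rfl⟩⟩
  · rintro R ⟨k₀, k₁, k₂, P, f₁, f₂, hR⟩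
    rw [← SuperpositionLaw.image_binningRegion W f₁ f₂ rfl P.satelliteAC_self] at hR
    obtain ⟨⟨R', B⟩, hB, rfl⟩ := hR
    exact ⟨k₀, k₁, k₂, P, P, f₁, f₂, rfl, B, hB⟩


end MACCM

end

theorem mainTheorem3 {X₁ X₂ Y : Type*} [Fintype X₁] [Fintype X₂] [Fintype Y]
    (W : X₁ → X₂ → PMF Y) :
    -- for each pair of an encoding law `P` and a codebook law `Q` with the same law of `U₀`:
    (∀ (U₀ U₁ U₂ : Type*) [Fintype U₀] [Fintype U₁] [Fintype U₂]
        (P Q : SuperpositionLaw U₀ U₁ U₂) (f₁ : U₀ → U₁ → X₁) (f₂ : U₀ → U₂ → X₂),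
        P.base = Q.base →
        -- the random coding scheme succeeds at all rates that satisfy the strict inequalities
        (∀ (R : Rates) (B : ℝ × ℝ), (R, B) ∈ P.strictBinningRegion Q W f₁ f₂ →
          ∀ᶠ ε in 𝓝[>] (0 : ℝ), ∀ᶠ ε' in 𝓝[>] (0 : ℝ),
            Tendsto (fun n => schemeErrorProb P Q W f₁ f₂ R B ε ε' n) atTop (𝓝 0)) ∧
        -- the region is achievable
        Prod.fst '' P.binningRegion Q W f₁ f₂ ⊆ capacityRegion W ∧
        -- eliminating the binning rates gives the Slepian-Wolf inequalities, whatever `Q` is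
        (P.div₁ Q ≠ ⊤ → P.div₂ Q ≠ ⊤ →
          Prod.fst '' P.binningRegion Q W f₁ f₂ = P.slepianWolfRegion W f₁ f₂)) ∧
    -- the union region is the union of the Slepian-Wolf regions, which is the capacity region
    unionBinningRegion W = unionSlepianWolfRegion W ∧
    unionSlepianWolfRegion W = capacityRegion W := by
  refine ⟨fun U₀ U₁ U₂ _ _ _ P Q f₁ f₂ hb => ⟨fun R B hRB => ?_, ?_, fun h₁ h₂ => ?_⟩,
    unionBinningRegion_eq_unionSlepianWolfRegion W, unionSlepianWolfRegion_eq_capacityRegion W⟩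
  · exact SuperpositionLaw.tendsto_of_mem_strictBinningRegion W f₁ f₂ hb hRB
  · exact (SuperpositionLaw.image_binningRegion_subset W f₁ f₂ hb).trans
      (slepianWolfRegion_subset_capacityRegion W f₁ f₂)
  · exact SuperpositionLaw.image_binningRegion W f₁ f₂ hb
      (SuperpositionLaw.satelliteAC_of_ne_top h₁ h₂)
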